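/- **Setting.** Let $\mathcal C$ be a *partially traced category*: a symmetric monoidal category $(\mathcal C,\otimes,I,\sigma)$ with partial functions $\mathrm{Tr}^U_{A,B}:\mathcal C(A\otimes U,B\otimes U)\rightharpoonup\mathcal C(A,B)$ satisfying the following axioms, written as if $\mathcal C$ were strict (in general the associators and unitors are inserted). Here $x\simeq y$ means that $x,y$ are both undefined or both defined and equal, and $x\lesssim y$ means that if $x$ is defined then $y$ is defined and $x=y$. * Naturality: $h\circ\mathrm{Tr}^U(f)\circ g\lesssim\mathrm{Tr}^U((h\otimes 1_U)\circ f\circ(g\otimes 1_U))$ for $f:A\otimes U\to B\otimes U$, $g:A'\to A$, $h:B\to B'$. * Dinaturality: $\mathrm{Tr}^U((1_B\otimes g)\circ f)\simeq\mathrm{Tr}^{U'}(f\circ(1_A\otimes g))$ for $f:A\otimes U\to B\otimes U'$, $g:U'\to U$. * Strength: $g\otimes\mathrm{Tr}^U(f)\lesssim\mathrm{Tr}^U(g\otimes f)$. * Vanishing I: $\mathrm{Tr}^I(f)\simeq f$. * Vanishing II: for $f:A\otimes U\otimes V\to B\otimes U\otimes V$, if $\mathrm{Tr}^V(f)$ is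 defined, then $\mathrm{Tr}^U(\mathrm{Tr}^V(f))\simeq\mathrm{Tr}^{U\otimes V}(f)$. * Yanking: $\mathrm{Tr}^A(\sigma_{A,A})\simeq 1_A$. *The graph $\mathrm{Int}^p(\mathcal C)$.* Its objects are pairs $(A^+,A^-)$ of objects of $\mathcal C$, and its arrows $(A^+,A^-)\to(B^+,B^-)$ are the morphisms $A^+\otimes B^-\to B^+\otimes A^-$ of $\mathcal C$. For a path $\vec p=p_1,\dots,p_n$ with $p_i:(A_{i-1}^+,A_{i-1}^-)\to(A_i^+,A_i^-)$, put $V=A_0^-\otimes\cdots\otimes A_{n-1}^-$ and define $\langle\vec p\,\rangle:A_0^+\otimes V\otimes A_n^-\to A_n^+\otimes A_0^-\otimes V$ by recursion: $\langle\ \rangle=1_{A_0^+\otimes A_0^-}$, and $\langle\vec p,f\rangle$ applies $\langle\vec p\,\rangle$ to the factors $A_0^+,V,A_n^-$, then $f$ to the factors $A_n^+,A_{n+1}^-$, and then moves the output $A_n^-$ of $f$ to the last place by symmetries. The partial composition is $[\vec p\,]:\simeq\mathrm{Tr}^{V}\big(\langle\vec p\,\rangle\circ(1_{A_0^+}\otimes\sigma_{A_n^-,V})\big)$.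 The tensor product is $(A^+,A^-)\otimes(B^+,B^-)=(A^+\otimes B^+,B^-\otimes A^-)$ on objects, and places two arrows side by side (up to symmetries of $\mathcal C$) on arrows; the unit is $(I,I)$, and $1_{(A^+,A^-)}$ is the identity of $A^+\otimes A^-$ in $\mathcal C$. *The category $\mathrm{Path}(\mathrm{Int}^p(\mathcal C))/{\sim}$.* Let $\sim$ be the smallest family of equivalence relations on parallel paths of $\mathrm{Int}^p(\mathcal C)$ that is stable under concatenation, stable under $1\otimes(-)$ and $(-)\otimes 1$ applied arrow by arrow, and satisfies $\vec p\sim[\vec p\,]$ whenever $[\vec p\,]$ is defined. The category $\mathrm{Path}(\mathrm{Int}^p(\mathcal C))/{\sim}$ has the objects of $\mathrm{Int}^p(\mathcal C)$, classes of paths as morphisms, and concatenation as composition. It is symmetric monoidal with the tensor product above on objects, $\vec f\otimes\vec g=(\vec f\otimes 1),(1\otimes\vec g)$ on morphisms, and the symmetry of $(A^+,A^-)$ and $(B^+,B^-)$ given by $\sigma_{A^+,B^+}\otimes\sigma_{A^-,B^-}$. *The maps $N$ and $F$.* $N:\mathcal C\to\mathrm{Int}^p(\mathcal C)$ is given by $N(A)=(A,I)$,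 $N(f)=f\otimes 1_I$, and $F:\mathrm{Int}^p(\mathcal C)\to\mathrm{Path}(\mathrm{Int}^p(\mathcal C))/{\sim}$ is the identity on objects and sends an arrow to the class of the corresponding path of length one. The composite $F\circ N$ is a strong symmetric monoidal functor. **Theorem.** Let $\mathcal C$ be a partially traced category and let $\mathcal D$ be a compact closed category, with its canonical trace $$\mathrm{Tr}^U(f)=\big(A\xrightarrow{1\otimes\eta}A\otimes U^*\otimes U\xrightarrow{1\otimes\sigma}A\otimes U\otimes U^*\xrightarrow{f\otimes 1}B\otimes U\otimes U^*\xrightarrow{1\otimes\varepsilon}B\big).$$ Let $(G,m):\mathcal C\to\mathcal D$ be a traced symmetric monoidal functor, i.e. a strong symmetric monoidal functor such that, for every $f:A\otimes U\to B\otimes U$ for which $\mathrm{Tr}^U(f)$ is defined, $\mathrm{Tr}^{GU}(m_{B,U}^{-1}\circ G(f)\circ m_{A,U})=G(\mathrm{Tr}^U(f))$. Then there is an essentially unique strong symmetric monoidal functor $L:\mathrm{Path}(\mathrm{Int}^p(\mathcal C))/{\sim}\to\mathcal D$ with $L\circ F\circ N\cong G$. Precisely: 1. there are a strong symmetric monoidal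 functor $L$ and a monoidal natural isomorphism $\varphi:L\circ F\circ N\Rightarrow G$; 2. for any two such pairs $(L,\varphi)$ and $(L',\varphi')$ there is exactly one monoidal natural isomorphism $\theta:L\Rightarrow L'$ with $\varphi'\circ(\theta FN)=\varphi$. -/

import Mathlib

open CategoryTheory MonoidalCategory

universe v₁ u₁ v₂ u₂ v u

set_option linter.unusedSectionVars false

namespace PartialTrace

variable {C : Type u} [Category.{v} C] [MonoidalCategory C] [SymmetricCategory C]

/-- The canonical symmetry `X ⊗ Y ⊗ Z ⟶ X ⊗ Z ⊗ Y` exchanging the last two factors of a product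
bracketed to the left. -/
def sw (X Y Z : C) : (X ⊗ Y) ⊗ Z ⟶ (X ⊗ Z) ⊗ Y :=
  (α_ X Y Z).hom ≫ X ◁ (β_ Y Z).hom ≫ (α_ X Z Y).inv

lemma sw_sw (X Y Z : C) : sw X Y Z ≫ sw X Z Y = 𝟙 _ := by
  simp [sw, ← MonoidalCategory.whiskerLeft_comp_assoc]

lemma sw_nat_head {X X' : C} (f : X ⟶ X') (Y Z : C) :
    (f ▷ Y) ▷ Z ≫ sw X' Y Z = sw X Y Z ≫ (f ▷ Z) ▷ Y := by
  simp only [sw, associator_naturality_left_assoc, Category.assoc, ← associator_inv_naturality_left]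
  rw [whisker_exchange_assoc]

lemma sw_nat_mid (X : C) {Y Y' : C} (f : Y ⟶ Y') (Z : C) :
    (X ◁ f) ▷ Z ≫ sw X Y' Z = sw X Y Z ≫ (X ⊗ Z) ◁ f := by
  simp only [sw, associator_naturality_middle_assoc, Category.assoc,
    ← associator_inv_naturality_right, ← MonoidalCategory.whiskerLeft_comp_assoc,
    BraidedCategory.braiding_naturality_left]

lemma sw_nat_last (X Y : C) {Z Z' : C} (f : Z ⟶ Z') :
    (X ⊗ Y) ◁ f ≫ sw X Y Z' = sw X Y Z ≫ (X ◁ f) ▷ Y := by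
  simp only [sw, associator_naturality_right_assoc, Category.assoc,
    ← associator_inv_naturality_middle, ← MonoidalCategory.whiskerLeft_comp_assoc,
    BraidedCategory.braiding_naturality_right]

lemma sw_tensor_mid (X Y Z W : C) :
    (α_ X Y Z).inv ▷ W ≫ sw (X ⊗ Y) Z W ≫ sw X Y W ▷ Z = sw X (Y ⊗ Z) W ≫ (α_ _ _ _).inv := by
  simp [sw]

lemma sw_tensor_last (X Y Z W : C) :
    (α_ (X ⊗ Y) Z W).inv ≫ sw X Y Z ▷ W ≫ sw (X ⊗ Z) Y W = sw X Y (Z ⊗ W) ≫ (α_ _ _ _).inv ▷ Y := by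
  simp [sw]

lemma sw_tensor_head (X Y Z W : C) :
    sw (X ⊗ Y) Z W = (α_ X Y Z).hom ▷ W ≫ (α_ X (Y ⊗ Z) W).hom ≫ X ◁ sw Y Z W ≫
      (α_ X (Y ⊗ W) Z).inv ≫ (α_ X Y W).inv ▷ Z := by
  simp [sw]

lemma sw_unit_mid (X Y : C) : sw X (𝟙_ C) Y = (ρ_ X).hom ▷ Y ≫ (ρ_ _).inv := by
  simp [sw]

lemma sw_unit_last (X Y : C) : sw X Y (𝟙_ C) = (ρ_ _).hom ≫ (ρ_ X).inv ▷ Y := by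
  simp [sw]

lemma sw_eq_braid (X Y Z : C) : X ◁ (β_ Y Z).hom = (α_ _ _ _).inv ≫ sw X Y Z ≫ (α_ _ _ _).hom := by
  simp [sw]

/-- The braid relation. -/
lemma sw_braid (X Y Z W : C) :
    sw X Y Z ▷ W ≫ sw (X ⊗ Z) Y W ≫ sw X Z W ▷ Y =
      sw (X ⊗ Y) Z W ≫ sw X Y W ▷ Z ≫ sw (X ⊗ W) Y Z := by
  have h1 := sw_tensor_last X Y Z W
  have h2 := sw_tensor_last X Y W Z
  have h3 := sw_nat_last X Y (β_ Z W).hom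
  simp only [comp_whiskerRight, Category.assoc, sw_eq_braid] at h3
  rw [← reassoc_of% h1, cancel_epi] at h3
  rw [← cancel_mono ((α_ X W Z).hom ▷ Y)]
  simp only [Category.assoc]
  rw [← h3, ← cancel_mono ((α_ X W Z).inv ▷ Y)]
  simp [← h2]

lemma sw_sw_w (X Y Z V : C) {W : C} (h : ((X ⊗ Y) ⊗ Z) ⊗ V ⟶ W) :
    sw X Y Z ▷ V ≫ sw X Z Y ▷ V ≫ h = h := by
  rw [← comp_whiskerRight_assoc, sw_sw, id_whiskerRight, Category.id_comp]

lemma sw_braid_w (X Y Z W V : C) {T : C} (h : (((X ⊗ W) ⊗ Z) ⊗ Y) ⊗ V ⟶ T) :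
    sw X Y Z ▷ W ▷ V ≫ sw (X ⊗ Z) Y W ▷ V ≫ sw X Z W ▷ Y ▷ V ≫ h =
      sw (X ⊗ Y) Z W ▷ V ≫ sw X Y W ▷ Z ▷ V ≫ sw (X ⊗ W) Y Z ▷ V ≫ h := by
  simpa only [comp_whiskerRight, Category.assoc] using
    congrArg (fun t => t ▷ V ≫ h) (sw_braid X Y Z W)

lemma sw_nat_head_w {X X' : C} (f : X ⟶ X') (Y Z V : C) {T : C} (h : ((X' ⊗ Z) ⊗ Y) ⊗ V ⟶ T) :
    f ▷ Y ▷ Z ▷ V ≫ sw X' Y Z ▷ V ≫ h = sw X Y Z ▷ V ≫ f ▷ Z ▷ Y ▷ V ≫ h := by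
  simpa only [comp_whiskerRight, Category.assoc] using
    congrArg (fun t => t ▷ V ≫ h) (sw_nat_head f Y Z)

lemma hom_inv_ww {X Y : C} (e : X ≅ Y) (V W : C) {T : C} (h : (X ⊗ V) ⊗ W ⟶ T) :
    e.hom ▷ V ▷ W ≫ e.inv ▷ V ▷ W ≫ h = h := by
  rw [← comp_whiskerRight_assoc, ← comp_whiskerRight]; simp

lemma inv_hom_ww {X Y : C} (e : X ≅ Y) (V W : C) {T : C} (h : (Y ⊗ V) ⊗ W ⟶ T) :
    e.inv ▷ V ▷ W ≫ e.hom ▷ V ▷ W ≫ h = h := hom_inv_ww e.symm V W h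

/-- A partial trace on a symmetric monoidal category. A value `tr U f : Part (A ⟶ B)` may be
undefined. Equality of elements of `Part` is Kleene equality (both sides undefined, or both defined
and equal), and `x ≤ y` in `Part` is directed Kleene equality (if `x` is defined, then `y` is
defined and equal to `x`). -/
class PartiallyTraced (C : Type u) [Category.{v} C] [MonoidalCategory C] [SymmetricCategory C] where
  tr {A B : C} (U : C) (f : A ⊗ U ⟶ B ⊗ U) : Part (A ⟶ B)
  naturality {A B A' B' U : C} (f : A ⊗ U ⟶ B ⊗ U) (g : A' ⟶ A) (h : B ⟶ B') :
    (tr U f).map (fun t => g ≫ t ≫ h) ≤ tr U (g ▷ U ≫ f ≫ h ▷ U)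
  dinaturality {A B U U' : C} (f : A ⊗ U ⟶ B ⊗ U') (g : U' ⟶ U) :
    tr U (f ≫ B ◁ g) = tr U' (A ◁ g ≫ f)
  strength {A B X Y U : C} (f : A ⊗ U ⟶ B ⊗ U) (g : X ⟶ Y) :
    (tr U f).map (fun t => g ⊗ₘ t) ≤ tr U ((α_ X A U).hom ≫ (g ⊗ₘ f) ≫ (α_ Y B U).inv)
  vanishing_one {A B : C} (f : A ⊗ 𝟙_ C ⟶ B ⊗ 𝟙_ C) :
    tr (𝟙_ C) f = Part.some ((ρ_ A).inv ≫ f ≫ (ρ_ B).hom)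
  vanishing_two {A B U V : C} (f : (A ⊗ U) ⊗ V ⟶ (B ⊗ U) ⊗ V) :
    (tr V f).Dom → (tr V f).bind (tr U) = tr (U ⊗ V) ((α_ A U V).inv ≫ f ≫ (α_ B U V).hom)
  yanking (A : C) : tr A (β_ A A).hom = Part.some (𝟙 A)

open PartiallyTraced

lemma tr_yank [PartiallyTraced C] {P Q R U : C} (h : P ⟶ R ⊗ U) (k : R ⊗ U ⟶ Q) :
    tr U (h ▷ U ≫ sw R U U ≫ k ▷ U) = Part.some (h ≫ k) := by
  rw [Part.eq_some_iff]
  have h1 : 𝟙 U ∈ tr U (β_ U U).hom := by rw [yanking]; exact Part.mem_some _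
  have h2 := strength (β_ U U).hom (𝟙 R) _ (Part.mem_map _ h1)
  have h3 := naturality _ h k _ (Part.mem_map _ h2)
  simpa [sw] using h3

lemma tr_two [PartiallyTraced C] {A B U V : C} (f : (A ⊗ U) ⊗ V ⟶ (B ⊗ U) ⊗ V) {t : A ⊗ U ⟶ B ⊗ U}
    (h : tr V f = Part.some t) :
    tr (U ⊗ V) ((α_ A U V).inv ≫ f ≫ (α_ B U V).hom) = tr U t := by
  rw [← vanishing_two f (by simp [h]), h, Part.bind_some]

lemma tr_conj [PartiallyTraced C] {A B U V : C} (e : U ≅ V) (f : A ⊗ U ⟶ B ⊗ U) :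
    tr U f = tr V (A ◁ e.inv ≫ f ≫ B ◁ e.hom) := by
  rw [← dinaturality]
  simp [← MonoidalCategory.whiskerLeft_comp]

variable (C) in
/-- The objects of the graph `Intᵖ(C)`: pairs `(A⁺, A⁻)` of objects of `C`. -/
structure IntP where
  /-- the component `A⁺` -/
  pos : C
  /-- the component `A⁻` -/
  neg : C

namespace IntP

/-- The arrows of the graph `Intᵖ(C)`. -/
@[ext]
structure Hom (A B : IntP C) where
  /-- the underlying morphism of `C` -/
  hom : A.pos ⊗ B.neg ⟶ B.pos ⊗ A.neg

instance : Quiver (IntP C) where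
  Hom A B := Hom A B

/-- For a path `(A₀⁺, A₀⁻) → ⋯ → (Aₙ⁺, Aₙ⁻)`, the object `A₀⁻ ⊗ ⋯ ⊗ Aₙ₋₁⁻`
(bracketed to the left, with a leading unit) over which one traces. -/
def loop {A : IntP C} : {B : IntP C} → Quiver.Path A B → C
  | _, .nil => 𝟙_ C
  | _, @Quiver.Path.cons _ _ _ B _ p _ => loop p ⊗ B.neg

/-- Precomposition: for a path `p₁, …, pₙ` from `(A₀⁺, A₀⁻)` to `(Aₙ⁺, Aₙ⁻)` with
`V = A₀⁻ ⊗ ⋯ ⊗ Aₙ₋₁⁻`, a morphism `A₀⁺ ⊗ V ⊗ Aₙ⁻ ⟶ Aₙ⁺ ⊗ A₀⁻ ⊗ V`. For the empty path it is the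
identity of `A₀⁺ ⊗ A₀⁻` (up to the unit `V`). For a path `p` followed by `f` one runs `pre p` on
`A₀⁺ ⊗ V ⊗ Aₙ⁻`, then `f` on the factors `Aₙ⁺` and `Aₙ₊₁⁻`, and moves the output `Aₙ⁻` of `f` to
the last place. -/
def pre {A : IntP C} : {B : IntP C} → (p : Quiver.Path A B) →
    ((A.pos ⊗ loop p) ⊗ B.neg ⟶ (B.pos ⊗ A.neg) ⊗ loop p)
  | _, .nil => (ρ_ A.pos).hom ▷ A.neg ≫ (ρ_ (A.pos ⊗ A.neg)).inv
  | B', @Quiver.Path.cons _ _ _ B _ p f =>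
      (α_ A.pos (loop p) B.neg).inv ▷ B'.neg ≫ pre p ▷ B'.neg ≫
        sw (B.pos ⊗ A.neg) (loop p) B'.neg ≫ sw B.pos A.neg B'.neg ▷ loop p ≫
        (f.hom ▷ A.neg) ▷ loop p ≫
        sw B'.pos B.neg A.neg ▷ loop p ≫ sw (B'.pos ⊗ A.neg) B.neg (loop p) ≫
        (α_ (B'.pos ⊗ A.neg) (loop p) B.neg).hom

variable [PartiallyTraced C]

/-- The partial composition of a path: a single trace over `loop p`. -/
def comp {A B : IntP C} (p : Quiver.Path A B) : Part (A ⟶ B) :=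
  (tr (loop p) (sw A.pos B.neg (loop p) ≫ pre p)).map Hom.mk

lemma pre_one {X Y : IntP C} (f : X ⟶ Y) :
    pre f.toPath = (X.pos ◁ (λ_ X.neg).hom) ▷ Y.neg ≫ sw X.pos X.neg Y.neg ≫ f.hom ▷ X.neg ≫
      sw Y.pos X.neg X.neg ≫ (Y.pos ⊗ X.neg) ◁ (λ_ X.neg).inv := by
  simp only [pre, loop, Quiver.Hom.toPath, sw_unit_mid, sw_unit_last]
  simp
  monoidal

lemma comp_two_aux {X Y Z Y' Z' T x : C} (f : X ⊗ Y ⟶ Y' ⊗ x) (g : Y' ⊗ Z ⟶ Z' ⊗ T) :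
    sw (X ⊗ Z) Y x ≫ sw X Z x ▷ Y ≫ sw (X ⊗ x) Z Y ≫ sw X x Y ▷ Z ≫ f ▷ x ▷ Z ≫
      sw Y' x x ▷ Z ≫ sw (Y' ⊗ x) x Z ≫ sw Y' x Z ▷ x ≫ g ▷ x ▷ x =
    sw X Z Y ▷ x ≫ f ▷ Z ▷ x ≫ sw Y' x Z ▷ x ≫ g ▷ x ▷ x ≫ sw (Z' ⊗ T) x x := by
  rw [sw_nat_head g, reassoc_of% sw_braid Y' x x Z, reassoc_of% sw_nat_head f,
    ← reassoc_of% sw_braid X Z Y x]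
  simp only [← comp_whiskerRight_assoc, sw_sw, id_whiskerRight, Category.id_comp,
    reassoc_of% sw_sw]

lemma comp_two {X Y Z : IntP C} (f : X ⟶ Y) (g : Y ⟶ Z) :
    comp (f.toPath.cons g) = (tr Y.neg (sw X.pos Z.neg Y.neg ≫ f.hom ▷ Z.neg ≫
      sw Y.pos X.neg Z.neg ≫ g.hom ▷ X.neg ≫ sw Z.pos Y.neg X.neg)).map Hom.mk := by
  let e : loop (f.toPath.cons g) ≅ Y.neg ⊗ X.neg :=
    (whiskerRightIso (λ_ X.neg) Y.neg) ≪≫ (β_ Y.neg X.neg).symm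
  have h1 := tr_yank (U := X.neg) (sw X.pos Z.neg Y.neg ≫ f.hom ▷ Z.neg ≫
      sw Y.pos X.neg Z.neg ≫ g.hom ▷ X.neg) (sw Z.pos Y.neg X.neg)
  have h2 := tr_two _ h1
  simp only [Category.assoc] at h2
  rw [← h2, comp, tr_conj e]
  congr 2
  have h3 := comp_two_aux f.hom g.hom
  have h4 : sw (X.pos ⊗ Z.neg) Y.neg X.neg ≫ sw X.pos Z.neg X.neg ▷ Y.neg ≫ sw (X.pos ⊗ X.neg) Z.neg Y.neg =
    (α_ _ _ _).hom ≫ _ ◁ (β_ _ _).hom ≫ sw X.pos Z.neg (X.neg ⊗ Y.neg) ≫ (α_ _ _ _).inv ▷ _ := by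
    rw [← sw_tensor_last, sw_eq_braid]; simp
  have e1 : e.inv = (β_ _ _).hom ≫ (λ_ X.neg).inv ▷ Y.neg := rfl
  have e2 : e.hom = (λ_ X.neg).hom ▷ Y.neg ≫ (β_ _ _).hom := by
    rw [SymmetricCategory.braiding_swap_eq_inv_braiding]; rfl
  rw [pre, pre_one, e1, e2]
  simp only [loop, Quiver.Hom.toPath, MonoidalCategory.whiskerLeft_comp, Category.assoc,
    comp_whiskerRight]
  rw [reassoc_of% sw_nat_last X.pos Z.neg ((λ_ X.neg).inv ▷ Y.neg)]
  have h5 : (X.pos ◁ (λ_ X.neg).inv ▷ Y.neg) ▷ Z.neg ≫ (α_ X.pos (𝟙_ C ⊗ X.neg) Y.neg).inv ▷ Z.neg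
      ≫ (X.pos ◁ (λ_ X.neg).hom) ▷ Y.neg ▷ Z.neg = (α_ _ _ _).inv ▷ Z.neg := by
    simp only [← comp_whiskerRight]
    simp
  rw [reassoc_of% h5, reassoc_of% sw_nat_mid (Y.pos ⊗ X.neg) (λ_ X.neg).inv Z.neg]
  simp only [reassoc_of% whisker_exchange]
  rw [reassoc_of% sw_nat_last (Z.pos ⊗ X.neg) Y.neg (λ_ X.neg).inv]
  have h6 : ((Z.pos ⊗ X.neg) ◁ (λ_ X.neg).inv) ▷ Y.neg ≫
      (α_ (Z.pos ⊗ X.neg) (𝟙_ C ⊗ X.neg) Y.neg).hom ≫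
      (Z.pos ⊗ X.neg) ◁ (λ_ X.neg).hom ▷ Y.neg = (α_ _ _ _).hom := by
    rw [← associator_naturality_middle]; simp
  have h7 : (α_ (Z.pos ⊗ X.neg) X.neg Y.neg).hom ≫ (Z.pos ⊗ X.neg) ◁ (β_ X.neg Y.neg).hom =
      sw (Z.pos ⊗ X.neg) X.neg Y.neg ≫ (α_ _ _ _).hom := by simp [sw]
  rw [reassoc_of% h6, h7, reassoc_of% sw_sw]
  rw [← cancel_epi (α_ _ _ _).hom, ← reassoc_of% h4, Iso.hom_inv_id_assoc, reassoc_of% h3]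

/-- The arrow of `Intᵖ(C)` given by a pair of morphisms `u : A⁺ ⟶ B⁺` and `v : B⁻ ⟶ A⁻`. -/
def pair {A B : IntP C} (u : A.pos ⟶ B.pos) (v : B.neg ⟶ A.neg) : A ⟶ B := ⟨u ⊗ₘ v⟩

lemma comp_pair {X A B : IntP C} (f : X ⟶ A) (u : A.pos ⟶ B.pos) (v : B.neg ⟶ A.neg) :
    comp (f.toPath.cons (pair u v)) = Part.some ⟨X.pos ◁ v ≫ f.hom ≫ u ▷ X.neg⟩ := by
  have h := tr_yank (X.pos ◁ v) (f.hom ≫ u ▷ X.neg)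
  rw [comp_two, ← Part.map_some, ← h]
  congr 2
  simp only [pair, MonoidalCategory.tensorHom_def, comp_whiskerRight, Category.assoc, sw_nat_mid]
  rw [reassoc_of% sw_nat_head u, reassoc_of% sw_sw, ← whisker_exchange, ← reassoc_of% whisker_exchange,
    ← reassoc_of% sw_nat_mid]

lemma pair_comp {X A B : IntP C} (u : X.pos ⟶ A.pos) (v : A.neg ⟶ X.neg) (f : A ⟶ B) :
    comp ((pair u v).toPath.cons f) = Part.some ⟨u ▷ B.neg ≫ f.hom ≫ B.pos ◁ v⟩ := by
  have h := tr_yank (u ▷ B.neg ≫ f.hom) (B.pos ◁ v)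
  rw [← Category.assoc, comp_two, ← Part.map_some, ← h]
  congr 2
  simp only [pair, MonoidalCategory.tensorHom_def, comp_whiskerRight, Category.assoc]
  rw [reassoc_of% sw_nat_mid A.pos v B.neg, ← reassoc_of% sw_nat_head u, reassoc_of% sw_sw,
    reassoc_of% whisker_exchange, sw_nat_last]

lemma sw_block (Z y w q z : C) : sw Z (y ⊗ w) (q ⊗ z) =
    (α_ (Z ⊗ (y ⊗ w)) q z).inv ≫ (α_ Z y w).inv ▷ q ▷ z ≫ sw (Z ⊗ y) w q ▷ z ≫ sw Z y q ▷ w ▷ z ≫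
      sw ((Z ⊗ q) ⊗ y) w z ≫ sw (Z ⊗ q) y z ▷ w ≫ (α_ Z q z).hom ▷ y ▷ w ≫ (α_ _ _ _).hom := by
  simp [sw]
  monoidal

/-- Exchange of the last factors of the two blocks `y ⊗ w` and `q ⊗ z`. -/
def th (Z y w q z : C) : (Z ⊗ (y ⊗ w)) ⊗ (q ⊗ z) ⟶ (Z ⊗ (y ⊗ z)) ⊗ (q ⊗ w) :=
  (α_ (Z ⊗ (y ⊗ w)) q z).inv ≫ (α_ Z y w).inv ▷ q ▷ z ≫ sw (Z ⊗ y) w q ▷ z ≫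
    sw ((Z ⊗ y) ⊗ q) w z ≫ sw (Z ⊗ y) q z ▷ w ≫ (α_ Z y z).hom ▷ q ▷ w ≫ (α_ _ _ _).hom

lemma th_sw (Z y w q z : C) : th Z y w q z ≫ sw Z (y ⊗ z) (q ⊗ w) =
    (α_ (Z ⊗ (y ⊗ w)) q z).inv ≫ ((α_ Z y w).inv ≫ sw Z y w) ▷ q ▷ z ≫ sw (Z ⊗ w) y q ▷ z ≫
      (sw Z w q ≫ (α_ _ _ _).hom) ▷ y ▷ z ≫ (α_ _ _ _).hom := by
  simp only [th, sw_block, comp_whiskerRight, Category.assoc, Iso.hom_inv_id_assoc]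
  rw [hom_inv_ww, sw_sw_w, reassoc_of% sw_nat_head (sw Z y q) z w, reassoc_of% sw_sw,
    sw_braid_w]

/-- `f` acting on the outer factors `a` and `p` of `(a ⊗ b) ⊗ (y ⊗ p)`. -/
def outer {a p a' s : C} (f : a ⊗ p ⟶ a' ⊗ s) (b y : C) : (a ⊗ b) ⊗ (y ⊗ p) ⟶ (a' ⊗ b) ⊗ (y ⊗ s) :=
  (α_ (a ⊗ b) y p).inv ≫ sw (a ⊗ b) y p ≫ sw a b p ▷ y ≫ f ▷ b ▷ y ≫ sw a' s b ▷ y ≫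
    sw (a' ⊗ b) s y ≫ (α_ (a' ⊗ b) y s).hom

lemma outer_exchange {a p a' s : C} (f : a ⊗ p ⟶ a' ⊗ s) (b y q : C) :
    sw (a ⊗ b) (y ⊗ p) (q ⊗ p) ≫ outer f b q ▷ (y ⊗ p) ≫ sw (a' ⊗ b) (q ⊗ s) (y ⊗ p) =
      th (a ⊗ b) y p q p ≫ outer f b y ▷ (q ⊗ p) ≫ th (a' ⊗ b) y s q p := by
  simp only [sw_block, outer, th, comp_whiskerRight, Category.assoc, whiskerRight_tensor,
    Iso.hom_inv_id_assoc, Iso.inv_hom_id_assoc, hom_inv_ww, inv_hom_ww]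
  rw [reassoc_of% sw_nat_head (sw (a ⊗ b) y q) p p, sw_braid_w (a ⊗ b) y q p p,
    ← sw_nat_head_w (sw a b p) y q p, ← sw_nat_head_w (f ▷ b) y q p,
    ← sw_nat_head_w (sw a' s b) y q p, ← sw_braid_w (a' ⊗ b) s y q p,
    ← comp_whiskerRight_assoc (sw (a' ⊗ b) y q ▷ s) (sw (a' ⊗ b) q y ▷ s), ← comp_whiskerRight,
    sw_sw, id_whiskerRight, id_whiskerRight, Category.id_comp]

/-- `g` acting on the inner factors `b` and `y` of `(a ⊗ b) ⊗ (y ⊗ p)`. -/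
def inner {b y b' q : C} (g : b ⊗ y ⟶ b' ⊗ q) (a p : C) : (a ⊗ b) ⊗ (y ⊗ p) ⟶ (a ⊗ b') ⊗ (q ⊗ p) :=
  (α_ (a ⊗ b) y p).inv ≫ (α_ a b y).hom ▷ p ≫ (a ◁ g) ▷ p ≫ (α_ a b' q).inv ▷ p ≫
   (α_ (a ⊗ b') q p).hom

lemma th_inner {b y b' q' : C} (g : b ⊗ y ⟶ b' ⊗ q') (a s q p : C) :
    th (a ⊗ b) y s q p ≫ inner g a p ▷ (q ⊗ s) = inner g a s ▷ (q ⊗ p) ≫ th (a ⊗ b') q' s q p := by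
  simp only [inner, th, comp_whiskerRight, Category.assoc, whiskerRight_tensor,
    Iso.hom_inv_id_assoc, Iso.inv_hom_id_assoc, hom_inv_ww, inv_hom_ww]
  have n := fun {X X' : C} (k : X ⟶ X') => sw_nat_head (k ▷ q) s p
  rw [sw_nat_head_w (α_ a b' q').inv, reassoc_of% n, sw_nat_head_w (α_ a b' q').inv,
    sw_nat_head_w (a ◁ g), reassoc_of% n, sw_nat_head_w (a ◁ g),
    sw_nat_head_w (α_ a b y).hom, reassoc_of% n, sw_nat_head_w (α_ a b y).hom]

/-- The two morphisms side by side: `f` on the factors `a`, `p` and `g` on the factors `b`, `y`. -/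
def tensHom {a p a' s b y b' q : C} (f : a ⊗ p ⟶ a' ⊗ s) (g : b ⊗ y ⟶ b' ⊗ q) :
    (a ⊗ b) ⊗ (y ⊗ p) ⟶ (a' ⊗ b') ⊗ (q ⊗ s) :=
  (α_ (a ⊗ b) y p).inv ≫ (α_ a b y).hom ▷ p ≫ sw a (b ⊗ y) p ≫ (f ⊗ₘ g) ≫
    sw a' s (b' ⊗ q) ≫ (α_ a' b' q).inv ▷ s ≫ (α_ (a' ⊗ b') q s).hom

lemma outer_eq {a p a' s : C} (f : a ⊗ p ⟶ a' ⊗ s) (b y : C) : outer f b y =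
    (α_ (a ⊗ b) y p).inv ≫ (α_ a b y).hom ▷ p ≫ sw a (b ⊗ y) p ≫ f ▷ (b ⊗ y) ≫
    sw a' s (b ⊗ y) ≫ (α_ a' b y).inv ▷ s ≫ (α_ (a' ⊗ b) y s).hom := by
  rw [← reassoc_of% sw_tensor_last, whiskerRight_tensor]
  simp only [Category.assoc, Iso.hom_inv_id_assoc]
  rw [← reassoc_of% sw_tensor_mid, hom_inv_whiskerRight_assoc, outer]

lemma tensHom_eq {a p a' s b y b' q : C} (f : a ⊗ p ⟶ a' ⊗ s) (g : b ⊗ y ⟶ b' ⊗ q) :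
    tensHom f g = outer f b y ≫ inner g a' s := by
  rw [outer_eq]
  simp only [tensHom, inner, MonoidalCategory.tensorHom_def, Category.assoc, Iso.hom_inv_id_assoc,
    inv_hom_whiskerRight_assoc]
  rw [reassoc_of% sw_nat_last a' s g]

lemma tensHom_eq' {a p a' s b y b' q : C} (f : a ⊗ p ⟶ a' ⊗ s) (g : b ⊗ y ⟶ b' ⊗ q) :
    tensHom f g = inner g a p ≫ outer f b' q := by
  rw [outer_eq]
  simp only [tensHom, inner, MonoidalCategory.tensorHom_def', Category.assoc, Iso.hom_inv_id_assoc,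
    inv_hom_whiskerRight_assoc]
  rw [reassoc_of% sw_nat_mid a g p]

lemma tensHom_id_left {b y b' q : C} (g : b ⊗ y ⟶ b' ⊗ q) (a p : C) :
    tensHom (𝟙 (a ⊗ p)) g = inner g a p := by
  rw [tensHom_eq', outer_eq]
  simp [reassoc_of% sw_sw]

lemma tensHom_id_right {a p a' s : C} (f : a ⊗ p ⟶ a' ⊗ s) (b y : C) :
    tensHom f (𝟙 (b ⊗ y)) = outer f b y := by
  rw [tensHom_eq, inner]
  simp

/-- The tensor product of objects: `(A⁺, A⁻) ⊗ (B⁺, B⁻) = (A⁺ ⊗ B⁺, B⁻ ⊗ A⁻)`. -/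
abbrev tensorObj (A B : IntP C) : IntP C := ⟨A.pos ⊗ B.pos, B.neg ⊗ A.neg⟩

/-- The tensor product of arrows of `Intᵖ(C)`. -/
def tensorHom {A B A' B' : IntP C} (f : A ⟶ A') (g : B ⟶ B') : tensorObj A B ⟶ tensorObj A' B' :=
  ⟨tensHom f.hom g.hom⟩

/-- The identity arrow of `Intᵖ(C)`, whose underlying morphism is the identity of `A⁺ ⊗ A⁻`. -/
def ident (A : IntP C) : A ⟶ A := ⟨𝟙 _⟩

lemma exchange_aux {A B A' B' : IntP C} (f : A ⟶ A') (g : B ⟶ B') :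
    comp ((tensorHom f (ident B)).toPath.cons (tensorHom (ident A') g)) =
      Part.some (tensorHom f g) := by
  rw [comp_two]
  simp only [tensorHom, ident, tensHom_id_left, tensHom_id_right, tensorObj]
  rw [reassoc_of% outer_exchange]
  rw [reassoc_of% th_inner, th_sw, ← comp_whiskerRight_assoc, ← tensHom_eq]
  have h1 := tr_yank (U := A'.neg) (P := ((A.pos ⊗ B.pos) ⊗ B'.neg ⊗ A'.neg) ⊗ B.neg)
    ((α_ _ _ _).inv ▷ B.neg ≫ sw ((A.pos ⊗ B.pos) ⊗ B'.neg) A'.neg B.neg)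
    ((sw ((A.pos ⊗ B.pos) ⊗ B'.neg) B.neg A'.neg) ≫ (α_ _ _ _).hom ▷ B.neg ≫
      tensHom f.hom g.hom ▷ B.neg ≫ ((α_ _ _ _).inv ≫ sw _ _ _) ▷ B.neg ≫ sw _ _ _ ≫
      (sw _ _ _ ≫ (α_ _ _ _).hom) ▷ B.neg)
  simp only [Category.assoc, reassoc_of% sw_sw, inv_hom_whiskerRight_assoc] at h1
  have h2 := tr_two _ h1
  have h3 := tr_yank (tensHom f.hom g.hom ≫ (α_ _ _ _).inv ≫ sw _ _ _) (sw _ _ _ ≫ (α_ _ _ _).hom)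
  simp only [Category.assoc, reassoc_of% sw_sw, Iso.inv_hom_id, Category.comp_id] at h3
  rw [← Part.map_some, ← h3]
  simp only [comp_whiskerRight, Category.assoc] at h2 h3 ⊢
  rw [← h2]
  congr 2
  simp only [th, Category.assoc, comp_whiskerRight, whiskerRight_tensor, Iso.hom_inv_id_assoc,
    Iso.inv_hom_id_assoc]

instance (X Y Z : C) : IsIso (sw X Y Z) := ⟨sw X Z Y, sw_sw _ _ _, sw_sw _ _ _⟩

lemma sw_sw_ww (X Y Z V W : C) {T : C} (h : (((X ⊗ Y) ⊗ Z) ⊗ V) ⊗ W ⟶ T) :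
    sw X Y Z ▷ V ▷ W ≫ sw X Z Y ▷ V ▷ W ≫ h = h := by
  rw [← comp_whiskerRight_assoc, ← comp_whiskerRight, sw_sw]; simp

lemma sw_last_eq (X Y Z W : C) : sw X Y (Z ⊗ W) =
    (α_ (X ⊗ Y) Z W).inv ≫ sw X Y Z ▷ W ≫ sw (X ⊗ Z) Y W ≫ (α_ X Z W).hom ▷ Y := by
  rw [reassoc_of% sw_tensor_last]; simp

lemma sw_mid_eq (X Y Z W : C) : sw X (Y ⊗ Z) W =
    (α_ X Y Z).inv ▷ W ≫ sw (X ⊗ Y) Z W ≫ sw X Y W ▷ Z ≫ (α_ (X ⊗ W) Y Z).hom := by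
  rw [reassoc_of% sw_tensor_mid]; simp

lemma inner_assoc {c z c' w : C} (h : c ⊗ z ⟶ c' ⊗ w) (a b y p : C) :
    ((a ⊗ b) ⊗ c) ◁ (α_ z y p).hom ≫ inner h (a ⊗ b) (y ⊗ p) ≫ (α_ a b c').hom ▷ (w ⊗ y ⊗ p) =
      (α_ a b c).hom ▷ ((z ⊗ y) ⊗ p) ≫ inner (inner h b y) a p ≫ (a ⊗ b ⊗ c') ◁ (α_ w y p).hom := by
  simp only [inner]
  monoidal

lemma inner_unit {a p a' s : C} (f : a ⊗ p ⟶ a' ⊗ s) :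
    (𝟙_ C ⊗ a) ◁ (ρ_ p).inv ≫ inner f (𝟙_ C) (𝟙_ C) ≫ (λ_ a').hom ▷ (s ⊗ 𝟙_ C) =
      (λ_ a).hom ▷ p ≫ f ≫ a' ◁ (ρ_ s).inv := by
  simp only [inner]
  monoidal

lemma outer_unit {a p a' s : C} (f : a ⊗ p ⟶ a' ⊗ s) :
    (a ⊗ 𝟙_ C) ◁ (λ_ p).inv ≫ outer f (𝟙_ C) (𝟙_ C) ≫ (ρ_ a').hom ▷ (𝟙_ C ⊗ s) =
      (ρ_ a).hom ▷ p ≫ f ≫ a' ◁ (λ_ s).inv := by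
  simp only [outer, sw_unit_mid, sw_unit_last]
  monoidal

lemma outer_braid {a p a' s : C} (f : a ⊗ p ⟶ a' ⊗ s) (b y : C) :
    (a ⊗ b) ◁ (β_ p y).hom ≫ outer f b y ≫ (β_ a' b).hom ▷ (y ⊗ s) =
      (β_ a b).hom ▷ (p ⊗ y) ≫ inner f b y ≫ (b ⊗ a') ◁ (β_ s y).hom := by
  have h1 : sw a b p ≫ f ▷ b ≫ sw a' s b ≫ (β_ a' b).hom ▷ s =
      (β_ a b).hom ▷ p ≫ (α_ b a p).hom ≫ b ◁ f ≫ (α_ b a' s).inv := by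
    have h := BraidedCategory.braiding_naturality_left f b
    rw [BraidedCategory.braiding_tensor_left_hom, BraidedCategory.braiding_tensor_left_hom] at h
    rw [← cancel_epi (sw a p b), ← cancel_mono (α_ b a' s).hom]
    simp only [Category.assoc, reassoc_of% sw_sw]
    simpa [sw] using h
  have h2 := congrArg (fun t => t ▷ y) h1
  simp only [comp_whiskerRight, Category.assoc] at h2
  simp only [sw_eq_braid, outer, inner, Category.assoc, Iso.hom_inv_id_assoc, reassoc_of% sw_sw,
    whiskerRight_tensor]
  rw [← reassoc_of% sw_nat_head (β_ a' b).hom s y, reassoc_of% h2]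

lemma outer_braid' {a p a' s : C} (f : a ⊗ p ⟶ a' ⊗ s) (b y : C) :
    (b ⊗ a) ◁ (β_ y p).hom ≫ inner f b y ≫ (β_ b a').hom ▷ (s ⊗ y) =
      (β_ b a).hom ▷ (y ⊗ p) ≫ outer f b y ≫ (a' ⊗ b) ◁ (β_ y s).hom := by
  have h := outer_braid f b y
  rw [← cancel_epi ((β_ a b).hom ▷ (y ⊗ p)), ← cancel_epi ((a ⊗ b) ◁ (β_ p y).hom)]
  rw [← comp_whiskerRight_assoc, SymmetricCategory.symmetry, id_whiskerRight, Category.id_comp,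
    reassoc_of% whisker_exchange, ← whiskerLeft_comp_assoc, SymmetricCategory.symmetry,
    MonoidalCategory.whiskerLeft_id, Category.id_comp]
  rw [← cancel_mono ((a' ⊗ b) ◁ (β_ s y).hom), ← cancel_mono ((β_ a' b).hom ▷ (y ⊗ s))]
  simp only [Category.assoc]
  rw [← whiskerLeft_comp_assoc, SymmetricCategory.symmetry, MonoidalCategory.whiskerLeft_id,
    Category.id_comp, h, whisker_exchange, ← comp_whiskerRight_assoc, SymmetricCategory.symmetry]
  simp

lemma sw_nat {X X' Y Y' Z Z' : C} (f : X ⟶ X') (g : Y ⟶ Y') (h : Z ⟶ Z') :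
    ((f ⊗ₘ g) ⊗ₘ h) ≫ sw X' Y' Z' = sw X Y Z ≫ ((f ⊗ₘ h) ⊗ₘ g) := by
  simp only [MonoidalCategory.tensorHom_def, comp_whiskerRight, Category.assoc]
  rw [sw_nat_last, reassoc_of% sw_nat_mid, reassoc_of% sw_nat_head, whisker_exchange]

lemma tensHom_pair {a a' b b' p s y q : C} (u : a ⟶ a') (v : p ⟶ s) (u' : b ⟶ b') (v' : y ⟶ q) :
    tensHom (u ⊗ₘ v) (u' ⊗ₘ v') = (u ⊗ₘ u') ⊗ₘ (v' ⊗ₘ v) := by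
  rw [tensHom, reassoc_of% sw_nat, reassoc_of% sw_sw]
  have h : (α_ a b y).hom ▷ p ≫ ((u ⊗ₘ (u' ⊗ₘ v')) ⊗ₘ v) =
      (((u ⊗ₘ u') ⊗ₘ v') ⊗ₘ v) ≫ (α_ a' b' q).hom ▷ s := by
    rw [← tensorHom_id, ← tensorHom_id, MonoidalCategory.tensorHom_comp_tensorHom,
      MonoidalCategory.tensorHom_comp_tensorHom, MonoidalCategory.associator_naturality,
      Category.id_comp, Category.comp_id]
  rw [reassoc_of% h, hom_inv_whiskerRight_assoc, MonoidalCategory.associator_naturality,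
    Iso.inv_hom_id_assoc]

lemma outer_inner_aux {X X' y q : C} (G : X ⊗ y ⟶ X' ⊗ q) (c z p : C) :
    sw (X ⊗ c) z y ▷ p ≫ sw ((X ⊗ c) ⊗ y) z p ≫ sw X c y ▷ p ▷ z ≫ sw (X ⊗ y) c p ▷ z ≫
      G ▷ p ▷ c ▷ z ≫ sw (X' ⊗ q) p c ▷ z ≫ sw X' q c ▷ p ▷ z ≫ sw ((X' ⊗ c) ⊗ q) p z ≫
      sw (X' ⊗ c) q z ▷ p =
    sw (X ⊗ c) z y ▷ p ≫ sw X c y ▷ z ▷ p ≫ G ▷ c ▷ z ▷ p ≫ sw X' q c ▷ z ▷ p ≫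
      sw (X' ⊗ c) q z ▷ p := by
  rw [← reassoc_of% sw_nat_head (sw X c y), ← sw_nat_head_w G, ← reassoc_of% sw_nat_head (G ▷ c),
    sw_sw_w, reassoc_of% sw_nat_head (sw X' q c), reassoc_of% sw_sw]

lemma outer_inner_assoc {b y b' q : C} (g : b ⊗ y ⟶ b' ⊗ q) (a c z p : C) :
    ((a ⊗ b) ⊗ c) ◁ (α_ z y p).hom ≫ outer (inner g a p) c z ≫ (α_ a b' c).hom ▷ (z ⊗ q ⊗ p) =
      (α_ a b c).hom ▷ ((z ⊗ y) ⊗ p) ≫ inner (outer g c z) a p ≫ (a ⊗ b' ⊗ c) ◁ (α_ z q p).hom := by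
  have h := outer_inner_aux ((α_ a b y).hom ≫ a ◁ g ≫ (α_ a b' q).inv) c z p
  have h' := congrArg (fun t => ((α_ _ _ _).inv ≫ (α_ _ _ _).inv ▷ p) ≫ t ≫
    ((α_ _ _ _).hom ▷ p ≫ (α_ _ _ _).hom ≫ (α_ _ _ _).hom ▷ ((z ⊗ q) ⊗ p)) ≫
     (a ⊗ b' ⊗ c) ◁ (α_ z q p).hom) h
  convert h' using 1
  · simp only [outer, inner, sw_last_eq, sw_mid_eq]
    monoidal
  · simp only [outer, inner, sw]
    monoidal

lemma outer_assoc_half (X c z y p : C) :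
    sw (X ⊗ c) z y ▷ p ≫ sw ((X ⊗ c) ⊗ y) z p ≫ sw X c y ▷ p ▷ z ≫ sw (X ⊗ y) c p ▷ z ≫
      sw X y p ▷ c ▷ z =
    sw ((X ⊗ c) ⊗ z) y p ≫ sw (X ⊗ c) z p ▷ y ≫ sw X c p ▷ z ▷ y ≫ sw ((X ⊗ p) ⊗ c) z y ≫
      sw (X ⊗ p) c y ▷ z := by
  have := sw_braid_w X c y p z (𝟙 _)
  simp only [Category.comp_id] at this
  rw [this, reassoc_of% sw_braid, reassoc_of% sw_nat_head (sw X c p)]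

lemma outer_assoc_aux {a p a' s : C} (f : a ⊗ p ⟶ a' ⊗ s) (b c z y : C) :
    sw ((a ⊗ b) ⊗ c) z y ▷ p ≫ sw (((a ⊗ b) ⊗ c) ⊗ y) z p ≫ sw (a ⊗ b) c y ▷ p ▷ z ≫
      sw ((a ⊗ b) ⊗ y) c p ▷ z ≫ sw (a ⊗ b) y p ▷ c ▷ z ≫ sw a b p ▷ y ▷ c ▷ z ≫
      f ▷ b ▷ y ▷ c ▷ z ≫ sw a' s b ▷ y ▷ c ▷ z ≫ sw (a' ⊗ b) s y ▷ c ▷ z ≫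
      sw ((a' ⊗ b) ⊗ y) s c ▷ z ≫ sw (a' ⊗ b) y c ▷ s ▷ z ≫ sw (((a' ⊗ b) ⊗ c) ⊗ y) s z ≫
      sw ((a' ⊗ b) ⊗ c) y z ▷ s =
    sw (((a ⊗ b) ⊗ c) ⊗ z) y p ≫ sw ((a ⊗ b) ⊗ c) z p ▷ y ≫ sw (a ⊗ b) c p ▷ z ▷ y ≫
      sw a b p ▷ c ▷ z ▷ y ≫ f ▷ b ▷ c ▷ z ▷ y ≫ sw a' s b ▷ c ▷ z ▷ y ≫
      sw (a' ⊗ b) s c ▷ z ▷ y ≫ sw ((a' ⊗ b) ⊗ c) s z ▷ y ≫ sw (((a' ⊗ b) ⊗ c) ⊗ z) s y := by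
  have h := outer_assoc_half (a ⊗ b) c z y p
  have h' := outer_assoc_half (a' ⊗ b) c z y s
  rw [reassoc_of% h, ← sw_nat_head_w (sw a b p), ← reassoc_of% sw_nat_head (sw a b p ▷ c),
    ← sw_nat_head_w (f ▷ b), ← reassoc_of% sw_nat_head (f ▷ b ▷ c),
    ← sw_nat_head_w (sw a' s b), ← reassoc_of% sw_nat_head (sw a' s b ▷ c)]
  iterate 6 apply congrArg (_ ≫ ·)
  rw [← cancel_epi (sw (a' ⊗ b) c s ▷ z ▷ y), ← cancel_epi (sw ((a' ⊗ b) ⊗ c) z s ▷ y),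
    ← cancel_epi (sw (((a' ⊗ b) ⊗ c) ⊗ z) y s), ← reassoc_of% h']
  simp only [sw_sw_ww, sw_sw_w, reassoc_of% sw_sw, ← comp_whiskerRight, sw_sw, id_whiskerRight]

lemma outer_assoc {a p a' s : C} (f : a ⊗ p ⟶ a' ⊗ s) (b c z y : C) :
    ((a ⊗ b) ⊗ c) ◁ (α_ z y p).hom ≫ outer (outer f b y) c z ≫ (α_ a' b c).hom ▷ (z ⊗ y ⊗ s) =
      (α_ a b c).hom ▷ ((z ⊗ y) ⊗ p) ≫ outer f (b ⊗ c) (z ⊗ y) ≫ (a' ⊗ b ⊗ c) ◁ (α_ z y s).hom := by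
  have h := outer_assoc_aux f b c z y
  have h' := congrArg (fun t => ((α_ _ _ _).inv ≫ (α_ _ _ _).inv ▷ p) ≫ t ≫
    ((α_ _ _ _).hom ▷ s ≫ (α_ _ _ _).hom ≫ (α_ _ _ _).hom ▷ ((z ⊗ y) ⊗ s)) ≫
     (a' ⊗ b ⊗ c) ◁ (α_ z y s).hom) h
  convert h' using 1
  · simp only [outer, inner, sw_last_eq, sw_mid_eq]
    monoidal
  · simp only [outer, inner, sw_last_eq, sw_mid_eq]
    simp only [sw]
    monoidal

lemma tensHom_braid {a p a' s b y b' q : C} (f : a ⊗ p ⟶ a' ⊗ s) (g : b ⊗ y ⟶ b' ⊗ q) :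
    (a ⊗ b) ◁ (β_ p y).hom ≫ tensHom f g ≫ (β_ a' b').hom ▷ (q ⊗ s) =
      (β_ a b).hom ▷ (p ⊗ y) ≫ tensHom g f ≫ (b' ⊗ a') ◁ (β_ s q).hom := by
  rw [tensHom_eq, tensHom_eq']
  have e1 := outer_braid f b y
  have e2 := outer_braid' g a' s
  have h (X z w : C) : X ◁ (β_ z w).hom ≫ X ◁ (β_ w z).hom = 𝟙 _ := by
    rw [← MonoidalCategory.whiskerLeft_comp, SymmetricCategory.symmetry,
      MonoidalCategory.whiskerLeft_id]
  have e3 : inner g a' s ≫ (β_ a' b').hom ▷ (q ⊗ s) = (β_ a' b).hom ▷ (y ⊗ s) ≫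
      (b ⊗ a') ◁ (β_ y s).hom ≫ outer g a' s ≫ (b' ⊗ a') ◁ (β_ s q).hom := by
    rw [← reassoc_of% whisker_exchange, ← e2, reassoc_of% h]
  simp only [Category.assoc]
  rw [e3, reassoc_of% e1, reassoc_of% h]

lemma comp_nil (A : IntP C) : comp (Quiver.Path.nil : Quiver.Path A A) = Part.some (ident A) := by
  simp only [comp, loop, pre, ident]
  rw [PartiallyTraced.vanishing_one, Part.map_some, sw_unit_last]
  simp

/-- `g ↦ 1 ⊗ g`; its `mapPath` is `p ↦ 1 ⊗ p` on paths. -/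
def tensorLeft (X : IntP C) : IntP C ⥤q IntP C where
  obj Y := tensorObj X Y
  map g := tensorHom (ident X) g

/-- `g ↦ g ⊗ 1`; its `mapPath` is `p ↦ p ⊗ 1` on paths. -/
def tensorRight (X : IntP C) : IntP C ⥤q IntP C where
  obj Y := tensorObj Y X
  map g := tensorHom g (ident X)

/-- Congruence relations on the category of paths of `Intᵖ(C)`: equivalence relations on parallel
paths that are stable under concatenation and under tensoring with identities, and that relate a
path to its composite whenever the latter is defined. -/
structure IsCongruence (S : ∀ A B : IntP C, Quiver.Path A B → Quiver.Path A B → Prop) :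
    Prop where
  equivalence (A B : IntP C) : Equivalence (S A B)
  append {X Y Z : IntP C} {p p' : Quiver.Path X Y} {q q' : Quiver.Path Y Z} :
    S X Y p p' → S Y Z q q' → S X Z (p.comp q) (p'.comp q')
  comp {X Y : IntP C} {p : Quiver.Path X Y} {f : X ⟶ Y} : f ∈ comp p → S X Y p f.toPath
  tensorLeft (A : IntP C) {X Y : IntP C} {p q : Quiver.Path X Y} : S X Y p q →
    S _ _ ((tensorLeft A).mapPath p) ((tensorLeft A).mapPath q)
  tensorRight (A : IntP C) {X Y : IntP C} {p q : Quiver.Path X Y} : S X Y p q →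
    S _ _ ((tensorRight A).mapPath p) ((tensorRight A).mapPath q)

/-- The smallest congruence relation, i.e. the intersection of all congruence relations. -/
def Sim (A B : IntP C) (p q : Quiver.Path A B) : Prop :=
  ∀ S : (∀ A B : IntP C, Quiver.Path A B → Quiver.Path A B → Prop), IsCongruence S → S A B p q

lemma isCongruence_sim : IsCongruence (Sim (C := C)) where
  equivalence A B :=
    { refl := fun p S hS => (hS.equivalence A B).refl p
      symm := fun h S hS => (hS.equivalence A B).symm (h S hS)
      trans := fun h h' S hS => (hS.equivalence A B).trans (h S hS) (h' S hS) }
  append h h' S hS := hS.append (h S hS) (h' S hS)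
  comp h S hS := hS.comp h
  tensorLeft A _ _ _ _ h S hS := hS.tensorLeft A (h S hS)
  tensorRight A _ _ _ _ h S hS := hS.tensorRight A (h S hS)

end IntP

variable (C) in
/-- The objects of the category `Path(Intᵖ(C))/∼`; they are the objects of `Intᵖ(C)`. -/
structure PathInt [PartiallyTraced C] where
  /-- the underlying object of `Intᵖ(C)` -/
  as : IntP C

namespace PathInt

open IntP

variable [PartiallyTraced C]

/-- Morphisms are paths up to the smallest congruence. -/
def Hom (A B : PathInt C) : Type (max u v) := Quot (Sim A.as B.as)

/-- Composition is concatenation of paths. -/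
instance : Category (PathInt C) where
  Hom := Hom
  id A := Quot.mk _ Quiver.Path.nil
  comp := fun {A B D} f g => Quot.map₂ (fun p q => p.comp q)
    (fun p _ _ h => isCongruence_sim.append ((isCongruence_sim.equivalence _ _).refl p) h)
    (fun _ _ q h => isCongruence_sim.append h ((isCongruence_sim.equivalence _ _).refl q)) f g
  id_comp := by rintro A B ⟨p⟩; exact congrArg (Quot.mk _) (Quiver.Path.nil_comp p)
  comp_id := by rintro A B ⟨p⟩; rfl
  assoc := by rintro A B D E ⟨p⟩ ⟨q⟩ ⟨r⟩; exact congrArg (Quot.mk _) (Quiver.Path.comp_assoc p q r)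

/-- The class of a path of length one. -/
def sing {X Y : IntP C} (f : X ⟶ Y) : (⟨X⟩ : PathInt C) ⟶ ⟨Y⟩ := Quot.mk _ f.toPath

@[elab_as_elim]
lemma hom_induction {A : PathInt C} {P : ∀ {B : PathInt C}, (A ⟶ B) → Prop} (id : P (𝟙 A))
    (step : ∀ {X Y : IntP C} (p : A ⟶ (⟨X⟩ : PathInt C)) (f : X ⟶ Y), P p → P (p ≫ sing f))
    {B : PathInt C} (f : A ⟶ B) : P f := by
  obtain ⟨p⟩ := f
  change P (B := ⟨B.as⟩) (Quot.mk _ p)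
  generalize B.as = B' at p
  induction p with
  | nil => exact id
  | cons p f ih => exact step (X := _) (Quot.mk _ p) f ih

lemma sing_of_mem {X Y Z : IntP C} {f : X ⟶ Y} {g : Y ⟶ Z} {t : X ⟶ Z}
    (h : comp (f.toPath.cons g) = Part.some t) : sing f ≫ sing g = sing t :=
  Quot.sound (isCongruence_sim.comp (Part.eq_some_iff.1 h))

lemma sing_ident (X : IntP C) : sing (ident X) = 𝟙 _ :=
  (Quot.sound (isCongruence_sim.comp (Part.eq_some_iff.1 (comp_nil X)))).symm

/-- The map `p ↦ 1 ⊗ p` on classes of paths. -/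
def whL (X : PathInt C) {Y Z : PathInt C} (f : Y ⟶ Z) :
    (⟨tensorObj X.as Y.as⟩ : PathInt C) ⟶ ⟨tensorObj X.as Z.as⟩ :=
  Quot.map (IntP.tensorLeft X.as).mapPath (fun _ _ h => isCongruence_sim.tensorLeft X.as h) f

/-- The map `p ↦ p ⊗ 1` on classes of paths. -/
def whR {Y Z : PathInt C} (f : Y ⟶ Z) (X : PathInt C) :
    (⟨tensorObj Y.as X.as⟩ : PathInt C) ⟶ ⟨tensorObj Z.as X.as⟩ :=
  Quot.map (IntP.tensorRight X.as).mapPath (fun _ _ h => isCongruence_sim.tensorRight X.as h) f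

lemma whL_id (X Y : PathInt C) : whL X (𝟙 Y) = 𝟙 _ := rfl
lemma whR_id (X Y : PathInt C) : whR (𝟙 Y) X = 𝟙 _ := rfl

lemma whL_comp (X : PathInt C) {Y Z W : PathInt C} (f : Y ⟶ Z) (g : Z ⟶ W) :
    whL X (f ≫ g) = whL X f ≫ whL X g := by
  obtain ⟨p⟩ := f
  obtain ⟨q⟩ := g
  exact congrArg (Quot.mk _) ((IntP.tensorLeft X.as).mapPath_comp p q)

lemma whR_comp {Y Z W : PathInt C} (f : Y ⟶ Z) (g : Z ⟶ W) (X : PathInt C) :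
    whR (f ≫ g) X = whR f X ≫ whR g X := by
  obtain ⟨p⟩ := f
  obtain ⟨q⟩ := g
  exact congrArg (Quot.mk _) ((IntP.tensorRight X.as).mapPath_comp p q)

lemma whL_F (X : PathInt C) {Y Z : IntP C} (f : Y ⟶ Z) :
    whL X (sing f) = sing (IntP.tensorHom (ident X.as) f) := rfl

lemma whR_F {Y Z : IntP C} (f : Y ⟶ Z) (X : PathInt C) :
    whR (sing f) X = sing (IntP.tensorHom f (ident X.as)) := rfl

/-- The class of the arrow given by a pair of morphisms of `C`. -/
def J {a p a' p' : C} (u : a ⟶ a') (v : p' ⟶ p) :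
    (⟨⟨a, p⟩⟩ : PathInt C) ⟶ (⟨⟨a', p'⟩⟩ : PathInt C) :=
  sing (pair (A := ⟨a, p⟩) (B := ⟨a', p'⟩) u v)

lemma J_id (a p : C) : J (𝟙 a) (𝟙 p) = 𝟙 ((⟨⟨a, p⟩⟩ : PathInt C)) := by
  rw [← sing_ident, J, pair, ident]; simp

lemma J_comp {a p a' p' a'' p'' : C} (u : a ⟶ a') (v : p' ⟶ p) (u' : a' ⟶ a'') (v' : p'' ⟶ p') :
    J u v ≫ J u' v' = J (u ≫ u') (v' ≫ v) := by
  rw [J, J, sing_of_mem (comp_pair _ _ _), J]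
  congr 2
  simp only [pair, MonoidalCategory.tensorHom_def, comp_whiskerRight, MonoidalCategory.whiskerLeft_comp,
    Category.assoc]
  rw [whisker_exchange u' v, reassoc_of% whisker_exchange u v', reassoc_of% whisker_exchange u' v']

lemma ident_eq (A : IntP C) : ident A = pair (𝟙 _) (𝟙 _) := by simp [ident, pair]

lemma tensorHom_pair {A B A' B' : IntP C} (u : A.pos ⟶ B.pos) (v : B.neg ⟶ A.neg)
    (u' : A'.pos ⟶ B'.pos) (v' : B'.neg ⟶ A'.neg) :
    IntP.tensorHom (pair u v) (pair u' v') =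
      pair (A := A.tensorObj A') (B := B.tensorObj B') (u ⊗ₘ u') (v' ⊗ₘ v) :=
  congrArg Hom.mk (tensHom_pair u v u' v')

lemma whL_J (X : PathInt C) {a p a' p' : C} (u : a ⟶ a') (v : p' ⟶ p) :
    whL X (J u v) = J (X.as.pos ◁ u) (v ▷ X.as.neg) := by
  change sing (IntP.tensorHom (ident X.as) (pair (A := ⟨a, p⟩) (B := ⟨a', p'⟩) u v)) = sing (pair _ _)
  rw [ident_eq, tensorHom_pair, id_tensorHom, tensorHom_id]

lemma whR_J (X : PathInt C) {a p a' p' : C} (u : a ⟶ a') (v : p' ⟶ p) :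
    whR (J u v) X = J (u ▷ X.as.pos) (X.as.neg ◁ v) := by
  change sing (IntP.tensorHom (pair (A := ⟨a, p⟩) (B := ⟨a', p'⟩) u v) (ident X.as)) = sing (pair _ _)
  rw [ident_eq, tensorHom_pair, id_tensorHom, tensorHom_id]

/-- A sufficient condition for naturality squares with respect to `J`. -/
lemma J_square {X Y X' Y' : IntP C} (f : X ⟶ Y) (g : X' ⟶ Y') (u : Y.pos ⟶ Y'.pos)
    (v : Y'.neg ⟶ Y.neg) (u' : X.pos ⟶ X'.pos) (v' : X'.neg ⟶ X.neg)
    (h : X.pos ◁ v ≫ f.hom ≫ u ▷ X.neg = u' ▷ Y'.neg ≫ g.hom ≫ Y'.pos ◁ v') :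
    sing f ≫ J u v = J u' v' ≫ sing g := by
  have h1 := sing_of_mem (comp_pair f u v)
  have h2 := sing_of_mem (pair_comp u' v' g)
  rw [h] at h1
  exact h1.trans h2.symm

lemma hom_outer {A A' : IntP C} (f : A ⟶ A') (B : IntP C) :
    (IntP.tensorHom f (ident B)).hom = outer f.hom B.pos B.neg := tensHom_id_right _ _ _

lemma hom_inner {A A' : IntP C} (f : A ⟶ A') (B : IntP C) :
    (IntP.tensorHom (ident B) f).hom = inner f.hom B.pos B.neg := tensHom_id_left _ _ _

/-- Naturality extends from single arrows to all paths. -/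
lemma square_ext {Φ Ψ : PathInt C → PathInt C}
    (φ : ∀ {X Y : PathInt C}, (X ⟶ Y) → (Φ X ⟶ Φ Y)) (ψ : ∀ {X Y : PathInt C}, (X ⟶ Y) → (Ψ X ⟶ Ψ Y))
    (hφ : ∀ X, φ (𝟙 X) = 𝟙 _) (hψ : ∀ X, ψ (𝟙 X) = 𝟙 _)
    (hφ' : ∀ {X Y Z : PathInt C} (f : X ⟶ Y) (g : Y ⟶ Z), φ (f ≫ g) = φ f ≫ φ g)
    (hψ' : ∀ {X Y Z : PathInt C} (f : X ⟶ Y) (g : Y ⟶ Z), ψ (f ≫ g) = ψ f ≫ ψ g)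
    (τ : ∀ X, Φ X ⟶ Ψ X)
    (h : ∀ {X Y : IntP C} (f : X ⟶ Y), φ (sing f) ≫ τ ⟨Y⟩ = τ ⟨X⟩ ≫ ψ (sing f))
    {X Y : PathInt C} (f : X ⟶ Y) : φ f ≫ τ Y = τ X ≫ ψ f := by
  induction f using hom_induction with
  | id => simp [hφ, hψ]
  | step p f ih => rw [hφ', hψ', Category.assoc, h, ← Category.assoc, ih, Category.assoc]

/-- The isomorphism given by a pair of isomorphisms of `C`. -/
def JIso {a p a' p' : C} (u : a ≅ a') (v : p' ≅ p) :
    (⟨⟨a, p⟩⟩ : PathInt C) ≅ (⟨⟨a', p'⟩⟩ : PathInt C) where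
  hom := J u.hom v.hom
  inv := J u.inv v.inv
  hom_inv_id := by rw [J_comp, Iso.hom_inv_id, Iso.inv_hom_id, J_id]
  inv_hom_id := by rw [J_comp, Iso.hom_inv_id, Iso.inv_hom_id, J_id]

/-- The tensor product on `Path(Intᵖ(C))/∼`; on paths it is `f ⊗ g = (f ⊗ 1), (1 ⊗ g)`. The structural
isomorphisms are the classes of those of `Intᵖ(C)`, which are given by pairs of structural
isomorphisms of `C`. -/
instance : MonoidalCategoryStruct (PathInt C) where
  tensorObj X Y := ⟨X.as.tensorObj Y.as⟩
  tensorUnit := ⟨⟨𝟙_ C, 𝟙_ C⟩⟩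
  whiskerLeft X _ _ f := whL X f
  whiskerRight f X := whR f X
  tensorHom {_ A' B _} f g := whR f B ≫ whL A' g
  associator X Y Z := JIso (α_ X.as.pos Y.as.pos Z.as.pos) (α_ Z.as.neg Y.as.neg X.as.neg)
  leftUnitor X := JIso (λ_ X.as.pos) (ρ_ X.as.neg).symm
  rightUnitor X := JIso (ρ_ X.as.pos) (λ_ X.as.neg).symm

/-- The symmetry of `Path(Intᵖ(C))/∼`, the class of the symmetry of `Intᵖ(C)`. -/
def braid (X Y : PathInt C) : X ⊗ Y ≅ Y ⊗ X := JIso (β_ X.as.pos Y.as.pos) (β_ X.as.neg Y.as.neg)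

lemma braid_nat_right (X : PathInt C) {Y Z : PathInt C} (f : Y ⟶ Z) :
    X ◁ f ≫ (braid X Z).hom = (braid X Y).hom ≫ f ▷ X := by
  refine square_ext (fun f => whL X f) (fun f => whR f X) (whL_id X) (whR_id X) (whL_comp X)
    (fun f g => whR_comp f g X) (fun Y => (braid X Y).hom) (fun {_ _} f => ?_) f
  refine J_square (IntP.tensorHom (ident X.as) f) (IntP.tensorHom f (ident X.as)) _ _ _ _ ?_
  rw [hom_inner, hom_outer]
  exact outer_braid' _ _ _

lemma braid_nat_left {Y Z : PathInt C} (f : Y ⟶ Z) (X : PathInt C) :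
    f ▷ X ≫ (braid Z X).hom = (braid Y X).hom ≫ X ◁ f := by
  refine square_ext (fun f => whR f X) (fun f => whL X f) (whR_id X) (whL_id X)
    (fun f g => whR_comp f g X) (whL_comp X) (fun Y => (braid Y X).hom) (fun {_ _} f => ?_) f
  refine J_square (IntP.tensorHom f (ident X.as)) (IntP.tensorHom (ident X.as) f) _ _ _ _ ?_
  rw [hom_inner, hom_outer]
  exact outer_braid _ _ _

lemma exchange_sing {A B A' B' : IntP C} (f : A ⟶ A') (g : B ⟶ B') :
    sing f ▷ ⟨B⟩ ≫ ⟨A'⟩ ◁ sing g = ⟨A⟩ ◁ sing g ≫ sing f ▷ ⟨B'⟩ := by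
  have h1 : sing f ▷ ⟨B⟩ ≫ ⟨A'⟩ ◁ sing g = sing (IntP.tensorHom f g) :=
    sing_of_mem (exchange_aux f g)
  have h2 : sing g ▷ ⟨A⟩ ≫ ⟨B'⟩ ◁ sing f = sing (IntP.tensorHom g f) :=
    sing_of_mem (exchange_aux g f)
  have h3 : (⟨A⟩ ◁ sing g ≫ sing f ▷ ⟨B'⟩) ≫ (braid ⟨A'⟩ ⟨B'⟩).hom =
      (braid ⟨A⟩ ⟨B⟩).hom ≫ sing (IntP.tensorHom g f) := by
    rw [Category.assoc, braid_nat_left, ← Category.assoc, braid_nat_right, Category.assoc, h2]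
  rw [← cancel_mono (braid ⟨A'⟩ ⟨B'⟩).hom, h3, h1]
  exact J_square (IntP.tensorHom f g) (IntP.tensorHom g f) _ _ _ _ (tensHom_braid f.hom g.hom)

lemma exchange {W X Y Z : PathInt C} (f : W ⟶ X) (g : Y ⟶ Z) :
    f ▷ Y ≫ X ◁ g = W ◁ g ≫ f ▷ Z := by
  refine square_ext (fun f => whR f Y) (fun f => whR f Z) (whR_id Y) (whR_id Z)
    (fun f g => whR_comp f g Y) (fun f g => whR_comp f g Z) (fun X => whL X g) (fun {A A'} f => ?_) f
  symm
  refine square_ext (fun f => whL ⟨A⟩ f) (fun f => whL ⟨A'⟩ f) (whL_id ⟨A⟩) (whL_id ⟨A'⟩)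
    (whL_comp ⟨A⟩) (whL_comp ⟨A'⟩) (fun X => whR (sing f) X) (fun {B B'} g => ?_) g
  exact (exchange_sing f g).symm

lemma assoc_nat_left {X X' : PathInt C} (f : X ⟶ X') (Y Z : PathInt C) :
    f ▷ Y ▷ Z ≫ (α_ X' Y Z).hom = (α_ X Y Z).hom ≫ f ▷ (Y ⊗ Z) := by
  refine square_ext (fun f => whR (whR f Y) Z) (fun f => whR f (Y ⊗ Z)) (fun X => rfl) (fun X => rfl)
    (fun f g => by rw [whR_comp, whR_comp]) (fun f g => whR_comp f g _)
    (fun X => (α_ X Y Z).hom) (fun {_ _} f => ?_) f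
  refine J_square (IntP.tensorHom (IntP.tensorHom f (ident Y.as)) (ident Z.as))
    (IntP.tensorHom f (ident (Y.as.tensorObj Z.as))) _ _ _ _ ?_
  rw [hom_outer, hom_outer, hom_outer]
  exact outer_assoc _ _ _ _ _

lemma assoc_nat_mid (X : PathInt C) {Y Y' : PathInt C} (f : Y ⟶ Y') (Z : PathInt C) :
    (X ◁ f) ▷ Z ≫ (α_ X Y' Z).hom = (α_ X Y Z).hom ≫ X ◁ f ▷ Z := by
  refine square_ext (fun f => whR (whL X f) Z) (fun f => whL X (whR f Z)) (fun X => rfl) (fun X => rfl)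
    (fun f g => by rw [whL_comp, whR_comp]) (fun f g => by rw [whR_comp, whL_comp])
    (fun Y => (α_ X Y Z).hom) (fun {_ _} f => ?_) f
  refine J_square (IntP.tensorHom (IntP.tensorHom (ident X.as) f) (ident Z.as))
    (IntP.tensorHom (ident X.as) (IntP.tensorHom f (ident Z.as))) _ _ _ _ ?_
  rw [hom_outer, hom_inner, hom_inner, hom_outer]
  exact outer_inner_assoc _ _ _ _ _

lemma assoc_nat_right (X Y : PathInt C) {Z Z' : PathInt C} (f : Z ⟶ Z') :
    (X ⊗ Y) ◁ f ≫ (α_ X Y Z').hom = (α_ X Y Z).hom ≫ X ◁ Y ◁ f := by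
  refine square_ext (fun f => whL (X ⊗ Y) f) (fun f => whL X (whL Y f)) (fun X => rfl) (fun X => rfl)
    (fun f g => whL_comp _ f g) (fun f g => by rw [whL_comp, whL_comp])
    (fun Z => (α_ X Y Z).hom) (fun {_ _} f => ?_) f
  refine J_square (IntP.tensorHom (ident (X.as.tensorObj Y.as)) f)
    (IntP.tensorHom (ident X.as) (IntP.tensorHom (ident Y.as) f)) _ _ _ _ ?_
  rw [hom_inner, hom_inner, hom_inner]
  exact inner_assoc _ _ _ _ _

lemma lUnit_nat {X Y : PathInt C} (f : X ⟶ Y) :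
    𝟙_ (PathInt C) ◁ f ≫ (λ_ Y).hom = (λ_ X).hom ≫ f := by
  refine square_ext (fun f => whL (𝟙_ (PathInt C)) f) (fun f => f) (fun X => rfl) (fun X => rfl)
    (fun f g => whL_comp _ f g) (fun f g => rfl)
    (fun X => (λ_ X).hom) (fun {_ _} f => ?_) f
  refine J_square (IntP.tensorHom (ident ⟨𝟙_ C, 𝟙_ C⟩) f) f _ _ _ _ ?_
  rw [hom_inner]
  exact inner_unit _

lemma rUnit_nat {X Y : PathInt C} (f : X ⟶ Y) :
    f ▷ 𝟙_ (PathInt C) ≫ (ρ_ Y).hom = (ρ_ X).hom ≫ f := by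
  refine square_ext (fun f => whR f (𝟙_ (PathInt C))) (fun f => f) (fun X => rfl) (fun X => rfl)
    (fun f g => whR_comp f g _) (fun f g => rfl)
    (fun X => (ρ_ X).hom) (fun {_ _} f => ?_) f
  refine J_square (IntP.tensorHom f (ident ⟨𝟙_ C, 𝟙_ C⟩)) f _ _ _ _ ?_
  rw [hom_outer]
  exact outer_unit _

lemma tensorHom_def_aux {W X Y Z : PathInt C} (f : W ⟶ X) (g : Y ⟶ Z) :
    f ⊗ₘ g = f ▷ Y ≫ X ◁ g := rfl

instance : MonoidalCategory (PathInt C) where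
  tensorHom_def _ _ := rfl
  id_tensorHom_id X Y := Category.comp_id _
  tensorHom_comp_tensorHom {X₁ Y₁ Z₁ X₂ Y₂ Z₂} f₁ f₂ g₁ g₂ := by
    have h1 : (f₁ ≫ g₁) ▷ X₂ = f₁ ▷ X₂ ≫ g₁ ▷ X₂ := whR_comp f₁ g₁ X₂
    have h2 : Z₁ ◁ (f₂ ≫ g₂) = Z₁ ◁ f₂ ≫ Z₁ ◁ g₂ := whL_comp Z₁ f₂ g₂
    simp only [tensorHom_def_aux, h1, h2, Category.assoc]
    rw [reassoc_of% exchange g₁ f₂]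
  whiskerLeft_id X Y := whL_id X Y
  id_whiskerRight X Y := whR_id Y X
  associator_naturality {X₁ X₂ X₃ Y₁ Y₂ Y₃} f g h := by
    have h1 : (f ▷ X₂ ≫ Y₁ ◁ g) ▷ X₃ = f ▷ X₂ ▷ X₃ ≫ (Y₁ ◁ g) ▷ X₃ := whR_comp _ _ X₃
    have h2 : Y₁ ◁ (g ▷ X₃ ≫ Y₂ ◁ h) = Y₁ ◁ g ▷ X₃ ≫ Y₁ ◁ Y₂ ◁ h := whL_comp Y₁ _ _
    simp only [tensorHom_def_aux, h1, h2, Category.assoc]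
    rw [assoc_nat_right, reassoc_of% assoc_nat_mid, reassoc_of% assoc_nat_left]
  leftUnitor_naturality f := lUnit_nat f
  rightUnitor_naturality f := rUnit_nat f
  pentagon W X Y Z := by
    change whR (J _ _) Z ≫ J _ _ ≫ whL W (J _ _) = J _ _ ≫ J _ _
    rw [whR_J, whL_J, J_comp, J_comp, J_comp]
    congr 1
    · exact MonoidalCategory.pentagon _ _ _ _
    · rw [Category.assoc]
      exact MonoidalCategory.pentagon _ _ _ _
  triangle X Y := by
    change J _ _ ≫ whL X (J _ _) = whR (J _ _) Y
    rw [whR_J, whL_J, J_comp]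
    congr 1
    · exact MonoidalCategory.triangle _ _
    · change (ρ_ _).inv ▷ _ ≫ (α_ _ _ _).hom = _ ◁ (λ_ _).inv
      simp

instance : SymmetricCategory (PathInt C) where
  braiding := braid
  braiding_naturality_right X _ _ f := braid_nat_right X f
  braiding_naturality_left f Z := braid_nat_left f Z
  hexagon_forward X Y Z := by
    change J _ _ ≫ J _ _ ≫ J _ _ = whR (J _ _) Z ≫ J _ _ ≫ whL Y (J _ _)
    rw [whR_J, whL_J, J_comp, J_comp, J_comp, J_comp]
    congr 1
    · exact BraidedCategory.hexagon_forward _ _ _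
    · simp only [Category.assoc]
      exact BraidedCategory.hexagon_forward _ _ _
  hexagon_reverse X Y Z := by
    change J _ _ ≫ J _ _ ≫ J _ _ = whL X (J _ _) ≫ J _ _ ≫ whR (J _ _) Y
    rw [whR_J, whL_J, J_comp, J_comp, J_comp, J_comp]
    congr 1
    · exact BraidedCategory.hexagon_reverse _ _ _
    · simp only [Category.assoc]
      exact BraidedCategory.hexagon_reverse _ _ _
  symmetry X Y := by
    change J _ _ ≫ J _ _ = _
    rw [J_comp]
    refine Eq.trans ?_ (J_id _ _)
    congr 1
    · exact SymmetricCategory.symmetry _ _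
    · exact SymmetricCategory.symmetry _ _

end PathInt

open IntP PathInt

/-- The embedding `N : C → Intᵖ(C)`, as a map of graphs: `N A = (A, I)`, and `N f` is `f` regarded
as a morphism `A ⊗ I ⟶ B ⊗ I`. -/
def N (C : Type u) [Category.{v} C] [MonoidalCategory C] : C ⥤q IntP C where
  obj A := ⟨A, 𝟙_ C⟩
  map f := ⟨f ⊗ₘ 𝟙 (𝟙_ C)⟩

variable [PartiallyTraced C]

/-- The canonical map `F : Intᵖ(C) → Path(Intᵖ(C))/∼`, as a map of graphs: the identity on objects,
and an arrow is sent to the class of the corresponding path of length one. -/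
def F (C : Type u) [Category.{v} C] [MonoidalCategory C] [SymmetricCategory C]
    [PartiallyTraced C] : IntP C ⥤q PathInt C where
  obj X := ⟨X⟩
  map f := sing f

/-- The composite `F ∘ N`, which is a functor between honest categories. -/
def embed (C : Type u) [Category.{v} C] [MonoidalCategory C] [SymmetricCategory C]
    [PartiallyTraced C] : C ⥤ PathInt C where
  obj A := (F C).obj ((N C).obj A)
  map f := (F C).map ((N C).map f)
  map_id A := J_id _ _
  map_comp f g := ((J_comp _ _ _ _).trans (by rw [Category.comp_id]; rfl)).symm

/-- The object `(A, I)`. -/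
abbrev base (A : C) : PathInt C := ⟨⟨A, 𝟙_ C⟩⟩

/-- The action of `F ∘ N` on morphisms. -/
abbrev baseMap {A B : C} (f : A ⟶ B) : base A ⟶ base B := J f (𝟙 (𝟙_ C))

/-- The comparison `(A, I) ⊗ (B, I) = (A ⊗ B, I ⊗ I) ≅ (A ⊗ B, I)`. -/
abbrev baseMu (A B : C) : base A ⊗ base B ≅ base (A ⊗ B) :=
  JIso (Iso.refl (A ⊗ B)) (λ_ (𝟙_ C)).symm

lemma base_nat_left {A B : C} (f : A ⟶ B) (X : C) :
    baseMap f ▷ base X ≫ (baseMu B X).hom = (baseMu A X).hom ≫ baseMap (f ▷ X) := by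
  change whR (J f (𝟙 (𝟙_ C))) (base X) ≫ J (𝟙 _) (λ_ (𝟙_ C)).inv = J (𝟙 _) (λ_ (𝟙_ C)).inv ≫ J _ _
  rw [whR_J, J_comp, J_comp]
  simp

lemma base_nat_right (X : C) {A B : C} (f : A ⟶ B) :
    base X ◁ baseMap f ≫ (baseMu X B).hom = (baseMu X A).hom ≫ baseMap (X ◁ f) := by
  change whL (base X) (J f (𝟙 (𝟙_ C))) ≫ J (𝟙 _) (λ_ (𝟙_ C)).inv = J (𝟙 _) (λ_ (𝟙_ C)).inv ≫ J _ _
  rw [whL_J, J_comp, J_comp]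
  simp

lemma base_assoc (X Y Z : C) :
    (baseMu X Y).hom ▷ base Z ≫ (baseMu (X ⊗ Y) Z).hom ≫ baseMap (α_ X Y Z).hom =
      (α_ (base X) (base Y) (base Z)).hom ≫ base X ◁ (baseMu Y Z).hom ≫
        (baseMu X (Y ⊗ Z)).hom := by
  change whR (J (𝟙 _) (λ_ (𝟙_ C)).inv) (base Z) ≫ J (𝟙 _) (λ_ (𝟙_ C)).inv ≫ J _ (𝟙 _) =
    J (α_ X Y Z).hom (α_ (𝟙_ C) (𝟙_ C) (𝟙_ C)).hom ≫ whL (base X) (J (𝟙 _) (λ_ (𝟙_ C)).inv) ≫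
      J (𝟙 _) (λ_ (𝟙_ C)).inv
  rw [whR_J, whL_J, J_comp, J_comp, J_comp, J_comp]
  congr 1
  · simp
  · simp only [Category.id_comp, Category.comp_id, Category.assoc]
    monoidal

lemma base_left_unit (X : C) : (λ_ (base X)).hom =
    (𝟙 (𝟙_ (PathInt C))) ▷ base X ≫ (baseMu (𝟙_ C) X).hom ≫ baseMap (λ_ X).hom := by
  rw [id_whiskerRight, Category.id_comp]
  change J (λ_ X).hom (ρ_ (𝟙_ C)).inv = J (𝟙 _) (λ_ (𝟙_ C)).inv ≫ J (λ_ X).hom (𝟙 _)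
  rw [J_comp, Category.id_comp, Category.id_comp, unitors_inv_equal]

lemma base_right_unit (X : C) : (ρ_ (base X)).hom =
    base X ◁ (𝟙 (𝟙_ (PathInt C))) ≫ (baseMu X (𝟙_ C)).hom ≫ baseMap (ρ_ X).hom := by
  rw [MonoidalCategory.whiskerLeft_id, Category.id_comp]
  change J (ρ_ X).hom (λ_ (𝟙_ C)).inv = J (𝟙 _) (λ_ (𝟙_ C)).inv ≫ J (ρ_ X).hom (𝟙 _)
  rw [J_comp, Category.id_comp, Category.id_comp]

lemma base_braid (X Y : C) : (baseMu X Y).hom ≫ baseMap (β_ X Y).hom =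
    (β_ (base X) (base Y)).hom ≫ (baseMu Y X).hom := by
  change J (𝟙 _) (λ_ (𝟙_ C)).inv ≫ J (β_ X Y).hom (𝟙 _) =
    J (β_ X Y).hom (β_ (𝟙_ C) (𝟙_ C)).hom ≫ J (𝟙 _) (λ_ (𝟙_ C)).inv
  rw [J_comp, J_comp]
  congr 1
  · simp
  · simp [unitors_inv_equal]

/-- The strong monoidal structure of `F ∘ N`: the unit comparison is the identity of `(I, I)`, and
the comparison for the tensor product is the structural isomorphism `I ⊗ I ≅ I` in the second
component (an identity if `C` is strict). -/
instance : (embed C).Monoidal := Functor.CoreMonoidal.toMonoidal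
  { εIso := Iso.refl _
    μIso := baseMu
    μIso_hom_natural_left := base_nat_left
    μIso_hom_natural_right := fun X f => base_nat_right X f
    associativity := base_assoc
    left_unitality := base_left_unit
    right_unitality := base_right_unit }

instance : (embed C).Braided where
  braided X Y := base_braid X Y

section Traced

variable {D : Type u₂} [Category.{v₂} D] [MonoidalCategory D] [SymmetricCategory D]

/-- The canonical trace of a compact closed category, i.e. of a symmetric monoidal category in which
every object `U` has a chosen dual `ᘁU` with unit `η_ : I ⟶ ᘁU ⊗ U` and counit
`ε_ : U ⊗ ᘁU ⟶ I`:
`A ⟶ A ⊗ ᘁU ⊗ U ⟶ A ⊗ U ⊗ ᘁU ⟶ B ⊗ U ⊗ ᘁU ⟶ B`. -/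
def canonicalTrace [LeftRigidCategory D] {A B : D} (U : D) (f : A ⊗ U ⟶ B ⊗ U) : A ⟶ B :=
  (ρ_ A).inv ≫ A ◁ η_ (ᘁU) U ≫ A ◁ (β_ (ᘁU) U).hom ≫ (α_ A U (ᘁU)).inv ≫ f ▷ (ᘁU) ≫
    (α_ B U (ᘁU)).hom ≫ B ◁ ε_ (ᘁU) U ≫ (ρ_ B).hom

/-- A strong symmetric monoidal functor from a partially traced category to a compact closed
category preserves the trace: whenever the trace of `f` is defined, with value `t`, the canonical
trace of `μ ≫ G f ≫ μ⁻¹` is `G t`. -/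
def PreservesTrace [LeftRigidCategory D] (G : C ⥤ D) [G.Braided] : Prop :=
  ∀ ⦃A B U : C⦄ (f : A ⊗ U ⟶ B ⊗ U) (t : A ⟶ B), t ∈ PartiallyTraced.tr U f →
    canonicalTrace (G.obj U)
      (Functor.LaxMonoidal.μ G A U ≫ G.map f ≫ Functor.OplaxMonoidal.δ G B U) = G.map t

end Traced

end PartialTrace

namespace PartialTrace

/-! ### Dualities in a symmetric monoidal category and the traces they define. -/

section Letters

variable {E : Type u} [Category.{v} E] [MonoidalCategory E] [SymmetricCategory E]

/-! Both halves of the theorem rest on dualities and on bending wires along them (mates).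

Existence. If `D` is compact closed, its canonical trace is total, so every path in `Intᵖ(D)` has a
composite and every class of paths is the class of one arrow (`eq_sing`). Bending the negative wires
sends `A⁺ ⊗ B⁻ ⟶ B⁺ ⊗ A⁻` to a morphism from `A⁺ ⊗ (A⁻)*` to `B⁺ ⊗ (B⁻)*`, and turns composition by
trace into composition in `D` (`mate_comp`, `bendPath_eq`). It is compatible with tensoring by
identities, so having equal bends is a congruence and contains `∼`; hence `embed D` is faithful. It
is full because an arrow `(A, I) ⟶ (B, I)` is a morphism of `D` up to unitors, and essentially
surjective because `(a, x)` is isomorphic to the image of `a ⊗ x*`. A traced functor `G` preserves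
all composites that are defined (`map_mem_comp`), so it induces a functor `pathMap G` from `PathInt
C` to `PathInt D`; `L` is this functor followed by a symmetric monoidal inverse of `embed D`.

Uniqueness. In `PathInt C` the objects `(q, I)` and `(I, q)` are dual (`baseDual`), every `(a, x)`
is `(a, I) ⊗ (I, x)` (`decomp`), and every arrow is, along these isomorphisms, the mate of a
morphism of `C` (`decomp_arrow`). Strong symmetric monoidal functors preserve dualities and mates,
and the component of a monoidal transformation at an object determines its component at the dual
(`compat_of_isMonoidal`, `Compat.unique`). So the isomorphism `φ` followed by the inverse of `φ'`,
given on the objects `(a, I)`, has at most one extension. The forced formula is natural by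
`mate_nat`; that it is monoidal is checked on the objects `(a, I)` and `(I, p)` and propagated by
associativity and symmetry. -/

lemma sw_sw_assoc (X Y Z : E) {T : E} (h : (X ⊗ Y) ⊗ Z ⟶ T) : sw X Y Z ≫ sw X Z Y ≫ h = h := by
  rw [← Category.assoc, sw_sw, Category.id_comp]

lemma sw_nat_head_assoc {X X' : E} (f : X ⟶ X') (Y Z : E) {T : E} (h : (X' ⊗ Z) ⊗ Y ⟶ T) :
    f ▷ Y ▷ Z ≫ sw X' Y Z ≫ h = sw X Y Z ≫ f ▷ Z ▷ Y ≫ h := by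
  rw [← Category.assoc, sw_nat_head, Category.assoc]

lemma sw_sw_whisker (X Y Z V : E) : sw X Y Z ▷ V ≫ sw X Z Y ▷ V = 𝟙 _ := by
  rw [← comp_whiskerRight, sw_sw, id_whiskerRight]

lemma sw_sw_whisker_whisker_assoc (X Y Z V W : E) {T : E} (h : (((X ⊗ Y) ⊗ Z) ⊗ V) ⊗ W ⟶ T) :
    sw X Y Z ▷ V ▷ W ≫ sw X Z Y ▷ V ▷ W ≫ h = h := by
  rw [← comp_whiskerRight_assoc, sw_sw_whisker, id_whiskerRight, Category.id_comp]

/-- Crossing two blocks amounts to four crossings of single factors. Words bracketed to the left,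
moved by `sw` on single letters, are the normal form in which string diagrams are compared below. -/
lemma swap_blocks (Z y w q z : E) : sw Z (y ⊗ w) (q ⊗ z) =
    (α_ (Z ⊗ (y ⊗ w)) q z).inv ≫ (α_ Z y w).inv ▷ q ▷ z ≫ sw (Z ⊗ y) w q ▷ z ≫ sw Z y q ▷ w ▷ z ≫
      sw ((Z ⊗ q) ⊗ y) w z ≫ sw (Z ⊗ q) y z ▷ w ≫ (α_ Z q z).hom ▷ y ▷ w ≫ (α_ _ _ _).hom := by
  simp [sw]
  monoidal

variable {U U' V V' W W' : E}

/-- A morphism `I ⟶ U ⊗ U'`, inserted to the right of `X`. -/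
def insertUnit (η : 𝟙_ E ⟶ U ⊗ U') (X : E) : X ⟶ (X ⊗ U) ⊗ U' :=
  (ρ_ X).inv ≫ X ◁ η ≫ (α_ X U U').inv

/-- A morphism `U ⊗ U' ⟶ I`, applied to the right of `X`. -/
def applyCounit (ε : U ⊗ U' ⟶ 𝟙_ E) (X : E) : (X ⊗ U) ⊗ U' ⟶ X :=
  (α_ X U U').hom ≫ X ◁ ε ≫ (ρ_ X).hom

lemma insertUnit_nat (η : 𝟙_ E ⟶ U ⊗ U') {X Y : E} (f : X ⟶ Y) :
    f ≫ insertUnit η Y = insertUnit η X ≫ f ▷ U ▷ U' := by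
  simp only [insertUnit, Category.assoc, ← associator_inv_naturality_left]
  rw [whisker_exchange_assoc, rightUnitor_inv_naturality_assoc]

lemma applyCounit_nat (ε : U ⊗ U' ⟶ 𝟙_ E) {X Y : E} (f : X ⟶ Y) :
    f ▷ U ▷ U' ≫ applyCounit ε Y = applyCounit ε X ≫ f := by
  simp only [applyCounit, Category.assoc, associator_naturality_left_assoc]
  rw [← whisker_exchange_assoc, rightUnitor_naturality]

/-- This is naturality of `sw` in its last argument, applied to `η`. It moves every inserted unit to
the right end of the word; `applyCounit_right` does the same for counits. -/
lemma insertUnit_right (η : 𝟙_ E ⟶ U ⊗ U') (X Y : E) :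
    insertUnit η X ▷ Y = insertUnit η (X ⊗ Y) ≫ sw X Y U ▷ U' ≫ sw (X ⊗ U) Y U' := by
  have h := sw_nat_last X Y η
  have h2 := sw_tensor_last X Y U U'
  rw [sw_unit_last, Category.assoc] at h
  have h3 : insertUnit η X ▷ Y =
      (ρ_ _).inv ≫ (X ⊗ Y) ◁ η ≫ sw X Y (U ⊗ U') ≫ (α_ X U U').inv ▷ Y := by
    rw [reassoc_of% h, insertUnit]
    simp
  rw [h3, ← h2, insertUnit]
  simp only [Category.assoc]

lemma applyCounit_right (ε : U ⊗ U' ⟶ 𝟙_ E) (X Y : E) :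
    applyCounit ε X ▷ Y = sw (X ⊗ U) U' Y ≫ sw X U Y ▷ U' ≫ applyCounit ε (X ⊗ Y) := by
  have h := sw_nat_mid X ε Y
  have h2 := sw_tensor_mid X U U' Y
  rw [sw_unit_mid] at h
  have h3 : applyCounit ε X ▷ Y =
      (α_ X U U').hom ▷ Y ≫ sw X (U ⊗ U') Y ≫ (X ⊗ Y) ◁ ε ≫ (ρ_ _).hom := by
    rw [← reassoc_of% h, applyCounit]
    simp
  have h4 : sw X (U ⊗ U') Y = (α_ X U U').inv ▷ Y ≫ sw (X ⊗ U) U' Y ≫ sw X U Y ▷ U' ≫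
      (α_ _ _ _).hom := by
    rw [reassoc_of% h2]; simp
  rw [h3, h4, applyCounit]
  simp

/-- A pair of dual objects of a symmetric monoidal category. -/
structure DualPair (U U' : E) where
  /-- the unit of the duality -/
  η : 𝟙_ E ⟶ U ⊗ U'
  /-- the counit of the duality -/
  ε : U ⊗ U' ⟶ 𝟙_ E
  -- Unit and counit both have `U` on the left, so each triangle identity contains one crossing.
  -- They are required next to an arbitrary `X`, which is how they get used; `ofTriangles` needs
  -- only the bare identities.
  snake (X : E) : insertUnit η X ▷ U ≫ sw (X ⊗ U) U' U ≫ applyCounit ε (X ⊗ U) = 𝟙 _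
  snake' (X : E) : insertUnit η X ▷ U' ≫ sw (X ⊗ U) U' U' ≫ applyCounit ε X ▷ U' = 𝟙 _

namespace DualPair

/-- A duality is determined by two triangle identities. -/
def ofTriangles (η : 𝟙_ E ⟶ U ⊗ U') (ε : U ⊗ U' ⟶ 𝟙_ E)
    (zig : (λ_ U).inv ≫ η ▷ U ≫ sw U U' U ≫ (α_ U U U').hom ≫ U ◁ ε ≫ (ρ_ U).hom = 𝟙 U)
    (zag : (λ_ U').inv ≫ η ▷ U' ≫ sw U U' U' ≫ ε ▷ U' ≫ (λ_ U').hom = 𝟙 U') :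
    DualPair U U' where
  η := η
  ε := ε
  snake X := by
    have h := congrArg (fun t => X ◁ t) zig
    simp only [MonoidalCategory.whiskerLeft_id] at h
    rw [← h, insertUnit, applyCounit, sw_tensor_head]
    monoidal
  snake' X := by
    have h := congrArg (fun t => X ◁ t) zag
    simp only [MonoidalCategory.whiskerLeft_id] at h
    rw [← h, insertUnit, applyCounit, sw_tensor_head]
    monoidal

/-- The converse of `ofTriangles`: the case where `X` is the unit object gives back the bare
triangle. With `triangle_of_snake'` it serves to transport dualities along functors and to build
`baseDual`. -/
lemma triangle_of_snake {η : 𝟙_ E ⟶ U ⊗ U'} {ε : U ⊗ U' ⟶ 𝟙_ E}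
    (h : insertUnit η (𝟙_ E) ▷ U ≫ sw (𝟙_ E ⊗ U) U' U ≫ applyCounit ε (𝟙_ E ⊗ U) = 𝟙 _) :
    (λ_ U).inv ≫ η ▷ U ≫ sw U U' U ≫ (α_ U U U').hom ≫ U ◁ ε ≫ (ρ_ U).hom = 𝟙 U := by
  have h := congrArg (fun t => (λ_ U).inv ≫ t ≫ (λ_ U).hom) h
  simp only [Category.id_comp, Iso.inv_hom_id] at h
  rw [← h, insertUnit, applyCounit, sw_tensor_head]
  monoidal

lemma triangle_of_snake' {η : 𝟙_ E ⟶ U ⊗ U'} {ε : U ⊗ U' ⟶ 𝟙_ E}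
    (h : insertUnit η (𝟙_ E) ▷ U' ≫ sw (𝟙_ E ⊗ U) U' U' ≫ applyCounit ε (𝟙_ E) ▷ U' = 𝟙 _) :
    (λ_ U').inv ≫ η ▷ U' ≫ sw U U' U' ≫ ε ▷ U' ≫ (λ_ U').hom = 𝟙 U' := by
  have h := congrArg (fun t => (λ_ U').inv ≫ t ≫ (λ_ U').hom) h
  simp only [Category.id_comp, Iso.inv_hom_id] at h
  rw [← h, insertUnit, applyCounit, sw_tensor_head]
  monoidal

/-- The unit of a duality, inserted to the right of `X`. -/
abbrev cup (d : DualPair U U') (X : E) : X ⟶ (X ⊗ U) ⊗ U' := insertUnit d.η X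

/-- The counit of a duality, applied to the right of `X`. -/
abbrev cap (d : DualPair U U') (X : E) : (X ⊗ U) ⊗ U' ⟶ X := applyCounit d.ε X

variable (d : DualPair U U') (e : DualPair V V')

lemma cup_nat {X Y : E} (f : X ⟶ Y) : f ≫ d.cup Y = d.cup X ≫ f ▷ U ▷ U' := insertUnit_nat _ f

lemma cup_nat_assoc {X Y : E} (f : X ⟶ Y) {T : E} (h : (Y ⊗ U) ⊗ U' ⟶ T) :
    f ≫ d.cup Y ≫ h = d.cup X ≫ f ▷ U ▷ U' ≫ h := by
  rw [← Category.assoc, cup_nat, Category.assoc]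

lemma cap_nat {X Y : E} (f : X ⟶ Y) : f ▷ U ▷ U' ≫ d.cap Y = d.cap X ≫ f := applyCounit_nat _ f

lemma cup_left (X Y : E) : d.cup (X ⊗ Y) =
    X ◁ d.cup Y ≫ (α_ _ _ _).inv ≫ (α_ _ _ _).inv ▷ U' := by
  simp only [cup, insertUnit]; monoidal

lemma cap_left (X Y : E) : d.cap (X ⊗ Y) =
    (α_ _ _ _).hom ▷ U' ≫ (α_ _ _ _).hom ≫ X ◁ d.cap Y := by
  simp only [cap, applyCounit]; monoidal

lemma cup_right (X Y : E) :
    d.cup X ▷ Y = d.cup (X ⊗ Y) ≫ sw X Y U ▷ U' ≫ sw (X ⊗ U) Y U' := insertUnit_right _ X Y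

lemma cap_right (X Y : E) :
    d.cap X ▷ Y = sw (X ⊗ U) U' Y ≫ sw X U Y ▷ U' ≫ d.cap (X ⊗ Y) := applyCounit_right _ X Y

/-- The first triangle with its unit moved to the right end. Read as a trace, it is yanking. -/
lemma yank (X : E) : d.cup (X ⊗ U) ≫ sw X U U ▷ U' ≫ d.cap (X ⊗ U) = 𝟙 _ := by
  rw [← d.snake X, insertUnit_right]
  simp only [Category.assoc, sw_sw_assoc]

lemma yank_right (X : E) : d.cup (X ⊗ U') ≫ sw X U' U ▷ U' ≫ d.cap X ▷ U' = 𝟙 _ := by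
  rw [← d.snake' X, insertUnit_right]
  simp only [Category.assoc, sw_sw_assoc]

/-- The duality of the unit object with itself. -/
def unit : DualPair (𝟙_ E) (𝟙_ E) := ofTriangles (λ_ _).inv (λ_ _).hom
  (by simp only [sw_unit_mid]; monoidal) (by simp only [sw_unit_mid]; monoidal)

/-- The first triangle for the tensor product of two dualities: the loop on `V` is pulled straight
first, which leaves a loop on `U` beside an idle factor `V`. -/
lemma yank_yank (X : E) :
    d.cup ((X ⊗ U) ⊗ V) ≫ e.cup (((X ⊗ U) ⊗ V) ⊗ U) ▷ U' ≫ sw (X ⊗ U) V U ▷ V ▷ V' ▷ U' ≫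
      sw X U U ▷ V ▷ V ▷ V' ▷ U' ≫ sw ((X ⊗ U) ⊗ U) V V ▷ V' ▷ U' ≫
      sw (X ⊗ U) U V ▷ V ▷ V' ▷ U' ≫ e.cap (((X ⊗ U) ⊗ V) ⊗ U) ▷ U' ≫ d.cap ((X ⊗ U) ⊗ V) =
    𝟙 _ := by
  have h1 : e.cup (((X ⊗ U) ⊗ V) ⊗ U) ≫ sw (X ⊗ U) V U ▷ V ▷ V' ≫ sw X U U ▷ V ▷ V ▷ V' ≫
      sw ((X ⊗ U) ⊗ U) V V ▷ V' ≫ sw (X ⊗ U) U V ▷ V ▷ V' ≫ e.cap (((X ⊗ U) ⊗ V) ⊗ U) =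
      sw (X ⊗ U) V U ≫ sw X U U ▷ V ≫ sw (X ⊗ U) U V := by
    have h := e.yank ((X ⊗ U) ⊗ U)
    rw [cap_nat, ← cup_nat_assoc, ← cup_nat_assoc, reassoc_of% h]
  have h2 : d.cup ((X ⊗ U) ⊗ V) ≫ sw (X ⊗ U) V U ▷ U' =
      d.cup (X ⊗ U) ▷ V ≫ sw ((X ⊗ U) ⊗ U) U' V := by
    rw [cup_right, Category.assoc, Category.assoc, sw_sw, Category.comp_id]
  have h3 : sw (X ⊗ U) U V ▷ U' ≫ d.cap ((X ⊗ U) ⊗ V) =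
      sw ((X ⊗ U) ⊗ U) V U' ≫ d.cap (X ⊗ U) ▷ V := by
    rw [cap_right, sw_sw_assoc]
  have h1' := congrArg (fun t => t ▷ U') h1
  simp only [comp_whiskerRight] at h1'
  rw [reassoc_of% h1', reassoc_of% h2, h3, sw_nat_head_assoc, sw_sw_assoc,
    ← comp_whiskerRight, ← comp_whiskerRight, yank, id_whiskerRight]

/-- A zigzag on `U'` that has to cross `Z` straightens to the plain crossing of `U'` with `Z`. -/
lemma yank_past (X Z : E) :
    d.cup ((X ⊗ U') ⊗ Z) ≫ sw (X ⊗ U') Z U ▷ U' ≫ sw X U' U ▷ Z ▷ U' ≫ d.cap X ▷ Z ▷ U' =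
      sw X U' Z := by
  have h : d.cup ((X ⊗ U') ⊗ Z) ≫ sw (X ⊗ U') Z U ▷ U' =
      d.cup (X ⊗ U') ▷ Z ≫ sw ((X ⊗ U') ⊗ U) U' Z := by
    rw [cup_right, Category.assoc, Category.assoc, sw_sw, Category.comp_id]
  rw [reassoc_of% h, ← sw_nat_head_assoc, ← sw_nat_head, ← comp_whiskerRight_assoc,
    ← comp_whiskerRight_assoc, Category.assoc, yank_right, id_whiskerRight, Category.id_comp]

/-- The second triangle for the tensor product: the zigzag on `V'` is straightened past `U'`, then
the one on `U'` alone. -/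
lemma yank_yank_right (X : E) :
    d.cup ((X ⊗ V') ⊗ U') ≫ e.cup (((X ⊗ V') ⊗ U') ⊗ U) ▷ U' ≫ sw (X ⊗ V') U' U ▷ V ▷ V' ▷ U' ≫
      sw X V' U ▷ U' ▷ V ▷ V' ▷ U' ≫ sw ((X ⊗ U) ⊗ V') U' V ▷ V' ▷ U' ≫
      sw (X ⊗ U) V' V ▷ U' ▷ V' ▷ U' ≫ e.cap (X ⊗ U) ▷ U' ▷ V' ▷ U' ≫ d.cap X ▷ V' ▷ U' =
    𝟙 _ := by
  have h1 := e.yank_past (X ⊗ U) U'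
  have h2 : sw (X ⊗ U) V' U' ≫ d.cap X ▷ V' = sw X U V' ▷ U' ≫ d.cap (X ⊗ V') := by
    rw [cap_right, sw_sw_assoc]
  have h1' := congrArg (fun t => t ▷ U') h1
  have h2' := congrArg (fun t => t ▷ U') h2
  simp only [comp_whiskerRight] at h1' h2'
  have n1 := congrArg (fun t => t ▷ U') (e.cup_nat (sw (X ⊗ V') U' U))
  have n2 := congrArg (fun t => t ▷ U') (e.cup_nat (sw X V' U ▷ U'))
  simp only [comp_whiskerRight] at n1 n2
  rw [← reassoc_of% n1, ← reassoc_of% n2, reassoc_of% h1', h2', sw_sw_whisker_whisker_assoc,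
    yank_right]

/-- Duality of tensor products. -/
def tensor : DualPair (U ⊗ V) (V' ⊗ U') where
  η := d.η ≫ e.cup U ▷ U' ≫ (α_ (U ⊗ V) V' U').hom
  ε := (α_ (U ⊗ V) V' U').inv ≫ e.cap U ▷ U' ≫ d.ε
  snake X := by
    have h := yank_yank d e X
    rw [insertUnit_right]
    simp only [Category.assoc, sw_sw_assoc]
    have h1 := congrArg (fun t => (α_ X U V).inv ≫ t ≫ (α_ X U V).hom) h
    simp only [Category.id_comp, Iso.inv_hom_id] at h1
    rw [← h1, swap_blocks]
    simp only [cup, cap, insertUnit, applyCounit]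
    monoidal
  snake' X := by
    have h := yank_yank_right d e X
    rw [insertUnit_right]
    simp only [Category.assoc, sw_sw_assoc]
    have h1 := congrArg (fun t => (α_ X V' U').inv ≫ t ≫ (α_ X V' U').hom) h
    simp only [Category.id_comp, Iso.inv_hom_id] at h1
    rw [← h1, swap_blocks]
    simp only [cup, cap, insertUnit, applyCounit]
    monoidal

lemma cup_tensor (X : E) : (tensor d e).cup X = d.cup X ≫ e.cup (X ⊗ U) ▷ U' ≫
    (α_ X U V).hom ▷ V' ▷ U' ≫ (α_ _ V' U').hom := by
  simp only [cup, insertUnit, tensor]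
  monoidal

lemma cap_tensor (X : E) : (tensor d e).cap X = (α_ _ V' U').inv ≫
    (α_ X U V).inv ▷ V' ▷ U' ≫ e.cap (X ⊗ U) ▷ U' ≫ d.cap X := by
  simp only [cap, applyCounit, tensor]
  monoidal

/-- The duality given by an exact pairing. -/
def ofExactPairing (U' U : E) [ExactPairing U' U] : DualPair U U' := ofTriangles
  (η_ U' U ≫ (β_ U' U).hom) (ε_ U' U)
  (by
    have h := ExactPairing.coevaluation_evaluation U' U
    have n1 := BraidedCategory.braiding_naturality_left (η_ U' U) U
    have n2 := BraidedCategory.braiding_naturality_left (ε_ U' U) U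
    -- Both sides carry `U'` past the two copies of `U`; the left side crosses these copies twice,
    -- which cancels by symmetry.
    have hp : (β_ (U' ⊗ U) U).hom ≫ (α_ _ _ _).inv ≫ (β_ (U ⊗ U') U).hom =
        (β_ U' U).hom ▷ U ≫ sw U U' U ≫ (α_ _ _ _).hom := by
      have n := BraidedCategory.braiding_naturality_right U' (β_ U U).hom
      simp only [BraidedCategory.braiding_tensor_right_hom] at n
      have n' := congrArg (fun t => (α_ U' U U).hom ≫ t ≫ (β_ U U).hom ▷ U' ≫ (α_ _ _ _).hom) n
      simp only [Category.assoc, ← comp_whiskerRight_assoc, SymmetricCategory.symmetry,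
        id_whiskerRight, Category.id_comp, Iso.inv_hom_id, Category.comp_id] at n'
      simpa [sw, BraidedCategory.braiding_tensor_left_hom] using n'
    rw [comp_whiskerRight_assoc, ← reassoc_of% hp, reassoc_of% n1, ← reassoc_of% n2,
      reassoc_of% h]
    simp)
  (by
    have h := ExactPairing.evaluation_coevaluation U' U
    have n := BraidedCategory.braiding_naturality_right U' (ε_ U' U)
    have hp : (β_ U' U).hom ▷ U' ≫ sw U U' U' = (α_ _ _ _).hom ≫ (β_ U' (U ⊗ U')).hom := by
      simp [sw]
    rw [comp_whiskerRight_assoc, reassoc_of% hp, ← reassoc_of% n, reassoc_of% h]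
    simp)

/-- The trace defined by a duality. -/
def trace {A B : E} (f : A ⊗ U ⟶ B ⊗ U) : A ⟶ B := d.cup A ≫ f ▷ U' ≫ d.cap B

lemma trace_nat {A B A' B' : E} (g : A' ⟶ A) (f : A ⊗ U ⟶ B ⊗ U) (h : B ⟶ B') :
    d.trace (g ▷ U ≫ f ≫ h ▷ U) = g ≫ d.trace f ≫ h := by
  simp only [trace, comp_whiskerRight, Category.assoc, cap_nat, cup_nat_assoc]

lemma trace_left {A B X Y : E} (f : A ⊗ U ⟶ B ⊗ U) (g : X ⟶ Y) :
    d.trace ((α_ X A U).hom ≫ (g ⊗ₘ f) ≫ (α_ Y B U).inv) = g ⊗ₘ d.trace f := by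
  have h := d.trace_nat (𝟙 _) ((α_ X A U).hom ≫ X ◁ f ≫ (α_ X B U).inv) (g ▷ B)
  have h' : d.trace ((α_ X A U).hom ≫ X ◁ f ≫ (α_ X B U).inv) = X ◁ d.trace f := by
    simp only [trace, cup_left, cap_left]
    monoidal
  rw [h', Category.id_comp, ← tensorHom_def'] at h
  rw [← h, tensorHom_def']
  simp

lemma trace_right {A B : E} (f : A ⊗ U ⟶ B ⊗ U) (Y : E) :
    d.trace (sw A Y U ≫ f ▷ Y ≫ sw B U Y) = d.trace f ▷ Y := by
  simp only [trace, comp_whiskerRight, Category.assoc, cap_right, cup_right, sw_nat_head_assoc,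
    sw_sw_assoc]

lemma trace_braid : d.trace (β_ U U).hom = 𝟙 U := by
  have h := d.yank (𝟙_ E)
  have h' : sw (𝟙_ E) U U = (λ_ U).hom ▷ U ≫ (β_ U U).hom ≫ (λ_ U).inv ▷ U := by
    simp [sw]
  rw [h'] at h
  simp only [comp_whiskerRight, Category.assoc, cap_nat] at h
  rw [← cup_nat_assoc] at h
  have := congrArg (fun t => (λ_ U).inv ≫ t ≫ (λ_ U).hom) h
  simpa [trace] using this

/-- Two counits on interleaved factors may be applied in either order. -/
lemma cap_cap (B : E) :
    sw B V U ▷ U' ▷ V' ≫ sw ((B ⊗ U) ⊗ V) U' V' ≫ e.cap (B ⊗ U) ▷ U' ≫ d.cap B =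
      d.cap (B ⊗ V) ▷ V' ≫ e.cap B := by
  rw [cap_right]
  simp only [Category.assoc, sw_sw_assoc]
  rw [← e.cap_nat, cap_right]
  simp only [comp_whiskerRight, Category.assoc, sw_sw_w, sw_sw_whisker_whisker_assoc]

/-- Dinaturality, for traces taken with respect to arbitrary dualities. -/
lemma trace_dinat {A B : E} (f : A ⊗ U ⟶ B ⊗ V) (g : V ⟶ U) :
    d.trace (f ≫ B ◁ g) = e.trace (A ◁ g ≫ f) := by
  have hcap := cap_cap d e B
  have hcup : d.cup A ≫ e.cup (A ⊗ U) ▷ U' =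
      e.cup A ≫ d.cup A ▷ V ▷ V' ≫ sw (A ⊗ U) U' V ▷ V' ≫ sw ((A ⊗ U) ⊗ V) U' V' := by
    rw [cup_right, ← cup_nat_assoc]
  -- `hd` and `he` present the two composites of `f` and `g` as partial traces of the same diagram,
  -- `f` and `g` side by side: over `U` in one case, over `V` in the other. Both sides of the claim
  -- are then the double trace, with units and counits taken in different orders.
  have hd : A ◁ g ≫ f = d.cup A ▷ V ≫ sw (A ⊗ U) U' V ≫ ((A ⊗ U) ◁ g) ▷ U' ≫ f ▷ U ▷ U' ≫
      d.cap (B ⊗ V) := by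
    have h := d.yank A
    rw [cap_nat, cup_right]
    simp only [Category.assoc, sw_sw_assoc]
    rw [← comp_whiskerRight_assoc, ← sw_nat_mid, comp_whiskerRight_assoc, ← cup_nat_assoc,
      reassoc_of% h]
  have he : f ≫ B ◁ g = e.cup (A ⊗ U) ≫ f ▷ V ▷ V' ≫ ((B ⊗ V) ◁ g) ▷ V' ≫ sw B V U ▷ V' ≫
      e.cap (B ⊗ U) := by
    rw [← comp_whiskerRight_assoc ((B ⊗ V) ◁ g), sw_nat_last, comp_whiskerRight_assoc, cap_nat,
      ← cup_nat_assoc]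
    have h := e.yank B
    rw [reassoc_of% h]
  rw [trace, trace, hd, he]
  simp only [comp_whiskerRight, Category.assoc]
  rw [reassoc_of% hcup, ← hcap]
  rw [← sw_nat_head_assoc (f ▷ V), ← sw_nat_head_assoc ((B ⊗ V) ◁ g), ← sw_nat_head_assoc]
  simp only [← comp_whiskerRight_assoc, whisker_exchange]

end DualPair
end Letters
end PartialTrace

namespace PartialTrace

/-! ### Mates, and morphisms compatible with dualities. -/

section Mates

variable {E : Type u} [Category.{v} E] [MonoidalCategory E] [SymmetricCategory E]
variable {U U' V V' W W' A B X a a' b b' c c' : E}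

lemma sw_tensorHom {X X' Y Y' Z Z' : E} (f : X ⟶ X') (g : Y ⟶ Y') (h : Z ⟶ Z') :
    ((f ⊗ₘ g) ⊗ₘ h) ≫ sw X' Y' Z' = sw X Y Z ≫ ((f ⊗ₘ h) ⊗ₘ g) := by
  simp only [MonoidalCategory.tensorHom_def, comp_whiskerRight, Category.assoc]
  rw [sw_nat_last, reassoc_of% sw_nat_mid, reassoc_of% sw_nat_head, whisker_exchange]

lemma tensorHom_whisker_square {X Y X₁ Y₁ Z Z₁ : E} {p : X ⟶ X₁} {g : X ⟶ Y} {g₁ : X₁ ⟶ Y₁}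
    {q : Y ⟶ Y₁} (h : p ≫ g₁ = g ≫ q) (r : Z ⟶ Z₁) :
    (p ⊗ₘ r) ≫ g₁ ▷ Z₁ = g ▷ Z ≫ (q ⊗ₘ r) := by
  simp only [← tensorHom_id, MonoidalCategory.tensorHom_comp_tensorHom, h, Category.id_comp,
    Category.comp_id]

namespace DualPair

/-- The mate of a morphism `A ⊗ b ⟶ B ⊗ a` with respect to dualities of `a` and of `b`. -/
def mate (d : DualPair a a') (e : DualPair b b') (f : A ⊗ b ⟶ B ⊗ a) : A ⊗ a' ⟶ B ⊗ b' :=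
  e.cup (A ⊗ a') ≫ sw A a' b ▷ b' ≫ f ▷ a' ▷ b' ≫ d.cap B ▷ b'

/-- The composite of two mates is the mate of the traced composite. -/
lemma mate_comp (da : DualPair a a') (db : DualPair b b') (dc : DualPair c c') {C : E}
    (f : A ⊗ b ⟶ B ⊗ a) (g : B ⊗ c ⟶ C ⊗ b) :
    mate da db f ≫ mate db dc g =
      mate da dc (db.trace (sw A c b ≫ f ▷ c ≫ sw B a c ≫ g ▷ a ≫ sw C b a)) := by
  -- The unit for `c` moves to the front by naturality, and what remains is whiskered by `c'`; `key`
  -- is the comparison before this whiskering.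
  have key : mate da db f ▷ c ≫ sw B b' c ≫ g ▷ b' ≫ db.cap C =
      sw A a' c ≫ db.trace (sw A c b ≫ f ▷ c ≫ sw B a c ≫ g ▷ a ≫ sw C b a) ▷ a' ≫ da.cap C := by
    have h1 : da.cap B ▷ c ≫ g = sw (B ⊗ a) a' c ≫ sw B a c ▷ a' ≫ g ▷ a ▷ a' ≫ da.cap (C ⊗ b) := by
      rw [cap_right, cap_nat]
      simp only [Category.assoc]
    have h2 : sw (A ⊗ a') c b ≫ sw A a' b ▷ c ≫ f ▷ a' ▷ c ≫ da.cap B ▷ c ≫ g =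
        sw A a' c ▷ b ≫ sw (A ⊗ c) a' b ≫ sw A c b ▷ a' ≫ f ▷ c ▷ a' ≫ sw B a c ▷ a' ≫
          g ▷ a ▷ a' ≫ da.cap (C ⊗ b) := by
      have hb := sw_braid A a' c b
      rw [h1, sw_nat_head_assoc, ← reassoc_of% hb]
    have h2' := congrArg (fun t => t ▷ b') h2
    simp only [comp_whiskerRight] at h2'
    simp only [mate, trace, comp_whiskerRight, Category.assoc, cup_right]
    rw [← sw_nat_head_assoc (sw A a' b), ← sw_nat_head_assoc (f ▷ a'), ← sw_nat_head_assoc (da.cap B)]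
    simp only [sw_sw_assoc]
    rw [reassoc_of% h2', cup_nat_assoc, ← cap_cap]
    simp only [sw_nat_head_assoc]
  rw [mate, mate, mate, cup_nat_assoc]
  simp only [← comp_whiskerRight]
  congr 2
  simpa only [mate, Category.assoc, comp_whiskerRight] using key

/-- Two morphisms between the components of dualities that are compatible with the units and the
counits. -/
structure Compat (d : DualPair U U') (e : DualPair W W') (s : U ⟶ W) (s' : U' ⟶ W') : Prop where
  unit : d.η ≫ (s ⊗ₘ s') = e.η
  counit : (s ⊗ₘ s') ≫ e.ε = d.ε

namespace Compat

variable {d : DualPair U U'} {e : DualPair W W'} {s : U ⟶ W} {s' : U' ⟶ W'}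

lemma cup (h : Compat d e s s') {X Y : E} (u : X ⟶ Y) :
    d.cup X ≫ ((u ⊗ₘ s) ⊗ₘ s') = u ≫ e.cup Y := by
  rw [DualPair.cup, DualPair.cup, insertUnit, insertUnit, ← h.unit]
  simp only [Category.assoc, ← associator_inv_naturality, MonoidalCategory.whiskerLeft_comp]
  rw [tensorHom_def' u, rightUnitor_inv_naturality_assoc, ← whisker_exchange_assoc,
    ← whisker_exchange_assoc]
  simp only [Category.assoc]

lemma cap (h : Compat d e s s') {X Y : E} (u : X ⟶ Y) :
    ((u ⊗ₘ s) ⊗ₘ s') ≫ e.cap Y = d.cap X ≫ u := by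
  rw [DualPair.cap, DualPair.cap, applyCounit, applyCounit, ← h.counit]
  simp only [Category.assoc, associator_naturality_assoc, MonoidalCategory.whiskerLeft_comp]
  rw [← rightUnitor_naturality, tensorHom_def' u, Category.assoc, ← whisker_exchange_assoc]

/-- The case of a leading unit object suffices, since unitors remove it; this puts both conditions
into the left-bracketed form. -/
lemma of_letters
    (h : d.cup (𝟙_ E) ≫ (𝟙_ E ◁ s) ▷ U' ≫ (𝟙_ E ⊗ W) ◁ s' = e.cup (𝟙_ E))
    (h' : (𝟙_ E ◁ s) ▷ U' ≫ (𝟙_ E ⊗ W) ◁ s' ≫ e.cap (𝟙_ E) = d.cap (𝟙_ E)) :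
    Compat d e s s' where
  unit := by
    have h1 := congrArg (fun t => t ≫ (λ_ W).hom ▷ W') h
    have h2 : e.cup (𝟙_ E) ≫ (λ_ W).hom ▷ W' = e.η := by
      simp only [DualPair.cup, insertUnit]; monoidal
    rw [← h2, ← h1, MonoidalCategory.tensorHom_def]
    simp only [DualPair.cup, insertUnit]
    monoidal
  counit := by
    have h1 := congrArg (fun t => (λ_ U).inv ▷ U' ≫ t) h'
    have h2 : (λ_ U).inv ▷ U' ≫ d.cap (𝟙_ E) = d.ε := by
      simp only [DualPair.cap, applyCounit]; monoidal
    rw [← h2, ← h1, MonoidalCategory.tensorHom_def]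
    simp only [DualPair.cap, applyCounit]
    monoidal

lemma refl (d : DualPair U U') : Compat d d (𝟙 U) (𝟙 U') := ⟨by simp, by simp⟩

lemma comp {d' : DualPair V V'} {t : W ⟶ V} {t' : W' ⟶ V'} (h : Compat d e s s')
    (h' : Compat e d' t t') : Compat d d' (s ≫ t) (s' ≫ t') where
  unit := by
    rw [← MonoidalCategory.tensorHom_comp_tensorHom, reassoc_of% h.unit, h'.unit]
  counit := by
    rw [← MonoidalCategory.tensorHom_comp_tensorHom, Category.assoc, h'.counit, h.counit]

/-- The second component of a compatible pair is determined by the first. -/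
lemma unique (h : Compat d e s s') {s'' : U' ⟶ W'} (h' : Compat d e s s'') : s' = s'' := by
  have h1 : 𝟙_ E ◁ s' = 𝟙_ E ◁ s'' := by
    have e1 := d.snake' (𝟙_ E)
    have e2 := e.snake' (𝟙_ E)
    have c1 := h.cup (𝟙 (𝟙_ E))
    have c2 := h'.cap (𝟙 (𝟙_ E))
    rw [Category.comp_id] at c2
    rw [Category.id_comp] at c1
    rw [← Category.id_comp (𝟙_ E ◁ s'), ← Category.comp_id (𝟙_ E ◁ s''), ← e1, ← e2]
    -- Only the unit condition for `s'` and the counit condition for `s''` are needed: both sides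
    -- become the unit of `d`, then `s`, `s'` and `s''` side by side, then the counit of `e`, up to
    -- the naturality of one crossing.
    change (d.cup _ ▷ _ ≫ _ ≫ d.cap _ ▷ _) ≫ _ = _ ≫ e.cup _ ▷ _ ≫ _ ≫ e.cap _ ▷ _
    rw [← c1, ← c2]
    have l : (((𝟙 (𝟙_ E) ⊗ₘ s) ⊗ₘ s'') ≫ e.cap (𝟙_ E)) ▷ U' ≫ 𝟙_ E ◁ s' =
        (((𝟙 (𝟙_ E) ⊗ₘ s) ⊗ₘ s'') ⊗ₘ s') ≫ e.cap (𝟙_ E) ▷ W' := by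
      rw [comp_whiskerRight, Category.assoc, ← whisker_exchange, MonoidalCategory.tensorHom_def _ s',
        Category.assoc]
    have r : 𝟙_ E ◁ s'' ≫ (d.cup (𝟙_ E) ≫ ((𝟙 (𝟙_ E) ⊗ₘ s) ⊗ₘ s')) ▷ W' =
        d.cup (𝟙_ E) ▷ U' ≫ (((𝟙 (𝟙_ E) ⊗ₘ s) ⊗ₘ s') ⊗ₘ s'') := by
      rw [whisker_exchange, comp_whiskerRight, Category.assoc, MonoidalCategory.tensorHom_def _ s'']
    simp only [Category.assoc]
    rw [l, reassoc_of% r, reassoc_of% sw_tensorHom]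
  simpa using h1

end Compat

/-- Compatible pairs pass through the units and counits in the definition of `mate`. Thus a square
for `f` and `f₁` gives a square for their mates, with the dual components in the second factor. -/
lemma mate_nat {A₁ B₁ a₁ a₁' b₁ b₁' : E} {da : DualPair a a'} {da₁ : DualPair a₁ a₁'}
    {db : DualPair b b'} {db₁ : DualPair b₁ b₁'} {sa : a ⟶ a₁} {sa' : a' ⟶ a₁'} {sb : b ⟶ b₁}
    {sb' : b' ⟶ b₁'} (ha : Compat da da₁ sa sa') (hb : Compat db db₁ sb sb')
    (u : A ⟶ A₁) (w : B ⟶ B₁) {f : A ⊗ b ⟶ B ⊗ a} {f₁ : A₁ ⊗ b₁ ⟶ B₁ ⊗ a₁}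
    (h : (u ⊗ₘ sb) ≫ f₁ = f ≫ (w ⊗ₘ sa)) :
    (u ⊗ₘ sa') ≫ mate da₁ db₁ f₁ = mate da db f ≫ (w ⊗ₘ sb') := by
  have t₁ := tensorHom_whisker_square (sw_tensorHom u sa' sb) sb'
  have t₂ := tensorHom_whisker_square (tensorHom_whisker_square h sa') sb'
  have t₃ := tensorHom_whisker_square (ha.cap w) sb'
  simp only [mate, Category.assoc]
  rw [← reassoc_of% hb.cup, reassoc_of% t₁, reassoc_of% t₂, t₃]

/-- The dual `U' ⟶ W'` of a morphism `g : W ⟶ U`. -/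
def star (d : DualPair U U') (e : DualPair W W') (g : W ⟶ U) : U' ⟶ W' :=
  (λ_ U').inv ≫ mate d e (𝟙_ E ◁ g) ≫ (λ_ W').hom

lemma whiskerLeft_star (d : DualPair U U') (e : DualPair W W') (g : W ⟶ U) (X : E) :
    X ◁ star d e g = mate d e (X ◁ g) := by
  simp only [star, mate, cup, cap, insertUnit, applyCounit, sw]
  monoidal

/-- Dualizing reverses arrows, so the partner of `s` is the dual of its inverse; this is why `s` has
to be an isomorphism. -/
lemma compat_star (d : DualPair U U') (e : DualPair W W') (s : U ≅ W) :
    Compat d e s.hom (star d e s.inv) := by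
  refine Compat.of_letters ?_ ?_
  · rw [whiskerLeft_star, mate]
    have h : (d.cup (𝟙_ E) ≫ (𝟙_ E ◁ s.hom) ▷ U') ▷ W ≫ sw (𝟙_ E ⊗ W) U' W ≫
        ((𝟙_ E ⊗ W) ◁ s.inv) ▷ U' ≫ d.cap (𝟙_ E ⊗ W) = 𝟙 _ := by
      have h1 := d.snake (𝟙_ E)
      rw [← reassoc_of% sw_nat_last, ← whisker_exchange_assoc, comp_whiskerRight_assoc,
        sw_nat_head_assoc, cap_nat, reassoc_of% h1, ← MonoidalCategory.whiskerLeft_comp,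
        s.inv_hom_id, MonoidalCategory.whiskerLeft_id]
    rw [← Category.assoc, cup_nat_assoc, ← comp_whiskerRight, ← comp_whiskerRight,
      ← comp_whiskerRight, h, id_whiskerRight, Category.comp_id]
  · rw [whiskerLeft_star, mate]
    have h1 : e.cup ((𝟙_ E ⊗ W) ⊗ U') ≫ sw (𝟙_ E ⊗ W) U' W ▷ W' =
        e.cup (𝟙_ E ⊗ W) ▷ U' ≫ sw ((𝟙_ E ⊗ W) ⊗ W) W' U' := by
      rw [cup_right, Category.assoc, Category.assoc, sw_sw, Category.comp_id]
    have h2 : e.cup (𝟙_ E ⊗ W) ≫ ((𝟙_ E ⊗ W) ◁ s.inv) ▷ W' ≫ sw (𝟙_ E) W U ▷ W' ≫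
        e.cap (𝟙_ E ⊗ U) = 𝟙_ E ◁ s.inv := by
      have h := e.yank (𝟙_ E)
      rw [← comp_whiskerRight_assoc, sw_nat_last, comp_whiskerRight_assoc, cap_nat,
        reassoc_of% h]
    have h2' := congrArg (fun t => t ▷ U') h2
    simp only [comp_whiskerRight] at h2'
    simp only [Category.assoc]
    rw [reassoc_of% h1, ← cap_cap, ← sw_nat_head_assoc, ← sw_nat_head_assoc, sw_sw_assoc,
      reassoc_of% h2', ← comp_whiskerRight_assoc, ← MonoidalCategory.whiskerLeft_comp,
      s.hom_inv_id, MonoidalCategory.whiskerLeft_id, id_whiskerRight, Category.id_comp]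

/-- Dual objects are unique up to isomorphism. -/
def starIso (d : DualPair U U') (e : DualPair W W') (s : U ≅ W) : U' ≅ W' where
  hom := star d e s.inv
  inv := star e d s.hom
  hom_inv_id := ((compat_star d e s).comp (compat_star e d s.symm)).unique
    (by simpa using Compat.refl d)
  inv_hom_id := ((compat_star e d s.symm).comp (compat_star d e s)).unique
    (by simpa using Compat.refl e)

section Map

open Functor.LaxMonoidal Functor.OplaxMonoidal Functor.Monoidal

variable {E' : Type u₂} [Category.{v₂} E'] [MonoidalCategory E'] [SymmetricCategory E']
  (L : E ⥤ E') [L.Braided]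

lemma μ_map_sw (X Y Z : E) : μ L X Y ▷ L.obj Z ≫ μ L (X ⊗ Y) Z ≫ L.map (sw X Y Z) =
    sw (L.obj X) (L.obj Y) (L.obj Z) ≫ μ L X Z ▷ L.obj Y ≫ μ L (X ⊗ Z) Y := by
  have h := Functor.LaxMonoidal.associativity_inv L X Z Y
  have hb := Functor.LaxBraided.braided (F := L) Y Z
  simp only [sw, Functor.map_comp, Category.assoc]
  rw [Functor.LaxMonoidal.associativity_assoc, ← μ_natural_right_assoc, ← h,
    ← MonoidalCategory.whiskerLeft_comp_assoc, hb]
  simp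

lemma sw_eq_map (X Y Z : E) : sw (L.obj X) (L.obj Y) (L.obj Z) =
    μ L X Y ▷ L.obj Z ≫ μ L (X ⊗ Y) Z ≫ L.map (sw X Y Z) ≫ δ L (X ⊗ Z) Y ≫ δ L X Z ▷ L.obj Y := by
  have h := μ_map_sw L X Y Z
  rw [reassoc_of% h]
  simp

/-- The image of a duality under a strong symmetric monoidal functor. -/
def map (d : DualPair U U') : DualPair (L.obj U) (L.obj U') := ofTriangles
  (Functor.LaxMonoidal.ε L ≫ L.map d.η ≫ δ L U U')
  (μ L U U' ≫ L.map d.ε ≫ Functor.OplaxMonoidal.η L)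
  (by
    have h := congrArg L.map (triangle_of_snake (d.snake (𝟙_ E)))
    simp only [Functor.map_comp, L.map_id] at h
    rw [← h, sw_eq_map]
    simp)
  (by
    have h := congrArg L.map (triangle_of_snake' (d.snake' (𝟙_ E)))
    simp only [Functor.map_comp, L.map_id] at h
    rw [← h, sw_eq_map]
    simp)

lemma cup_map (d : DualPair U U') (X : E) :
    (d.map L).cup (L.obj X) ≫ μ L X U ▷ L.obj U' ≫ μ L (X ⊗ U) U' = L.map (d.cup X) := by
  simp [cup, insertUnit, map, ofTriangles]

lemma cap_map (d : DualPair U U') (X : E) :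
    μ L X U ▷ L.obj U' ≫ μ L (X ⊗ U) U' ≫ L.map (d.cap X) = (d.map L).cap (L.obj X) := by
  simp [cap, applyCounit, map, ofTriangles]

/-- Units, counits and crossings are preserved up to the comparison maps `μ`, and `mate` is built
from nothing else. -/
lemma mate_map (d : DualPair a a') (e : DualPair b b') (f : A ⊗ b ⟶ B ⊗ a) :
    mate (d.map L) (e.map L) (μ L A b ≫ L.map f ≫ δ L B a) ≫ μ L B b' =
      μ L A a' ≫ L.map (mate d e f) := by
  have hs := μ_map_sw L A a' b
  have hc := cap_map L d B
  simp only [mate, Functor.map_comp, Category.assoc]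
  rw [← cup_map, Category.assoc, Category.assoc, cup_nat_assoc]
  rw [← μ_natural_left_assoc, ← μ_natural_left_assoc, ← μ_natural_left]
  simp only [← comp_whiskerRight_assoc]
  rw [reassoc_of% hs, ← μ_natural_left_assoc, ← hc]
  simp

end Map

end DualPair
end Mates
end PartialTrace

namespace PartialTrace

/-! ### Compact closed categories: `embed D` is fully faithful. -/

section CompactClosed

open DualPair

variable {D : Type u} [Category.{v} D] [MonoidalCategory D] [SymmetricCategory D]

/-- Dinaturality along the identity. It allows the vanishing axioms to be checked with the unit
duality and with tensor products of dualities instead of the chosen duals. -/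
lemma DualPair.trace_eq {U U' U'' A B : D} (d : DualPair U U') (e : DualPair U U'')
    (f : A ⊗ U ⟶ B ⊗ U) : d.trace f = e.trace f := by
  simpa using trace_dinat d e f (𝟙 U)

lemma DualPair.trace_unit {A B : D} (f : A ⊗ 𝟙_ D ⟶ B ⊗ 𝟙_ D) :
    unit.trace f = (ρ_ A).inv ≫ f ≫ (ρ_ B).hom := by
  simp only [trace, cup, cap, insertUnit, applyCounit, unit, ofTriangles]
  monoidal

lemma DualPair.trace_tensor {U U' V V' A B : D} (d : DualPair U U') (e : DualPair V V')
    (f : (A ⊗ U) ⊗ V ⟶ (B ⊗ U) ⊗ V) :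
    (tensor d e).trace ((α_ A U V).inv ≫ f ≫ (α_ B U V).hom) = d.trace (e.trace f) := by
  simp only [trace, cup_tensor, cap_tensor]
  monoidal

/-- Vanishing II for the path `p.cons f`, whose loop object is `V ⊗ b`: tracing out `V` first
replaces the path by its composite. The inner variable must be the last one, hence the passage to `b
⊗ V` by dinaturality along the symmetry. -/
lemma DualPair.trace_two_loops {A B C a b b' c V V' W' : D} (d : DualPair b b') (e : DualPair V V')
    (e' : DualPair (V ⊗ b) W') (q : (A ⊗ V) ⊗ b ⟶ (B ⊗ a) ⊗ V) (f : B ⊗ c ⟶ C ⊗ b) :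
    e'.trace (sw A c (V ⊗ b) ≫ (α_ A V b).inv ▷ c ≫ q ▷ c ≫ sw (B ⊗ a) V c ≫ sw B a c ▷ V ≫
      f ▷ a ▷ V ≫ sw C b a ▷ V ≫ sw (C ⊗ a) b V ≫ (α_ (C ⊗ a) V b).hom) =
    d.trace (sw A c b ≫ e.trace (sw A b V ≫ q) ▷ c ≫ sw B a c ≫ f ▷ a ≫ sw C b a) := by
  have hin : (A ⊗ c) ◁ (β_ b V).hom ≫ sw A c (V ⊗ b) ≫ (α_ A V b).inv ▷ c =
      (α_ _ _ _).inv ≫ sw A c b ▷ V ≫ sw (A ⊗ b) c V ≫ sw A b V ▷ c := by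
    rw [← sw_tensor_last, sw_eq_braid, sw_braid]
    simp
  have hout : sw (C ⊗ a) b V ≫ (α_ (C ⊗ a) V b).hom ≫ (C ⊗ a) ◁ (β_ V b).hom = (α_ _ _ _).hom := by
    simp only [sw, Category.assoc, Iso.inv_hom_id_assoc]
    rw [← MonoidalCategory.whiskerLeft_comp, SymmetricCategory.symmetry,
      MonoidalCategory.whiskerLeft_id, Category.comp_id]
  have h := trace_dinat e' (tensor d e) ((sw A c (V ⊗ b) ≫ (α_ A V b).inv ▷ c ≫ q ▷ c ≫
    sw (B ⊗ a) V c ≫ sw B a c ▷ V ≫ f ▷ a ▷ V ≫ sw C b a ▷ V ≫ sw (C ⊗ a) b V ≫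
    (α_ (C ⊗ a) V b).hom) ≫ (C ⊗ a) ◁ (β_ V b).hom) (β_ b V).hom
  rw [Category.assoc, ← MonoidalCategory.whiskerLeft_comp, SymmetricCategory.symmetry,
    MonoidalCategory.whiskerLeft_id, Category.comp_id] at h
  rw [h, ← trace_right]
  have h2 := e.trace_nat (sw A c b) (sw (A ⊗ b) c V ≫ (sw A b V ≫ q) ▷ c ≫ sw (B ⊗ a) V c)
    (sw B a c ≫ f ▷ a ≫ sw C b a)
  rw [← h2, ← trace_tensor]
  simp only [Category.assoc]
  rw [reassoc_of% hin, hout]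
  simp only [Category.assoc, comp_whiskerRight]

/-- The left-bracketed form of `mate_tensor`. The wire `y` only passes by and is straightened with
`yank_past`, so what remains is the mate of `f` next to an identity on `y'`. -/
lemma DualPair.mate_letters {P Q s s' p p' y y' : D} (ds : DualPair s s') (dp : DualPair p p')
    (dy : DualPair y y') (f : P ⊗ p ⟶ Q ⊗ s) :
    dp.cup ((P ⊗ y') ⊗ s') ≫ dy.cup (((P ⊗ y') ⊗ s') ⊗ p) ▷ p' ≫ sw (P ⊗ y') s' p ▷ y ▷ y' ▷ p' ≫
      sw P y' p ▷ s' ▷ y ▷ y' ▷ p' ≫ sw ((P ⊗ p) ⊗ y') s' y ▷ y' ▷ p' ≫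
      sw (P ⊗ p) y' y ▷ s' ▷ y' ▷ p' ≫ f ▷ y ▷ y' ▷ s' ▷ y' ▷ p' ≫
      dy.cap (Q ⊗ s) ▷ s' ▷ y' ▷ p' ≫ ds.cap Q ▷ y' ▷ p' ≫ sw Q y' p' =
    sw P y' s' ≫ mate ds dp f ▷ y' := by
  have h1 : dy.cup (((P ⊗ y') ⊗ s') ⊗ p) ≫ sw (P ⊗ y') s' p ▷ y ▷ y' ≫
      sw P y' p ▷ s' ▷ y ▷ y' ≫ sw ((P ⊗ p) ⊗ y') s' y ▷ y' ≫
      sw (P ⊗ p) y' y ▷ s' ▷ y' ≫ f ▷ y ▷ y' ▷ s' ▷ y' ≫ dy.cap (Q ⊗ s) ▷ s' ▷ y' =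
      sw P y' s' ▷ p ≫ sw (P ⊗ s') y' p ≫ sw P s' p ▷ y' ≫ f ▷ s' ▷ y' := by
    have h := dy.yank_past (Q ⊗ s) s'
    have n : sw ((P ⊗ p) ⊗ y') s' y ▷ y' ≫ sw (P ⊗ p) y' y ▷ s' ▷ y' ≫ f ▷ y ▷ y' ▷ s' ▷ y' =
        f ▷ y' ▷ s' ▷ y ▷ y' ≫ sw ((Q ⊗ s) ⊗ y') s' y ▷ y' ≫ sw (Q ⊗ s) y' y ▷ s' ▷ y' := by
      simp only [← comp_whiskerRight]
      rw [sw_nat_head_assoc, ← comp_whiskerRight, sw_nat_head]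
    have hb := sw_braid P y' s' p
    rw [reassoc_of% n, ← cup_nat_assoc, ← cup_nat_assoc, ← cup_nat_assoc, h, sw_nat_head,
      reassoc_of% hb]
  have h1' := congrArg (fun t => t ▷ p') h1
  simp only [comp_whiskerRight] at h1'
  rw [reassoc_of% h1', mate]
  simp only [comp_whiskerRight, Category.assoc, cup_right]
  rw [cup_nat_assoc]
  simp only [← sw_nat_head_assoc, ← sw_nat_head]

lemma DualPair.mate_tensor {P Q s s' p p' y y' : D} (ds : DualPair s s') (dp : DualPair p p')
    (dy : DualPair y y') (f : P ⊗ p ⟶ Q ⊗ s) :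
    mate (tensor ds dy) (tensor dp dy) ((α_ P p y).inv ≫ f ▷ y ≫ (α_ Q s y).hom) ≫
      (α_ Q y' p').inv ≫ sw Q y' p' = (α_ P y' s').inv ≫ sw P y' s' ≫ mate ds dp f ▷ y' := by
  rw [← mate_letters ds dp dy f, mate, cup_tensor, cap_tensor, swap_blocks]
  simp only [cup, cap, insertUnit, applyCounit]
  monoidal

lemma DualPair.whiskerLeft_mate {A B a a' b b' : D} (d : DualPair a a') (e : DualPair b b')
    (f : A ⊗ b ⟶ B ⊗ a) (X : D) : mate d e ((α_ X A b).hom ≫ X ◁ f ≫ (α_ X B a).inv) =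
      (α_ _ _ _).hom ≫ X ◁ mate d e f ≫ (α_ _ _ _).inv := by
  simp only [mate, cup, cap, insertUnit, applyCounit, sw_tensor_head]
  monoidal

variable [LeftRigidCategory D]

/-- The chosen dual of an object of a compact closed category. -/
abbrev dual (U : D) : DualPair U (ᘁU : D) := ofExactPairing (ᘁU) U

lemma canonicalTrace_eq {A B : D} (U : D) (f : A ⊗ U ⟶ B ⊗ U) :
    canonicalTrace U f = (dual U).trace f := by
  simp [canonicalTrace, trace, cup, cap, insertUnit, applyCounit, ofExactPairing, ofTriangles]

variable (D) in
/-- The canonical trace of a compact closed category, as a partial trace that is total. -/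
abbrev canonicalPartialTrace : PartiallyTraced D where
  tr U f := Part.some (canonicalTrace U f)
  naturality f g h := by
    simp only [Part.map_some, canonicalTrace_eq, trace_nat, le_refl]
  dinaturality f g := by
    rw [canonicalTrace_eq, canonicalTrace_eq, trace_dinat (dual _) (dual _)]
  strength f g := by
    simp only [Part.map_some, canonicalTrace_eq, trace_left, le_refl]
  vanishing_one f := by
    rw [canonicalTrace_eq, trace_eq _ unit, trace_unit]
  vanishing_two {A B U V} f _ := by
    rw [Part.bind_some, canonicalTrace_eq, canonicalTrace_eq, canonicalTrace_eq,
      trace_eq (dual (U ⊗ V)) (tensor (dual U) (dual V)), trace_tensor]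
  yanking A := by
    rw [canonicalTrace_eq, trace_braid]

attribute [local instance] canonicalPartialTrace

namespace IntP

/-- The composite of a path in `Intᵖ(D)` for a compact closed category `D`. -/
def total {A B : IntP D} (p : Quiver.Path A B) : A.pos ⊗ B.neg ⟶ B.pos ⊗ A.neg :=
  canonicalTrace (loop p) (sw A.pos B.neg (loop p) ≫ pre p)

lemma comp_eq_total {A B : IntP D} (p : Quiver.Path A B) : comp p = Part.some ⟨total p⟩ := rfl

lemma total_nil (A : IntP D) : total (Quiver.Path.nil : Quiver.Path A A) = 𝟙 _ := by
  have h := comp_nil A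
  rw [comp_eq_total, Part.some_inj] at h
  exact congrArg Hom.hom h

/-- As all traces exist, the single trace over the whole loop can be computed one arrow at a time.
-/
lemma total_cons {A B B' : IntP D} (p : Quiver.Path A B) (f : B ⟶ B') :
    total (p.cons f) = (dual B.neg).trace (sw A.pos B'.neg B.neg ≫ total p ▷ B'.neg ≫
      sw B.pos A.neg B'.neg ≫ f.hom ▷ A.neg ≫ sw B'.pos B.neg A.neg) := by
  rw [total, total, canonicalTrace_eq, canonicalTrace_eq]
  exact trace_two_loops (dual _) (dual _) (dual _) (pre p) f.hom

/-- The functor `Intᵖ(D) → D` on arrows. -/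
def bend {A B : IntP D} (f : A.pos ⊗ B.neg ⟶ B.pos ⊗ A.neg) :
    A.pos ⊗ (ᘁA.neg : D) ⟶ B.pos ⊗ (ᘁB.neg : D) := mate (dual A.neg) (dual B.neg) f

/-- The functor `Intᵖ(D) → D` on paths. -/
def bendPath {A : IntP D} : {B : IntP D} → Quiver.Path A B →
    (A.pos ⊗ (ᘁA.neg : D) ⟶ B.pos ⊗ (ᘁB.neg : D))
  | _, .nil => 𝟙 _
  | _, .cons p f => bendPath p ≫ bend f.hom

lemma bend_id (A : IntP D) : bend (𝟙 (A.pos ⊗ A.neg)) = 𝟙 _ := by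
  rw [bend, mate, id_whiskerRight, id_whiskerRight, Category.id_comp, yank_right]

/-- The recursion of `total_cons` is exactly the composition law of mates. Consequently bending a
path arrow by arrow depends only on its composite. -/
lemma bendPath_eq {A B : IntP D} (p : Quiver.Path A B) : bendPath p = bend (total p) := by
  induction p with
  | nil => rw [total_nil, bend_id, bendPath]
  | cons p f ih => rw [bendPath, ih, bend, bend, mate_comp, ← total_cons, bend]

lemma bendPath_toPath {A B : IntP D} (f : A ⟶ B) : bendPath f.toPath = bend f.hom :=
  Category.id_comp _

lemma bendPath_comp {A B B' : IntP D} (p : Quiver.Path A B) (q : Quiver.Path B B') :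
    bendPath (p.comp q) = bendPath p ≫ bendPath q := by
  induction q with
  | nil => simp [bendPath]
  | cons q f ih => rw [Quiver.Path.comp_cons, bendPath, bendPath, ih, Category.assoc]

/-- The comparison `(b ⊗ a) ⊗ (p ⊗ y)* ⟶ ((b ⊗ a) ⊗ p*) ⊗ y*`. -/
def split (b y : D) (A : IntP D) :
    (b ⊗ A.pos) ⊗ (ᘁ(A.neg ⊗ y) : D) ≅ ((b ⊗ A.pos) ⊗ (ᘁA.neg : D)) ⊗ (ᘁy : D) :=
  whiskerLeftIso _ (starIso (dual (A.neg ⊗ y)) (tensor (dual A.neg) (dual y)) (Iso.refl _)) ≪≫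
    (α_ _ _ _).symm ≪≫ ⟨sw _ _ _, sw _ _ _, sw_sw _ _ _, sw_sw _ _ _⟩

/-- Bending commutes with tensoring by an identity. The isomorphism `split` is needed because the
chosen dual of `A.neg ⊗ y` is only isomorphic to the tensor product of the chosen duals. -/
lemma bend_inner {A B : IntP D} (f : A ⟶ B) (b y : D) :
    bend (A := ⟨b ⊗ A.pos, A.neg ⊗ y⟩) (B := ⟨b ⊗ B.pos, B.neg ⊗ y⟩) (inner f.hom b y) ≫
      (split b y B).hom = (split b y A).hom ≫
        ((α_ _ _ _).hom ≫ b ◁ bend f.hom ≫ (α_ _ _ _).inv) ▷ (ᘁy : D) := by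
  have h := mate_nat
    (compat_star (dual (A.neg ⊗ y)) (tensor (dual A.neg) (dual y)) (Iso.refl _))
    (compat_star (dual (B.neg ⊗ y)) (tensor (dual B.neg) (dual y)) (Iso.refl _))
    (𝟙 (b ⊗ A.pos)) (𝟙 (b ⊗ B.pos)) (f := inner f.hom b y) (f₁ := inner f.hom b y) (by simp)
  have h2 := mate_tensor (dual A.neg) (dual B.neg) (dual y)
    ((α_ b A.pos B.neg).hom ≫ b ◁ f.hom ≫ (α_ b B.pos A.neg).inv)
  rw [whiskerLeft_mate] at h2
  have h3 : inner f.hom b y = (α_ _ _ _).inv ≫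
      ((α_ b A.pos B.neg).hom ≫ b ◁ f.hom ≫ (α_ b B.pos A.neg).inv) ▷ y ≫ (α_ _ _ _).hom := by
    simp [inner]
  rw [← h3] at h2
  rw [id_tensorHom, id_tensorHom] at h
  change mate _ _ _ ≫ _ ◁ star _ _ (𝟙 _) ≫ (α_ _ _ _).inv ≫ sw _ _ _ =
    (_ ◁ star _ _ (𝟙 _) ≫ (α_ _ _ _).inv ≫ sw _ _ _) ≫ _
  simp only [Category.assoc]
  erw [← reassoc_of% h, h2]
  rfl

/-- The image in `D` of a path tensored on the left with `X`. -/
def bendLeft (X : IntP D) {A B : IntP D} (p : Quiver.Path A B) :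
    (X.pos ⊗ A.pos) ⊗ (ᘁ(A.neg ⊗ X.neg) : D) ⟶ (X.pos ⊗ B.pos) ⊗ (ᘁ(B.neg ⊗ X.neg) : D) :=
  bendPath ((IntP.tensorLeft X).mapPath p)

/-- The image in `D` of a path tensored on the right with `X`. -/
def bendRight (X : IntP D) {A B : IntP D} (p : Quiver.Path A B) :
    (A.pos ⊗ X.pos) ⊗ (ᘁ(X.neg ⊗ A.neg) : D) ⟶ (B.pos ⊗ X.pos) ⊗ (ᘁ(X.neg ⊗ B.neg) : D) :=
  bendPath ((IntP.tensorRight X).mapPath p)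

lemma bendLeft_nil (X A : IntP D) : bendLeft X (Quiver.Path.nil : Quiver.Path A A) = 𝟙 _ := rfl

lemma bendRight_nil (X A : IntP D) : bendRight X (Quiver.Path.nil : Quiver.Path A A) = 𝟙 _ := rfl

lemma bendLeft_cons (X : IntP D) {A B B' : IntP D} (p : Quiver.Path A B) (f : B ⟶ B') :
    bendLeft X (p.cons f) = bendLeft X p ≫
      bend (A := X.tensorObj B) (B := X.tensorObj B') (inner f.hom X.pos X.neg) :=
  congrArg (fun t => bendLeft X p ≫ bend (A := X.tensorObj B) (B := X.tensorObj B') t)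
    (PathInt.hom_inner f X)

lemma bendRight_cons (X : IntP D) {A B B' : IntP D} (p : Quiver.Path A B) (f : B ⟶ B') :
    bendRight X (p.cons f) = bendRight X p ≫
      bend (A := B.tensorObj X) (B := B'.tensorObj X) (outer f.hom X.pos X.neg) :=
  congrArg (fun t => bendRight X p ≫ bend (A := B.tensorObj X) (B := B'.tensorObj X) t)
    (PathInt.hom_outer f X)

/-- The right-hand side involves `p` only through `bendPath p`: this gives stability under tensoring
on the left. -/
lemma bendLeft_split (X : IntP D) {A B : IntP D} (p : Quiver.Path A B) :
    bendLeft X p ≫ (split X.pos X.neg B).hom = (split X.pos X.neg A).hom ≫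
        ((α_ _ _ _).hom ≫ X.pos ◁ bendPath p ≫ (α_ _ _ _).inv) ▷ (ᘁX.neg : D) := by
  induction p with
  | nil => simp [bendPath, bendLeft_nil]
  | @cons B B' p f ih =>
    rw [bendLeft_cons, Category.assoc]
    erw [bend_inner f X.pos X.neg]
    rw [reassoc_of% ih, bendPath]
    simp

lemma bend_comp_pair {X A B : IntP D} (f : X ⟶ A) (u : A.pos ⟶ B.pos) (v : B.neg ⟶ A.neg) :
    bend f.hom ≫ bend (pair u v).hom = bend (X.pos ◁ v ≫ f.hom ≫ u ▷ X.neg) := by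
  have h := comp_pair f u v
  rw [comp_eq_total, Part.some_inj] at h
  have h' : total _ = X.pos ◁ v ≫ f.hom ≫ u ▷ X.neg := congrArg Hom.hom h
  rw [← bendPath_toPath f, ← h', ← bendPath_eq]
  rfl

lemma bend_pair_comp {X A B : IntP D} (u : X.pos ⟶ A.pos) (v : A.neg ⟶ X.neg) (f : A ⟶ B) :
    bend (pair u v).hom ≫ bend f.hom = bend (u ▷ B.neg ≫ f.hom ≫ B.pos ◁ v) := by
  have h := pair_comp u v f
  rw [comp_eq_total, Part.some_inj] at h
  have h' : total _ = u ▷ B.neg ≫ f.hom ≫ B.pos ◁ v := congrArg Hom.hom h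
  rw [← bendPath_toPath (pair u v), ← h', ← bendPath_eq]
  rfl

/-- The image in `D` of the symmetry of `Intᵖ(D)`. -/
def bendBraid (A X : IntP D) := bend (A := A.tensorObj X) (B := X.tensorObj A)
  (pair (A := A.tensorObj X) (B := X.tensorObj A) (β_ A.pos X.pos).hom (β_ A.neg X.neg).hom).hom

lemma bendBraid_bendBraid (A X : IntP D) : bendBraid A X ≫ bendBraid X A = 𝟙 _ := by
  rw [bendBraid, bendBraid, bend_comp_pair]
  refine (congrArg bend ?_).trans (bend_id (A.tensorObj X))
  simp only [pair, ← id_tensorHom, ← tensorHom_id, MonoidalCategory.tensorHom_comp_tensorHom,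
    SymmetricCategory.symmetry, Category.comp_id, id_tensorHom_id]

/-- Conjugation by the symmetry turns tensoring on the right into tensoring on the left, so that
stability on the right needs no computation of its own. -/
lemma bendRight_braid (X : IntP D) {A B : IntP D} (p : Quiver.Path A B) :
    bendRight X p ≫ bendBraid B X = bendBraid A X ≫ bendLeft X p := by
  induction p with
  | nil => rw [bendLeft_nil, bendRight_nil, Category.id_comp]; exact (Category.comp_id _).symm
  | @cons B B' p f ih =>
    have h : bend (A := B.tensorObj X) (B := B'.tensorObj X) (outer f.hom X.pos X.neg) ≫
        bendBraid B' X = bendBraid B X ≫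
          bend (A := X.tensorObj B) (B := X.tensorObj B') (inner f.hom X.pos X.neg) :=
      (bend_comp_pair (X := B.tensorObj X) (A := B'.tensorObj X) (B := X.tensorObj B')
          ⟨outer f.hom X.pos X.neg⟩ _ _).trans
        ((congrArg bend (outer_braid f.hom X.pos X.neg)).trans
          (bend_pair_comp (X := B.tensorObj X) (A := X.tensorObj B) (B := X.tensorObj B') _ _
            ⟨inner f.hom X.pos X.neg⟩).symm)
    rw [bendRight_cons, bendLeft_cons, Category.assoc]
    erw [h]
    rw [reassoc_of% ih]

lemma bendLeft_congr (X : IntP D) {A B : IntP D} {p q : Quiver.Path A B}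
    (h : bendPath p = bendPath q) : bendLeft X p = bendLeft X q := by
  rw [← cancel_mono (split X.pos X.neg B).hom, bendLeft_split, bendLeft_split, h]

lemma bendRight_congr (X : IntP D) {A B : IntP D} {p q : Quiver.Path A B}
    (h : bendPath p = bendPath q) : bendRight X p = bendRight X q := by
  have : IsIso (bendBraid B X) := ⟨bendBraid X B, bendBraid_bendBraid _ _, bendBraid_bendBraid _ _⟩
  apply (cancel_mono (bendBraid B X)).1
  exact (bendRight_braid X p).trans
    ((congrArg _ (bendLeft_congr X h)).trans (bendRight_braid X q).symm)

/-- Since `∼` is the smallest congruence, `bendPath` is therefore well defined on classes of paths.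
-/
lemma isCongruence_bendPath :
    IsCongruence (C := D) (fun _ _ p q => bendPath p = bendPath q) where
  equivalence _ _ := ⟨fun _ => rfl, Eq.symm, Eq.trans⟩
  append h h' := by rw [bendPath_comp, bendPath_comp, h, h']
  comp {X Y p f} h := by
    rw [comp_eq_total, Part.mem_some_iff] at h
    rw [bendPath_toPath, h, bendPath_eq]
  tensorLeft X {A B p q} h := bendLeft_congr X h
  tensorRight X {A B p q} h := bendRight_congr X h

end IntP

namespace PathInt

open IntP

/-- The composite of a path over `D` is always defined, and a path is related to its composite. -/
lemma eq_sing {A B : IntP D} (f : (⟨A⟩ : PathInt D) ⟶ ⟨B⟩) :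
    ∃ g : A ⟶ B, f = sing g := by
  obtain ⟨p⟩ := f
  exact ⟨⟨total p⟩, Quot.sound (isCongruence_sim.comp (by rw [comp_eq_total]; exact Part.mem_some _))⟩

lemma sing_injective {A B : IntP D} {f g : A ⟶ B} (h : sing f = sing g) :
    bend f.hom = bend g.hom := by
  have h' := congrArg (Quot.lift (fun p => bendPath p) (fun _ _ h => h _ isCongruence_bendPath)) h
  simpa only [sing, bendPath_toPath] using h'

end PathInt

lemma DualPair.mate_whiskerRight {A B b b' : D} (d : DualPair b b') (f : A ⟶ B) :
    mate d d (f ▷ b) = f ▷ b' := by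
  rw [mate, ← comp_whiskerRight, cap_nat, comp_whiskerRight]
  have h := d.yank_right A
  rw [reassoc_of% h]

/-- For `u` the unit object, this says that `embed D` followed by bending is tensoring with the dual
of the unit object. -/
lemma IntP.bend_whiskerRight {A B : D} (k : A ⟶ B) (u : D) :
    IntP.bend (A := ⟨A, u⟩) (B := ⟨B, u⟩) (k ⊗ₘ 𝟙 u) = k ▷ (ᘁu : D) := by
  rw [← (dual u).mate_whiskerRight k, ← tensorHom_id]
  rfl

/-- Any dual of the unit object is isomorphic to the unit object, and tensoring with the latter is
faithful. -/
lemma DualPair.eq_of_whiskerRight_eq {U' A B : D} (d : DualPair (𝟙_ D) U') {f g : A ⟶ B}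
    (h : f ▷ U' = g ▷ U') : f = g := by
  have h3 : f ▷ 𝟙_ D = g ▷ 𝟙_ D := by
    rw [← cancel_epi (A ◁ (starIso d unit (Iso.refl _)).hom), whisker_exchange,
      whisker_exchange, h]
  simpa using h3

instance : (embed D).Faithful where
  map_injective {_ _ f g} h := eq_of_whiskerRight_eq (ofExactPairing _ _)
    ((IntP.bend_whiskerRight f (𝟙_ D)).symm.trans
      ((PathInt.sing_injective h).trans (IntP.bend_whiskerRight g (𝟙_ D))))

/-- A class is the class of one arrow, and an arrow `(A, I) ⟶ (B, I)` is a morphism `A ⊗ I ⟶ B ⊗ I`;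
unitors turn it into a morphism `A ⟶ B`. -/
instance : (embed D).Full where
  map_surjective {A B} f := by
    obtain ⟨g, hg⟩ := PathInt.eq_sing f
    have h (t : A ⊗ 𝟙_ D ⟶ B ⊗ 𝟙_ D) : ((ρ_ A).inv ≫ t ≫ (ρ_ B).hom) ⊗ₘ 𝟙 (𝟙_ D) = t := by simp
    exact ⟨(ρ_ A).inv ≫ g.hom ≫ (ρ_ B).hom,
      (congrArg PathInt.sing (IntP.Hom.ext (h g.hom))).trans hg.symm⟩

end CompactClosed
end PartialTrace

namespace PartialTrace

open PartiallyTraced IntP DualPair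

variable {C : Type u} [Category.{v} C] [MonoidalCategory C] [SymmetricCategory C]
  [PartiallyTraced C]

/-! ### Dualities in `Path(Intᵖ(C))/∼`, and arrows as mates. -/

namespace PathInt

/-- The object `(I, p)`. -/
abbrev cobase (p : C) : PathInt C := ⟨⟨𝟙_ C, p⟩⟩

/-- An arrow of `Intᵖ(C)` with explicit components, as a morphism of `Path(Intᵖ(C))/∼`. -/
abbrev arrow {a x b y : C} (f : a ⊗ y ⟶ b ⊗ x) :
    (⟨⟨a, x⟩⟩ : PathInt C) ⟶ (⟨⟨b, y⟩⟩ : PathInt C) := sing (X := ⟨a, x⟩) (Y := ⟨b, y⟩) ⟨f⟩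

lemma arrow_J {a x b y b' y' : C} (f : a ⊗ y ⟶ b ⊗ x) (u : b ⟶ b') (v : y' ⟶ y) :
    arrow f ≫ J u v = arrow (a ◁ v ≫ f ≫ u ▷ x) :=
  sing_of_mem (comp_pair (X := ⟨a, x⟩) (A := ⟨b, y⟩) (B := ⟨b', y'⟩) ⟨f⟩ u v)

lemma J_arrow {a x b y a' x' : C} (u : a' ⟶ a) (v : x ⟶ x') (f : a ⊗ y ⟶ b ⊗ x) :
    J u v ≫ arrow f = arrow (u ▷ y ≫ f ≫ b ◁ v) :=
  sing_of_mem (pair_comp (X := ⟨a', x'⟩) (A := ⟨a, x⟩) (B := ⟨b, y⟩) u v ⟨f⟩)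

lemma arrow_comp {a x b y c z : C} (f : a ⊗ y ⟶ b ⊗ x) (g : b ⊗ z ⟶ c ⊗ y) {t : a ⊗ z ⟶ c ⊗ x}
    (h : tr y (sw a z y ≫ f ▷ z ≫ sw b x z ≫ g ▷ x ≫ sw c y x) = Part.some t) :
    arrow f ≫ arrow g = arrow t := by
  refine sing_of_mem ((comp_two _ _).trans ?_)
  exact (congrArg (Part.map (Hom.mk (A := ⟨a, x⟩) (B := ⟨c, z⟩))) h).trans (Part.map_some _ _)

lemma whiskerLeft_arrow (X : PathInt C) {a x b y : C} (f : a ⊗ y ⟶ b ⊗ x) :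
    X ◁ arrow f = arrow (inner f X.as.pos X.as.neg) :=
  congrArg sing (Hom.ext (hom_inner (A := ⟨a, x⟩) (A' := ⟨b, y⟩) ⟨f⟩ X.as))

lemma whiskerRight_arrow (X : PathInt C) {a x b y : C} (f : a ⊗ y ⟶ b ⊗ x) :
    arrow f ▷ X = arrow (outer f X.as.pos X.as.neg) :=
  congrArg sing (Hom.ext (hom_outer (A := ⟨a, x⟩) (A' := ⟨b, y⟩) ⟨f⟩ X.as))

lemma whiskerLeft_J (X : PathInt C) {a p a' p' : C} (u : a ⟶ a') (v : p' ⟶ p) :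
    X ◁ J u v = J (X.as.pos ◁ u) (v ▷ X.as.neg) := whL_J X u v

lemma whiskerRight_J (X : PathInt C) {a p a' p' : C} (u : a ⟶ a') (v : p' ⟶ p) :
    J u v ▷ X = J (u ▷ X.as.pos) (X.as.neg ◁ v) := whR_J X u v

lemma sw_J (X Y Z : PathInt C) : sw X Y Z = J (sw X.as.pos Y.as.pos Z.as.pos)
    ((α_ Y.as.neg Z.as.neg X.as.neg).inv ≫ (β_ Y.as.neg Z.as.neg).hom ▷ X.as.neg ≫
      (α_ Z.as.neg Y.as.neg X.as.neg).hom) := by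
  change J _ _ ≫ X ◁ J _ _ ≫ J _ _ = _
  rw [whiskerLeft_J, J_comp, J_comp]
  simp only [Category.assoc]
  rfl

/-- The insertion of a pair of dual factors `q`. -/
def insert (q a x : C) : (⟨⟨a, x⟩⟩ : PathInt C) ⟶ ⟨⟨a ⊗ q, q ⊗ x⟩⟩ := arrow (α_ a q x).inv

/-- The cancellation of a pair of dual factors `q`. -/
def cancel (q a x : C) : (⟨⟨a ⊗ q, q ⊗ x⟩⟩ : PathInt C) ⟶ ⟨⟨a, x⟩⟩ := arrow (α_ a q x).hom

lemma J_insert {a x a' x' : C} (q : C) (u : a ⟶ a') (v : x' ⟶ x) :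
    J u v ≫ insert q a' x' = insert q a x ≫ J (u ▷ q) (q ◁ v) := by
  rw [insert, insert, J_arrow, arrow_J]
  rw [associator_inv_naturality_left_assoc, associator_inv_naturality_right_assoc, whisker_exchange]

lemma cancel_J {a x a' x' : C} (q : C) (u : a ⟶ a') (v : x' ⟶ x) :
    cancel q a x ≫ J u v = J (u ▷ q) (q ◁ v) ≫ cancel q a' x' := by
  rw [cancel, cancel, J_arrow, arrow_J]
  rw [associator_naturality_left_assoc, associator_naturality_right_assoc, whisker_exchange]

/-- Every arrow of `Intᵖ(C)` is obtained from a morphism of `C` by inserting and cancelling pairs of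
dual factors. -/
lemma insert_cancel {a x b q : C} (u : a ⊗ q ⟶ b ⊗ x) :
    insert q a x ≫ J u (β_ x q).hom ≫ cancel x b q = arrow u := by
  rw [insert, cancel, ← Category.assoc, arrow_J]
  apply arrow_comp
  -- The composite is a trace over `x ⊗ q`. By Vanishing II it is computed, and in particular
  -- defined, by yanking over `q` and then over `x`.
  have h1 := tr_yank (sw a q x) (sw a x q ≫ u ▷ x ≫ sw b x x)
  rw [sw_sw_assoc] at h1
  have h2 := tr_two _ h1
  have h3 := tr_yank u (𝟙 (b ⊗ x))
  rw [id_whiskerRight, Category.comp_id, Category.comp_id] at h3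
  rw [← h3, ← h2]
  congr 1
  have h4 : a ◁ (β_ x q).hom ≫ (α_ a q x).inv = (α_ _ _ _).inv ≫ sw a x q := by simp [sw]
  rw [reassoc_of% h4, sw_last_eq, sw_mid_eq]
  simp only [comp_whiskerRight, Category.assoc, hom_inv_whiskerRight_assoc, sw_sw_assoc]

lemma arrow_id (a x : C) : arrow (𝟙 (a ⊗ x)) = 𝟙 _ := sing_ident _

/-- The first triangle identity for `(q, I)` and `(I, q)`, unitors aside. The trace over `q ⊗ w` is
yanked over `w`; the braid relation then brings the rest into a form that can be yanked over `q`. -/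
lemma insert_cancel_self (q y w : C) :
    insert q (y ⊗ q) w ≫ J (sw y q q) (𝟙 (q ⊗ w)) ≫ cancel q (y ⊗ q) w = 𝟙 _ := by
  rw [insert, cancel, ← Category.assoc, arrow_J, ← arrow_id]
  apply arrow_comp
  have h1 := tr_yank (sw (y ⊗ q) w q) (sw y q q ▷ w ≫ sw (y ⊗ q) q w)
  have h2 := tr_two _ h1
  have h3 := tr_yank (sw y q w) (sw y w q)
  rw [sw_braid, ← h2, sw_sw] at h3
  rw [← h3]
  congr 1
  rw [sw_last_eq, sw_mid_eq]
  simp only [comp_whiskerRight, Category.assoc, hom_inv_whiskerRight_assoc,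
    MonoidalCategory.whiskerLeft_id, Category.id_comp, sw_sw_assoc]

/-- The unit of the duality between `(q, I)` and `(I, q)`. -/
def baseUnit (q : C) : 𝟙_ (PathInt C) ⟶ base q ⊗ cobase q :=
  arrow ((λ_ _).hom ≫ 𝟙 (q ⊗ 𝟙_ C) ≫ (ρ_ _).inv)

/-- The counit of the duality between `(q, I)` and `(I, q)`. -/
def baseCounit (q : C) : base q ⊗ cobase q ⟶ 𝟙_ (PathInt C) :=
  arrow ((ρ_ _).hom ≫ 𝟙 (q ⊗ 𝟙_ C) ≫ (λ_ _).inv)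

/-- With `applyCounit_base`, this identifies the formal cup and cap with `insert` and `cancel`, up
to unitors. -/
lemma insertUnit_base (q y z : C) : insertUnit (baseUnit q) ⟨⟨y, z⟩⟩ =
    insert q y z ≫ J (ρ_ (y ⊗ q)).inv (q ◁ (λ_ z).hom) := by
  rw [insertUnit, insert, arrow_J]
  change J _ _ ≫ _ ◁ arrow _ ≫ J _ _ = _
  rw [whiskerLeft_arrow, arrow_J, J_arrow]
  refine congrArg arrow (?_ : (ρ_ y).inv ▷ _ ≫ ((y ⊗ 𝟙_ C) ◁ (α_ q (𝟙_ C) z).inv ≫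
    IntP.inner ((λ_ _).hom ≫ 𝟙 (q ⊗ 𝟙_ C) ≫ (ρ_ _).inv) y z ≫ (α_ y q (𝟙_ C)).inv ▷ (𝟙_ C ⊗ z)) ≫
    ((y ⊗ q) ⊗ 𝟙_ C) ◁ (λ_ z).hom = y ◁ q ◁ (λ_ z).hom ≫ (α_ y q z).inv ≫ (ρ_ (y ⊗ q)).inv ▷ z)
  rw [IntP.inner]
  monoidal

lemma applyCounit_base (q y z : C) : applyCounit (baseCounit q) ⟨⟨y, z⟩⟩ =
    J (ρ_ (y ⊗ q)).hom (q ◁ (λ_ z).inv) ≫ cancel q y z := by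
  rw [applyCounit, cancel, J_arrow]
  change J _ _ ≫ _ ◁ arrow _ ≫ J _ _ = _
  rw [whiskerLeft_arrow, arrow_J, J_arrow]
  refine congrArg arrow (?_ : (α_ y q (𝟙_ C)).hom ▷ z ≫ ((y ⊗ (q ⊗ 𝟙_ C)) ◁ (λ_ z).inv ≫
    IntP.inner ((ρ_ _).hom ≫ 𝟙 (q ⊗ 𝟙_ C) ≫ (λ_ _).inv) y z ≫ (ρ_ y).hom ▷ ((q ⊗ 𝟙_ C) ⊗ z)) ≫
    y ◁ (α_ q (𝟙_ C) z).hom = (ρ_ (y ⊗ q)).hom ▷ z ≫ (α_ y q z).hom ≫ y ◁ q ◁ (λ_ z).inv)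
  rw [IntP.inner]
  monoidal

/-- The duality between `(q, I)` and `(I, q)`. -/
def baseDual (q : C) : DualPair (base q) (cobase q) := ofTriangles (baseUnit q) (baseCounit q)
  (by
    apply triangle_of_snake
    rw [insertUnit_right]
    simp only [Category.assoc, sw_sw_assoc]
    refine Eq.trans ?_ (insert_cancel_self q (𝟙_ C) (𝟙_ C ⊗ 𝟙_ C))
    change insertUnit (baseUnit q) ⟨⟨𝟙_ C ⊗ q, 𝟙_ C ⊗ 𝟙_ C⟩⟩ ≫ _ ≫
      applyCounit (baseCounit q) ⟨⟨𝟙_ C ⊗ q, 𝟙_ C ⊗ 𝟙_ C⟩⟩ = _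
    rw [insertUnit_base, applyCounit_base, sw_J, whiskerRight_J]
    simp only [Category.assoc]
    congr 1
    simp only [← Category.assoc]
    congr 1
    simp only [J_comp]
    congr 1
    · change ((ρ_ _).inv ≫ sw (𝟙_ C) q q ▷ 𝟙_ C) ≫ (ρ_ _).hom = _
      simp
    · simp)
  (by
    apply triangle_of_snake'
    rw [insertUnit_right, applyCounit_right]
    simp only [Category.assoc, sw_sw_assoc]
    -- The second triangle is `insert_cancel` for an identity morphism; `e` absorbs the extra unit
    -- object in the second component.
    have h := insert_cancel (𝟙 ((𝟙_ C ⊗ 𝟙_ C) ⊗ q))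
    rw [arrow_id] at h
    let e : (𝟙_ (PathInt C) ⊗ cobase q) ≅ (⟨⟨𝟙_ C ⊗ 𝟙_ C, q⟩⟩ : PathInt C) :=
      JIso (Iso.refl _) (ρ_ q).symm
    rw [← cancel_mono e.hom, Category.id_comp]
    refine Eq.trans ?_
      ((congrArg (fun t => J (𝟙 _) (ρ_ q).inv ≫ t) h).trans (Category.comp_id _))
    change (insertUnit (baseUnit q) ⟨⟨𝟙_ C ⊗ 𝟙_ C, q ⊗ 𝟙_ C⟩⟩ ≫ _ ≫ _ ≫ _ ≫
      applyCounit (baseCounit q) ⟨⟨𝟙_ C ⊗ 𝟙_ C, q ⊗ 𝟙_ C⟩⟩) ≫ J (𝟙 _) (ρ_ q).inv = _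
    rw [insertUnit_base, applyCounit_base, sw_J, sw_J, sw_J]
    simp only [whiskerRight_J, Category.assoc, cancel_J]
    rw [reassoc_of% J_insert]
    congr 1
    simp only [← Category.assoc]
    congr 1
    simp only [J_comp]
    congr 1
    · simp only [sw_unit_mid, sw_unit_last]
      monoidal
    · simp
      monoidal)

lemma cup_baseDual (q y z : C) : (baseDual q).cup ⟨⟨y, z⟩⟩ =
    insert q y z ≫ J (ρ_ (y ⊗ q)).inv (q ◁ (λ_ z).hom) := insertUnit_base q y z

lemma cap_baseDual (q y z : C) : (baseDual q).cap ⟨⟨y, z⟩⟩ =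
    J (ρ_ (y ⊗ q)).hom (q ◁ (λ_ z).inv) ≫ cancel q y z := applyCounit_base q y z

/-- Every object `(a, x)` is the tensor product of `(a, I)` and `(I, x)`. -/
def decomp (a x : C) : base a ⊗ cobase x ≅ ⟨⟨a, x⟩⟩ := JIso (ρ_ a) (ρ_ x).symm

/-- This drives the uniqueness half: every generator of `PathInt C` is the mate of a morphism coming
from `C`, so a strong symmetric monoidal functor is determined by its restriction along `embed C`,
up to isomorphism. The proof matches the mate with the factorization `insert_cancel`. -/
lemma decomp_arrow {a x b q : C} (u : a ⊗ q ⟶ b ⊗ x) :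
    (decomp a x).hom ≫ arrow u =
      mate (baseDual x) (baseDual q) (J u (𝟙 (𝟙_ C ⊗ 𝟙_ C))) ≫ (decomp b q).hom := by
  rw [mate, cap_right]
  change J _ _ ≫ _ = (((baseDual q).cup ⟨⟨_, _⟩⟩ ≫ _ ≫ _ ≫ _ ≫ _ ≫ (baseDual x).cap ⟨⟨_, _⟩⟩)) ≫ J _ _
  rw [cup_baseDual, cap_baseDual, sw_J, sw_J, sw_J]
  simp only [whiskerRight_J, Category.assoc, cancel_J]
  rw [← insert_cancel, reassoc_of% J_insert]
  simp only [← Category.assoc]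
  congr 1
  simp only [Category.assoc]
  congr 1
  simp only [J_comp]
  congr 1
  · simp only [sw_unit_mid, sw_unit_last]
    monoidal
  · simp
    monoidal

end PathInt

end PartialTrace

namespace PartialTrace

open IntP DualPair Functor.LaxMonoidal Functor.OplaxMonoidal Functor.Monoidal

/-! ### The functor on path categories induced by a traced functor. -/

section Star

variable {C : Type u₁} [Category.{v₁} C] [MonoidalCategory C] [SymmetricCategory C]
  {D : Type u₂} [Category.{v₂} D] [MonoidalCategory D] [SymmetricCategory D]
  (G : C ⥤ D) [G.Braided]

/-- The external product of two morphisms to values of a monoidal functor. -/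
def extProd {P Q : D} {X Y : C} (u : P ⟶ G.obj X) (v : Q ⟶ G.obj Y) : P ⊗ Q ⟶ G.obj (X ⊗ Y) :=
  (u ⊗ₘ v) ≫ μ G X Y

variable {G} {P Q R P' Q' R' : D} {X Y Z X' Y' Z' : C}

lemma extProd_id (X Y : C) : extProd G (𝟙 (G.obj X)) (𝟙 (G.obj Y)) = μ G X Y := by simp [extProd]

lemma extProd_whiskerRight {u : P ⟶ G.obj X} {h : X ⟶ X'} {k : P ⟶ P'} {u' : P' ⟶ G.obj X'}
    (e : u ≫ G.map h = k ≫ u') (v : Q ⟶ G.obj Y) :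
    extProd G u v ≫ G.map (h ▷ Y) = k ▷ Q ≫ extProd G u' v := by
  rw [extProd, extProd, Category.assoc, ← μ_natural_left, ← tensorHom_id, ← tensorHom_id,
    MonoidalCategory.tensorHom_comp_tensorHom_assoc, MonoidalCategory.tensorHom_comp_tensorHom_assoc,
    e, Category.comp_id, Category.id_comp]

lemma extProd_whiskerLeft {u : P ⟶ G.obj X} {h : X ⟶ X'} {k : P ⟶ P'} {u' : P' ⟶ G.obj X'}
    (e : u ≫ G.map h = k ≫ u') (v : Q ⟶ G.obj Y) :
    extProd G v u ≫ G.map (Y ◁ h) = Q ◁ k ≫ extProd G v u' := by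
  rw [extProd, extProd, Category.assoc, ← μ_natural_right, ← id_tensorHom, ← id_tensorHom,
    MonoidalCategory.tensorHom_comp_tensorHom_assoc, MonoidalCategory.tensorHom_comp_tensorHom_assoc,
    e, Category.comp_id, Category.id_comp]

/-- Pasting of squares. Each elementary move in `inner`, `outer` and `pre` has its own square, so
transporting these morphisms along `G` amounts to reading off their definitions. -/
lemma extProd_comp {u : P ⟶ G.obj X} {u' : P' ⟶ G.obj X'} {u'' : R ⟶ G.obj Z} {h : X ⟶ X'} {k : P ⟶ P'}
    {h' : X' ⟶ Z} {k' : P' ⟶ R} (e : u ≫ G.map h = k ≫ u') (e' : u' ≫ G.map h' = k' ≫ u'') :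
    u ≫ G.map (h ≫ h') = (k ≫ k') ≫ u'' := by
  rw [G.map_comp, reassoc_of% e, e', Category.assoc]

lemma extProd_assoc (u : P ⟶ G.obj X) (v : Q ⟶ G.obj Y) (w : R ⟶ G.obj Z) :
    extProd G (extProd G u v) w ≫ G.map (α_ X Y Z).hom = (α_ P Q R).hom ≫ extProd G u (extProd G v w) := by
  have h : extProd G (extProd G u v) w = ((u ⊗ₘ v) ⊗ₘ w) ≫ μ G X Y ▷ G.obj Z ≫ μ G (X ⊗ Y) Z := by
    rw [extProd, extProd, ← Category.assoc, ← tensorHom_id, MonoidalCategory.tensorHom_comp_tensorHom,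
      Category.comp_id]
  have h' : extProd G u (extProd G v w) = (u ⊗ₘ (v ⊗ₘ w)) ≫ G.obj X ◁ μ G Y Z ≫ μ G X (Y ⊗ Z) := by
    rw [extProd, extProd, ← Category.assoc, ← id_tensorHom, MonoidalCategory.tensorHom_comp_tensorHom,
      Category.comp_id]
  rw [h, h', Category.assoc, Category.assoc, Functor.LaxMonoidal.associativity,
    MonoidalCategory.associator_naturality_assoc]

lemma extProd_inv {u : P ⟶ G.obj X} {u' : P' ⟶ G.obj X'} {h : X ≅ X'} {k : P ≅ P'}
    (e : u ≫ G.map h.hom = k.hom ≫ u') : u' ≫ G.map h.inv = k.inv ≫ u := by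
  rw [Iso.eq_inv_comp, ← reassoc_of% e, ← G.map_comp, Iso.hom_inv_id, G.map_id, Category.comp_id]

lemma extProd_assoc_inv (u : P ⟶ G.obj X) (v : Q ⟶ G.obj Y) (w : R ⟶ G.obj Z) :
    extProd G u (extProd G v w) ≫ G.map (α_ X Y Z).inv = (α_ P Q R).inv ≫ extProd G (extProd G u v) w :=
  extProd_inv (extProd_assoc u v w)

lemma extProd_braid (u : P ⟶ G.obj X) (v : Q ⟶ G.obj Y) :
    extProd G u v ≫ G.map (β_ X Y).hom = (β_ P Q).hom ≫ extProd G v u := by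
  rw [extProd, extProd, Category.assoc, Functor.LaxBraided.braided, BraidedCategory.braiding_naturality_assoc]

lemma extProd_sw (u : P ⟶ G.obj X) (v : Q ⟶ G.obj Y) (w : R ⟶ G.obj Z) :
    extProd G (extProd G u v) w ≫ G.map (sw X Y Z) = sw P Q R ≫ extProd G (extProd G u w) v :=
  extProd_comp (extProd_assoc u v w) (extProd_comp (extProd_whiskerLeft (extProd_braid v w) u) (extProd_assoc_inv u w v))

lemma extProd_rightUnitor (u : P ⟶ G.obj X) :
    extProd G u (ε G) ≫ G.map (ρ_ X).hom = (ρ_ P).hom ≫ u := by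
  rw [extProd, MonoidalCategory.tensorHom_def, Category.assoc, Category.assoc, ← rightUnitor_naturality,
    Functor.LaxMonoidal.right_unitality]

/-- The image under `G` of an arrow of `Intᵖ(C)`. -/
def conj (G : C ⥤ D) [G.Braided] {a p b q : C} (f : a ⊗ p ⟶ b ⊗ q) :
    G.obj a ⊗ G.obj p ⟶ G.obj b ⊗ G.obj q := μ G a p ≫ G.map f ≫ δ G b q

lemma extProd_conj {a p b q : C} (f : a ⊗ p ⟶ b ⊗ q) :
    extProd G (𝟙 (G.obj a)) (𝟙 (G.obj p)) ≫ G.map f = conj G f ≫ extProd G (𝟙 _) (𝟙 _) := by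
  simp [extProd_id, conj]

lemma extProd_inner {a p b q : C} (f : a ⊗ p ⟶ b ⊗ q) (x y : C) :
    extProd G (extProd G (𝟙 (G.obj x)) (𝟙 (G.obj a))) (extProd G (𝟙 (G.obj p)) (𝟙 (G.obj y))) ≫
      G.map (inner f x y) = inner (conj G f) (G.obj x) (G.obj y) ≫
        extProd G (extProd G (𝟙 (G.obj x)) (𝟙 (G.obj b))) (extProd G (𝟙 (G.obj q)) (𝟙 (G.obj y))) :=
  extProd_comp (extProd_assoc_inv _ _ _) <| extProd_comp (extProd_whiskerRight (extProd_assoc _ _ _) _) <|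
    extProd_comp (extProd_whiskerRight (extProd_whiskerLeft (extProd_conj f) _) _) <|
    extProd_comp (extProd_whiskerRight (extProd_assoc_inv _ _ _) _) <| extProd_assoc _ _ _

lemma extProd_outer {a p b q : C} (f : a ⊗ p ⟶ b ⊗ q) (x y : C) :
    extProd G (extProd G (𝟙 (G.obj a)) (𝟙 (G.obj x))) (extProd G (𝟙 (G.obj y)) (𝟙 (G.obj p))) ≫
      G.map (outer f x y) = outer (conj G f) (G.obj x) (G.obj y) ≫
        extProd G (extProd G (𝟙 (G.obj b)) (𝟙 (G.obj x))) (extProd G (𝟙 (G.obj y)) (𝟙 (G.obj q))) :=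
  extProd_comp (extProd_assoc_inv _ _ _) <| extProd_comp (extProd_sw _ _ _) <|
    extProd_comp (extProd_whiskerRight (extProd_sw _ _ _) _) <|
    extProd_comp (extProd_whiskerRight (extProd_whiskerRight (extProd_conj f) _) _) <|
    extProd_comp (extProd_whiskerRight (extProd_sw _ _ _) _) <| extProd_comp (extProd_sw _ _ _) <| extProd_assoc _ _ _

/-- The map of graphs `Intᵖ(C) → Intᵖ(D)` induced by `G`. -/
def intMap (G : C ⥤ D) [G.Braided] : IntP C ⥤q IntP D where
  obj A := ⟨G.obj A.pos, G.obj A.neg⟩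
  map f := ⟨conj G f.hom⟩

/-- The comparison of the objects over which one traces. -/
def loopIso (G : C ⥤ D) [G.Braided] {A : IntP C} : {B : IntP C} → (p : Quiver.Path A B) →
    (loop ((intMap G).mapPath p) ≅ G.obj (loop p))
  | _, .nil => εIso G
  | _, @Quiver.Path.cons _ _ _ B _ p _ => whiskerRightIso (loopIso G p) (G.obj B.neg) ≪≫ μIso G _ _

lemma loopIso_cons {A B B' : IntP C} (p : Quiver.Path A B) (f : B ⟶ B') :
    (loopIso G (p.cons f)).hom = extProd G (loopIso G p).hom (𝟙 (G.obj B.neg)) := by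
  change (loopIso G p).hom ▷ G.obj B.neg ≫ μ G (loop p) B.neg = _
  simp [extProd]

/-- The morphism `pre` of the image of a path. -/
def preMap (G : C ⥤ D) [G.Braided] {A B : IntP C} (p : Quiver.Path A B) :
    (G.obj A.pos ⊗ loop ((intMap G).mapPath p)) ⊗ G.obj B.neg ⟶
      (G.obj B.pos ⊗ G.obj A.neg) ⊗ loop ((intMap G).mapPath p) := pre ((intMap G).mapPath p)

lemma extProd_pre {A B : IntP C} (p : Quiver.Path A B) :
    extProd G (extProd G (𝟙 (G.obj A.pos)) (loopIso G p).hom) (𝟙 (G.obj B.neg)) ≫ G.map (pre p) =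
      preMap G p ≫ extProd G (extProd G (𝟙 _) (𝟙 _)) (loopIso G p).hom := by
  induction p with
  | nil =>
    exact extProd_comp (extProd_whiskerRight (extProd_rightUnitor _) _) (extProd_inv (extProd_rightUnitor _))
  | @cons B B' p f ih =>
    rw [loopIso_cons]
    exact extProd_comp (extProd_whiskerRight (extProd_assoc_inv _ _ _) _) <| extProd_comp (extProd_whiskerRight ih _) <|
      extProd_comp (extProd_sw _ _ _) <| extProd_comp (extProd_whiskerRight (extProd_sw _ _ _) _) <|
      extProd_comp (extProd_whiskerRight (extProd_whiskerRight (extProd_conj f.hom) _) _) <|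
      extProd_comp (extProd_whiskerRight (extProd_sw _ _ _) _) <| extProd_comp (extProd_sw _ _ _) <| extProd_assoc _ _ _

variable [PartiallyTraced C] [PartiallyTraced D]

/-- A strong symmetric monoidal functor between partially traced categories is traced if it preserves
all traces that are defined. -/
def IsTraced (G : C ⥤ D) [G.Braided] : Prop :=
  ∀ ⦃A B U : C⦄ (f : A ⊗ U ⟶ B ⊗ U) (t : A ⟶ B), t ∈ PartiallyTraced.tr U f →
    G.map t ∈ PartiallyTraced.tr (G.obj U) (conj G f)

/-- `G` preserves the trace defining the composite; naturality then absorbs the comparisons `μ` and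
`δ` at the two ends, and dinaturality along `loopIso` replaces the image of the loop object by the
loop object of the image path. -/
lemma map_mem_comp (hG : IsTraced G) {A B : IntP C} {p : Quiver.Path A B} {f : A ⟶ B}
    (h : f ∈ comp p) : (intMap G).map f ∈ comp ((intMap G).mapPath p) := by
  obtain ⟨t, ht, rfl⟩ := (Part.mem_map_iff _).1 h
  refine (Part.mem_map_iff _).2 ⟨conj G t, ?_, rfl⟩
  have h1 := PartiallyTraced.naturality _ (μ G A.pos B.neg) (δ G B.pos A.neg) _
    (Part.mem_map _ (hG _ _ ht))
  have h2 := extProd_comp (extProd_sw (𝟙 (G.obj A.pos)) (𝟙 (G.obj B.neg)) (loopIso G p).hom) (extProd_pre p)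
  have h3 (a b : C) : extProd G (extProd G (𝟙 (G.obj a)) (𝟙 (G.obj b))) (loopIso G p).hom =
      _ ◁ (loopIso G p).hom ≫ μ G a b ▷ _ ≫ μ G _ _ := by
    rw [extProd_id, extProd, MonoidalCategory.tensorHom_def', Category.assoc]
  have h4 : _ ◁ (loopIso G p).inv ≫
      (sw (G.obj A.pos) (G.obj B.neg) (loop ((intMap G).mapPath p)) ≫ preMap G p) ≫
      _ ◁ (loopIso G p).hom = μ G A.pos B.neg ▷ _ ≫ conj G (sw A.pos B.neg (loop p) ≫ pre p) ≫
        δ G B.pos A.neg ▷ _ := by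
    rw [h3, h3] at h2
    rw [conj, ← cancel_mono (μ G B.pos A.neg ▷ G.obj (loop p)), ← cancel_mono (μ G _ (loop p)),
      ← cancel_epi (_ ◁ (loopIso G p).hom)]
    simp only [Category.assoc, whiskerRight_δ_μ, δ_μ, Category.comp_id] at h2 ⊢
    rw [h2]
    simp
  have h5 := (tr_conj (loopIso G p) _).trans (congrArg (PartiallyTraced.tr (G.obj (loop p))) h4)
  rw [← h5] at h1
  exact h1

/-- The image of an object. -/
abbrev mapObj (G : C ⥤ D) [G.Braided] (A : IntP C) : PathInt D := ⟨⟨G.obj A.pos, G.obj A.neg⟩⟩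

/-- The class of the image of a path. -/
def mapClass (G : C ⥤ D) [G.Braided] {A B : IntP C} (p : Quiver.Path A B) :
    mapObj G A ⟶ mapObj G B :=
  Quot.mk _ ((intMap G).mapPath p)

lemma mapClass_nil (A : IntP C) : mapClass G (Quiver.Path.nil : Quiver.Path A A) = 𝟙 _ := rfl

lemma mapClass_cons {A B B' : IntP C} (p : Quiver.Path A B) (f : B ⟶ B') :
    mapClass G (p.cons f) = mapClass G p ≫ PathInt.arrow (conj G f.hom) := rfl

lemma mapClass_comp {A B B' : IntP C} (p : Quiver.Path A B) (q : Quiver.Path B B') :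
    mapClass G (p.comp q) = mapClass G p ≫ mapClass G q :=
  congrArg (Quot.mk _) ((intMap G).mapPath_comp p q)

/-- The comparison of the tensor product with its image. -/
def compareTensor (G : C ⥤ D) [G.Braided] (A B : IntP C) :
    mapObj G A ⊗ mapObj G B ≅ mapObj G (A.tensorObj B) :=
  PathInt.JIso (μIso G A.pos B.pos) (μIso G B.neg A.neg).symm

/-- Turns a square in `D` into one in `PathInt D`. Negative components are contravariant, which is
why `δ` appears there in place of `μ`. -/
lemma compare_square {a b c d a' b' c' d' : C} {f : (a ⊗ b) ⊗ (c ⊗ d) ⟶ (a' ⊗ b') ⊗ (c' ⊗ d')}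
    {g : (G.obj a ⊗ G.obj b) ⊗ (G.obj c ⊗ G.obj d) ⟶ (G.obj a' ⊗ G.obj b') ⊗ (G.obj c' ⊗ G.obj d')}
    (h : extProd G (extProd G (𝟙 (G.obj a)) (𝟙 (G.obj b))) (extProd G (𝟙 (G.obj c)) (𝟙 (G.obj d))) ≫ G.map f =
      g ≫ extProd G (extProd G (𝟙 _) (𝟙 _)) (extProd G (𝟙 _) (𝟙 _))) :
    PathInt.arrow g ≫ PathInt.J (μ G a' b') (δ G c d) =
      PathInt.J (μ G a b) (δ G c' d') ≫ PathInt.arrow (conj G f) := by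
  rw [PathInt.arrow_J, PathInt.J_arrow]
  refine congrArg PathInt.arrow ?_
  simp only [extProd_id] at h
  simp only [extProd, MonoidalCategory.tensorHom_def', Category.assoc] at h
  rw [← cancel_epi (_ ◁ μ G c d), ← cancel_mono (_ ◁ μ G c' d'), ← cancel_mono (μ G _ _)]
  simp only [Category.assoc, conj, whiskerLeft_μ_δ_assoc, whiskerLeft_δ_μ_assoc, δ_μ, Category.comp_id]
  rw [← whisker_exchange_assoc, ← h]

/-- The class of the image of a path tensored on the left with `X`. -/
def mapClassLeft (G : C ⥤ D) [G.Braided] (X : IntP C) {A B : IntP C} (p : Quiver.Path A B) :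
    mapObj G (X.tensorObj A) ⟶ mapObj G (X.tensorObj B) :=
  mapClass G ((IntP.tensorLeft X).mapPath p)

/-- The class of the image of a path tensored on the right with `X`. -/
def mapClassRight (G : C ⥤ D) [G.Braided] (X : IntP C) {A B : IntP C} (p : Quiver.Path A B) :
    mapObj G (A.tensorObj X) ⟶ mapObj G (B.tensorObj X) :=
  mapClass G ((IntP.tensorRight X).mapPath p)

lemma mapClassLeft_cons (X : IntP C) {A B B' : IntP C} (p : Quiver.Path A B) (f : B ⟶ B') :
    mapClassLeft G X (p.cons f) = mapClassLeft G X p ≫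
      PathInt.arrow (conj G (IntP.inner f.hom X.pos X.neg)) :=
  congrArg (fun t => mapClassLeft G X p ≫ PathInt.arrow (conj G t)) (PathInt.hom_inner f X)

lemma mapClassRight_cons (X : IntP C) {A B B' : IntP C} (p : Quiver.Path A B) (f : B ⟶ B') :
    mapClassRight G X (p.cons f) = mapClassRight G X p ≫
      PathInt.arrow (conj G (IntP.outer f.hom X.pos X.neg)) :=
  congrArg (fun t => mapClassRight G X p ≫ PathInt.arrow (conj G t)) (PathInt.hom_outer f X)

/-- Used twice: it makes the kernel of `mapClass` stable under tensoring, and it is the naturality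
of the tensor comparison of `pathMap`. -/
lemma whiskerLeft_mapClass (X : IntP C) {A B : IntP C} (p : Quiver.Path A B) :
    mapObj G X ◁ mapClass G p ≫ (compareTensor G X B).hom =
      (compareTensor G X A).hom ≫ mapClassLeft G X p := by
  induction p with
  | nil =>
    refine Eq.trans ?_ (Category.comp_id (compareTensor G X A).hom).symm
    rw [mapClass_nil, MonoidalCategory.whiskerLeft_id, Category.id_comp]
  | @cons B B' p f ih =>
    have h : mapObj G X ◁ PathInt.arrow (conj G f.hom) ≫
        (compareTensor G X B').hom = (compareTensor G X B).hom ≫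
          PathInt.arrow (conj G (IntP.inner f.hom X.pos X.neg)) := by
      rw [PathInt.whiskerLeft_arrow]
      exact compare_square (extProd_inner f.hom X.pos X.neg)
    rw [mapClass_cons, MonoidalCategory.whiskerLeft_comp, Category.assoc, h, reassoc_of% ih,
      mapClassLeft_cons]

lemma whiskerRight_mapClass (X : IntP C) {A B : IntP C} (p : Quiver.Path A B) :
    mapClass G p ▷ mapObj G X ≫ (compareTensor G B X).hom =
      (compareTensor G A X).hom ≫ mapClassRight G X p := by
  induction p with
  | nil =>
    refine Eq.trans ?_ (Category.comp_id (compareTensor G A X).hom).symm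
    rw [mapClass_nil, id_whiskerRight, Category.id_comp]
  | @cons B B' p f ih =>
    have h : PathInt.arrow (conj G f.hom) ▷ mapObj G X ≫
        (compareTensor G B' X).hom = (compareTensor G B X).hom ≫
          PathInt.arrow (conj G (IntP.outer f.hom X.pos X.neg)) := by
      rw [PathInt.whiskerRight_arrow]
      exact compare_square (extProd_outer f.hom X.pos X.neg)
    rw [mapClass_cons, comp_whiskerRight, Category.assoc, h, reassoc_of% ih, mapClassRight_cons]

/-- The kernel of `mapClass` contains the smallest congruence, which is what makes `pathMap` well
defined. -/
lemma isCongruence_mapClass (hG : IsTraced G) :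
    IsCongruence (C := C) (fun _ _ p q => mapClass G p = mapClass G q) where
  equivalence _ _ := ⟨fun _ => rfl, Eq.symm, Eq.trans⟩
  append h h' := by rw [mapClass_comp, mapClass_comp, h, h']
  comp h := Quot.sound (isCongruence_sim.comp (map_mem_comp hG h))
  tensorLeft X {A B p q} h := by
    apply (cancel_epi (compareTensor G X A).hom).1
    exact (whiskerLeft_mapClass X p).symm.trans ((congrArg (fun t => _ ◁ t ≫ _) h).trans
      (whiskerLeft_mapClass X q))
  tensorRight X {A B p q} h := by
    apply (cancel_epi (compareTensor G A X).hom).1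
    exact (whiskerRight_mapClass X p).symm.trans ((congrArg (fun t => t ▷ _ ≫ _) h).trans
      (whiskerRight_mapClass X q))

/-- The functor `Path(Intᵖ(C))/∼ → Path(Intᵖ(D))/∼` induced by a traced functor. -/
def pathMap (G : C ⥤ D) [G.Braided] (hG : IsTraced G) : PathInt C ⥤ PathInt D where
  obj X := mapObj G X.as
  map := Quot.lift (mapClass G) (fun _ _ h => h _ (isCongruence_mapClass hG))
  map_id _ := rfl
  map_comp := by
    rintro X Y Z ⟨p⟩ ⟨q⟩
    exact mapClass_comp p q

lemma conj_tensorHom {a p b q : C} (u : a ⟶ b) (v : p ⟶ q) :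
    conj G (u ⊗ₘ v) = G.map u ⊗ₘ G.map v := by
  simp [conj, ← μ_natural_assoc]

lemma pathMap_J (hG : IsTraced G) {a p b q : C} (u : a ⟶ b) (v : q ⟶ p) :
    (pathMap G hG).map (PathInt.J u v) = PathInt.J (G.map u) (G.map v) :=
  congrArg PathInt.arrow (conj_tensorHom u v)

lemma J_pathMap_J (hG : IsTraced G) {a p : D} {b q c r : C} (u : a ⟶ G.obj b) (v : G.obj q ⟶ p)
    (u' : b ⟶ c) (v' : r ⟶ q) :
    PathInt.J u v ≫ (pathMap G hG).map (PathInt.J u' v') =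
      PathInt.J (u ≫ G.map u') (G.map v' ≫ v) :=
  (congrArg (PathInt.J u v ≫ ·) (pathMap_J hG u' v')).trans (PathInt.J_comp u v _ _)

/-- The unit comparison of `pathMap G`. -/
abbrev compareUnit (G : C ⥤ D) [G.Braided] : 𝟙_ (PathInt D) ≅ mapObj G ⟨𝟙_ C, 𝟙_ C⟩ :=
  PathInt.JIso (εIso G) (εIso G).symm

/-- `pathMap G` is strong monoidal. -/
abbrev pathMapMonoidal (hG : IsTraced G) : (pathMap G hG).CoreMonoidal where
  εIso := compareUnit G
  μIso X Y := compareTensor G X.as Y.as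
  μIso_hom_natural_left := by
    rintro X Y ⟨p⟩ X'
    exact whiskerRight_mapClass X'.as p
  μIso_hom_natural_right := by
    rintro X Y X' ⟨p⟩
    exact whiskerLeft_mapClass X'.as p
  associativity X Y Z := by
    change PathInt.J (μ G _ _) (δ G _ _) ▷ mapObj G Z.as ≫ PathInt.J (μ G _ _) (δ G _ _) ≫
      (pathMap G hG).map (PathInt.J (α_ _ _ _).hom (α_ _ _ _).hom) =
      PathInt.J (α_ _ _ _).hom (α_ _ _ _).hom ≫ mapObj G X.as ◁ PathInt.J (μ G _ _) (δ G _ _) ≫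
        PathInt.J (μ G _ _) (δ G _ _)
    rw [PathInt.whiskerRight_J, PathInt.whiskerLeft_J, J_pathMap_J, PathInt.J_comp, PathInt.J_comp]
    refine (PathInt.J_comp _ _ _ _).trans (congrArg₂ PathInt.J ?_ ?_)
    · exact Functor.LaxMonoidal.associativity _ _ _ _
    · simp only [Category.assoc]
      exact (Functor.OplaxMonoidal.associativity _ _ _ _).symm
  left_unitality X := by
    change PathInt.J (λ_ _).hom (ρ_ _).inv = PathInt.J (ε G) (η G) ▷ mapObj G X.as ≫
      PathInt.J (μ G _ _) (δ G _ _) ≫ (pathMap G hG).map (PathInt.J (λ_ _).hom (ρ_ _).inv)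
    rw [PathInt.whiskerRight_J, J_pathMap_J]
    refine Eq.trans (congrArg₂ PathInt.J ?_ ?_) (PathInt.J_comp _ _ _ _).symm
    · exact Functor.LaxMonoidal.left_unitality _ _
    · simp only [Category.assoc]
      exact Functor.OplaxMonoidal.right_unitality _ _
  right_unitality X := by
    change PathInt.J (ρ_ _).hom (λ_ _).inv = mapObj G X.as ◁ PathInt.J (ε G) (η G) ≫
      PathInt.J (μ G _ _) (δ G _ _) ≫ (pathMap G hG).map (PathInt.J (ρ_ _).hom (λ_ _).inv)
    rw [PathInt.whiskerLeft_J, J_pathMap_J]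
    refine Eq.trans (congrArg₂ PathInt.J ?_ ?_) (PathInt.J_comp _ _ _ _).symm
    · exact Functor.LaxMonoidal.right_unitality _ _
    · simp only [Category.assoc]
      exact Functor.OplaxMonoidal.left_unitality _ _

instance (hG : IsTraced G) : (pathMap G hG).Monoidal := (pathMapMonoidal hG).toMonoidal

instance (hG : IsTraced G) : (pathMap G hG).Braided where
  braided X Y := by
    change PathInt.J (μ G _ _) (δ G _ _) ≫ (pathMap G hG).map (PathInt.J (β_ _ _).hom (β_ _ _).hom) =
      PathInt.J (β_ _ _).hom (β_ _ _).hom ≫ PathInt.J (μ G _ _) (δ G _ _)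
    rw [J_pathMap_J, PathInt.J_comp]
    congr 1
    · exact Functor.LaxBraided.braided _ _
    · rw [← cancel_epi (μ G _ _), ← cancel_mono (μ G _ _)]
      simp

end Star

/-! ### `embed D` is an equivalence. -/

section Equivalence

variable {D : Type u₂} [Category.{v₂} D] [MonoidalCategory D] [SymmetricCategory D]
  [LeftRigidCategory D]

attribute [local instance] canonicalPartialTrace

/-- The object `(I, x)` and the image of the dual of `x` are both dual to `(x, I)`, hence
isomorphic; now tensor with `(a, I)` and use `decomp`. -/
instance : (embed D).EssSurj where
  mem_essImage X := ⟨X.as.pos ⊗ (ᘁX.as.neg : D), ⟨(μIso (embed D) _ _).symm ≪≫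
    whiskerLeftIso (base X.as.pos) (starIso ((dual X.as.neg).map (embed D))
      (PathInt.baseDual X.as.neg) (Iso.refl _)) ≪≫ PathInt.decomp X.as.pos X.as.neg⟩⟩

instance : (embed D).IsEquivalence where

end Equivalence
end PartialTrace

namespace PartialTrace

open IntP DualPair Functor.LaxMonoidal Functor.OplaxMonoidal Functor.Monoidal

/-! ### Symmetric monoidal inverses, and the construction of `L`. -/

section Inverse

variable {E : Type u₁} [Category.{v₁} E] [MonoidalCategory E]
  [SymmetricCategory E] {E' : Type u₂} [Category.{v₂} E'] [MonoidalCategory E']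
  [SymmetricCategory E']

/-- A strong symmetric monoidal equivalence has a strong symmetric monoidal inverse. -/
lemma exists_braided_inverse (e : E ≌ E') (H : E ⥤ E') [H.Braided] (h : e.functor = H) :
    ∃ (K : E' ⥤ E) (_ : K.Braided) (u : H ⋙ K ≅ 𝟭 E), NatTrans.IsMonoidal u.hom := by
  subst h
  let _ : e.inverse.Monoidal := e.inverseMonoidal
  have : e.IsMonoidal := { leftAdjoint_ε := rfl, leftAdjoint_μ := fun _ _ => rfl }
  let _ : e.inverse.Braided :=
    { braided := fun X Y => by
        -- Compatibility with the symmetry can be tested after the faithful `e.functor`, where the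
        -- counit reduces it to naturality of the symmetry of `E'`.
        apply e.functor.map_injective
        rw [← cancel_mono (e.counitIso.hom.app _)]
        have h1 := e.counitIso.hom.naturality (β_ X Y).hom
        have h2 := Functor.LaxBraided.braided (F := e.functor) (e.inverse.obj X) (e.inverse.obj Y)
        rw [Functor.id_map, Functor.comp_map] at h1
        simp only [Functor.map_comp, Category.assoc]
        rw [h1, e.functor_map_μ_inverse_comp_counitIso_hom_app_tensor_assoc,
          e.functor_map_μ_inverse_comp_counitIso_hom_app_tensor,
          BraidedCategory.braiding_naturality, ← cancel_epi (μ e.functor _ _), reassoc_of% h2]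
        simp }
  have : NatTrans.IsMonoidal e.unitIso.hom := inferInstanceAs (NatTrans.IsMonoidal e.unit)
  exact ⟨e.inverse, inferInstance, e.unitIso.symm,
    inferInstanceAs (NatTrans.IsMonoidal e.unitIso.inv)⟩

end Inverse

section Existence

variable {C : Type u₁} [Category.{v₁} C] [MonoidalCategory C] [SymmetricCategory C]
  [PartiallyTraced C]
  {D : Type u₂} [Category.{v₂} D] [MonoidalCategory D] [SymmetricCategory D]

/-- `pathMap G` extends `G`. -/
def embedPathMap [PartiallyTraced D] {G : C ⥤ D} [G.Braided] (hG : IsTraced G) :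
    embed C ⋙ pathMap G hG ≅ G ⋙ embed D :=
  NatIso.ofComponents (fun A => (PathInt.JIso (Iso.refl (G.obj A)) (εIso G) :
      mapObj G ⟨A, 𝟙_ C⟩ ≅ base (G.obj A))) (fun {A B} f => by
    change (pathMap G hG).map (PathInt.J f (𝟙 (𝟙_ C))) ≫ PathInt.J (𝟙 _) (ε G) =
      PathInt.J (𝟙 _) (ε G) ≫ PathInt.J (G.map f) (𝟙 _)
    rw [pathMap_J]
    refine (PathInt.J_comp _ _ _ _).trans (Eq.trans ?_ (PathInt.J_comp _ _ _ _).symm)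
    simp)

instance [PartiallyTraced D] {G : C ⥤ D} [G.Braided] (hG : IsTraced G) :
    NatTrans.IsMonoidal (embedPathMap hG).hom where
  unit := by
    change ((PathInt.J (ε G) (η G)) ≫ (pathMap G hG).map (𝟙 (𝟙_ (PathInt C)))) ≫
      PathInt.J (𝟙 _) (ε G) = 𝟙 (𝟙_ (PathInt D)) ≫ PathInt.J (ε G) (𝟙 _)
    rw [(pathMap G hG).map_id, Category.id_comp]
    refine (congrArg (· ≫ _) (Category.comp_id _)).trans ((PathInt.J_comp _ _ _ _).trans
      (congrArg₂ PathInt.J (Category.comp_id _) (ε_η G)))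
  tensor X Y := by
    change (PathInt.J (μ G X Y) (δ G _ _) ≫ (pathMap G hG).map (PathInt.J (𝟙 _) (λ_ (𝟙_ C)).inv)) ≫
      PathInt.J (𝟙 _) (ε G) = (PathInt.J (𝟙 _) (ε G) ▷ mapObj G ⟨Y, 𝟙_ C⟩ ≫
        base (G.obj X) ◁ PathInt.J (𝟙 _) (ε G)) ≫ PathInt.J (𝟙 _) (λ_ (𝟙_ D)).inv ≫
          PathInt.J (μ G X Y) (𝟙 _)
    rw [J_pathMap_J, PathInt.whiskerRight_J, PathInt.whiskerLeft_J, PathInt.J_comp]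
    refine (PathInt.J_comp _ _ _ _).trans (Eq.trans ?_
      ((congrArg (_ ≫ ·) (PathInt.J_comp _ _ _ _)).trans (PathInt.J_comp _ _ _ _)).symm)
    congr 1
    · simp
    · rw [← cancel_mono (μ G _ _)]
      simp only [Category.assoc, δ_μ, Category.comp_id, Category.id_comp,
        ← Functor.LaxMonoidal.left_unitality_inv]
      rw [leftUnitor_inv_naturality_assoc, whisker_exchange_assoc]

variable [LeftRigidCategory D]

attribute [local instance] canonicalPartialTrace

lemma PreservesTrace.isTraced {G : C ⥤ D} [G.Braided] (hG : PreservesTrace G) : IsTraced G :=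
  fun _ _ _ f t ht => Part.mem_some_iff.2 (hG f t ht).symm

/-- With `K` a symmetric monoidal inverse of `embed D`, take `pathMap G` followed by `K`: on `C` it
is `G ⋙ embed D ⋙ K`, which is isomorphic to `G`. Each isomorphism in the chain is monoidal. -/
lemma exists_extension (G : C ⥤ D) [G.Braided] (hG : PreservesTrace G) :
    ∃ (L : PathInt C ⥤ D) (_ : L.Braided) (φ : embed C ⋙ L ≅ G), NatTrans.IsMonoidal φ.hom := by
  obtain ⟨K, _, u, hu⟩ : ∃ (K : PathInt D ⥤ D) (_ : K.Braided) (u : embed D ⋙ K ≅ 𝟭 D),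
      NatTrans.IsMonoidal u.hom :=
    exists_braided_inverse (embed D).asEquivalence (embed D) rfl
  have h₁ : NatTrans.IsMonoidal (Functor.associator (embed C) (pathMap G hG.isTraced) K).inv :=
    inferInstance
  have h₂ : NatTrans.IsMonoidal (Functor.whiskerRight (embedPathMap hG.isTraced).hom K) :=
    inferInstance
  have h₃ : NatTrans.IsMonoidal (Functor.associator G (embed D) K).hom := inferInstance
  have h₄ : NatTrans.IsMonoidal (Functor.whiskerLeft G u.hom) := inferInstance
  have h₅ : NatTrans.IsMonoidal (Functor.rightUnitor G).hom := inferInstance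
  exact ⟨pathMap G hG.isTraced ⋙ K, inferInstance,
    (Functor.associator _ _ _).symm ≪≫ Functor.isoWhiskerRight (embedPathMap hG.isTraced) K ≪≫
      Functor.associator _ _ _ ≪≫ Functor.isoWhiskerLeft G u ≪≫ Functor.rightUnitor G,
    @NatTrans.IsMonoidal.comp _ _ _ _ _ _ _ _ _ _ _ _ _ _ h₁ <|
      @NatTrans.IsMonoidal.comp _ _ _ _ _ _ _ _ _ _ _ _ _ _ h₂ <|
      @NatTrans.IsMonoidal.comp _ _ _ _ _ _ _ _ _ _ _ _ _ _ h₃ <|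
      @NatTrans.IsMonoidal.comp _ _ _ _ _ _ _ _ _ _ _ _ _ _ h₄ h₅⟩

end Existence
end PartialTrace

namespace PartialTrace

open DualPair Functor.LaxMonoidal Functor.OplaxMonoidal Functor.Monoidal

/-! ### Spreading monoidality of a transformation, and transporting dualities along functors. -/

section Tensorators

variable {B : Type u₁} [Category.{v₁} B] [MonoidalCategory B] [SymmetricCategory B]
  {D : Type u₂} [Category.{v₂} D] [MonoidalCategory D] [SymmetricCategory D]
  {L L' : B ⥤ D} [L.Braided] [L'.Braided] (θ : L ⟶ L')

/-- Compatibility of a natural transformation with the comparison maps for `X ⊗ Y`. -/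
def TensorCompat (X Y : B) : Prop :=
  μ L X Y ≫ θ.app (X ⊗ Y) = extProd L' (θ.app X) (θ.app Y)

namespace TensorCompat

variable {θ} {X Y Z X' Y' : B}

lemma of_iso (h : TensorCompat θ X Y) (e : X ≅ X') (f : Y ≅ Y') : TensorCompat θ X' Y' := by
  have h1 : (L.map e.hom ⊗ₘ L.map f.hom) ≫ extProd L' (θ.app X') (θ.app Y') =
      extProd L' (θ.app X) (θ.app Y) ≫ L'.map (e.hom ⊗ₘ f.hom) := by
    rw [extProd, extProd, Category.assoc, ← μ_natural, MonoidalCategory.tensorHom_comp_tensorHom_assoc,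
      MonoidalCategory.tensorHom_comp_tensorHom_assoc, θ.naturality, θ.naturality]
  rw [TensorCompat, ← cancel_epi (L.map e.hom ⊗ₘ L.map f.hom), h1, ← h, μ_natural_assoc,
    θ.naturality, Category.assoc]

lemma braid (h : TensorCompat θ X Y) : TensorCompat θ Y X := by
  have h1 := extProd_braid (G := L') (θ.app X) (θ.app Y)
  rw [TensorCompat, ← cancel_epi (β_ (L.obj X) (L.obj Y)).hom, ← h1, ← h,
    ← Functor.LaxBraided.braided_assoc, θ.naturality, Category.assoc]

/-- Both ways of bracketing `X`, `Y`, `Z` give the same comparison, so three of the four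
compatibilities imply the fourth. -/
lemma assoc (h : TensorCompat θ X Y) (h' : TensorCompat θ (X ⊗ Y) Z) (h'' : TensorCompat θ Y Z) :
    TensorCompat θ X (Y ⊗ Z) := by
  have h1 : extProd L' (extProd L' (θ.app X) (θ.app Y)) (θ.app Z) =
      μ L X Y ▷ L.obj Z ≫ extProd L' (θ.app (X ⊗ Y)) (θ.app Z) := by
    rw [← h, extProd, extProd, ← tensorHom_id, MonoidalCategory.tensorHom_comp_tensorHom_assoc,
      Category.id_comp]
  have h2 : extProd L' (θ.app X) (extProd L' (θ.app Y) (θ.app Z)) =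
      L.obj X ◁ μ L Y Z ≫ extProd L' (θ.app X) (θ.app (Y ⊗ Z)) := by
    rw [← h'', extProd, extProd, ← id_tensorHom, MonoidalCategory.tensorHom_comp_tensorHom_assoc,
      Category.id_comp]
  have h3 := extProd_assoc (G := L') (θ.app X) (θ.app Y) (θ.app Z)
  rw [h1, h2, ← h', Category.assoc, Category.assoc, ← θ.naturality,
    Functor.LaxMonoidal.associativity_assoc, cancel_epi, cancel_epi] at h3
  exact h3

lemma assoc' (h : TensorCompat θ Y Z) (h' : TensorCompat θ X (Y ⊗ Z)) (h'' : TensorCompat θ X Y) :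
    TensorCompat θ (X ⊗ Y) Z :=
  (h.braid.assoc (h'.braid.of_iso (β_ _ _) (Iso.refl _)) h''.braid).braid.of_iso (β_ _ _) (Iso.refl _)

end TensorCompat

end Tensorators

section Unitors

variable {B : Type u₁} [Category.{v₁} B] [MonoidalCategory B]
  {D : Type u₂} [Category.{v₂} D] [MonoidalCategory D]
  {L L' : B ⥤ D} [L.Monoidal] [L'.Monoidal]

/-- If `t` respects the unit comparisons, tensoring `s` with `t` and removing the unit object gives
back `s`. It is what shows that the extended transformation has its prescribed values on `(a, I)`.
-/
lemma rightUnitor_map_unit {X : B} (s : L.obj X ⟶ L'.obj X) {t : L.obj (𝟙_ B) ⟶ L'.obj (𝟙_ B)}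
    (ht : Functor.LaxMonoidal.ε L ≫ t = Functor.LaxMonoidal.ε L') :
    (s ⊗ₘ t) ≫ μ L' X (𝟙_ B) ≫ L'.map (ρ_ X).hom = μ L X (𝟙_ B) ≫ L.map (ρ_ X).hom ≫ s := by
  rw [← cancel_epi (L.obj X ◁ Functor.LaxMonoidal.ε L), ← id_tensorHom,
    MonoidalCategory.tensorHom_comp_tensorHom_assoc, ht, Category.id_comp, id_tensorHom,
    ← Functor.LaxMonoidal.right_unitality_assoc, ← rightUnitor_naturality,
    Functor.LaxMonoidal.right_unitality, MonoidalCategory.tensorHom_def, Category.assoc]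

lemma leftUnitor_map_unit {X : B} (s : L.obj X ⟶ L'.obj X) {t : L.obj (𝟙_ B) ⟶ L'.obj (𝟙_ B)}
    (ht : Functor.LaxMonoidal.ε L ≫ t = Functor.LaxMonoidal.ε L') :
    (t ⊗ₘ s) ≫ μ L' (𝟙_ B) X ≫ L'.map (λ_ X).hom = μ L (𝟙_ B) X ≫ L.map (λ_ X).hom ≫ s := by
  rw [← cancel_epi (Functor.LaxMonoidal.ε L ▷ L.obj X), ← tensorHom_id,
    MonoidalCategory.tensorHom_comp_tensorHom_assoc, ht, Category.id_comp, tensorHom_id,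
    ← Functor.LaxMonoidal.left_unitality_assoc, ← leftUnitor_naturality,
    Functor.LaxMonoidal.left_unitality, MonoidalCategory.tensorHom_def', Category.assoc]

end Unitors

namespace DualPair

variable {B : Type u₁} [Category.{v₁} B] [MonoidalCategory B] [SymmetricCategory B]
  {D : Type u₂} [Category.{v₂} D] [MonoidalCategory D] [SymmetricCategory D]
  {L L' : B ⥤ D} [L.Braided] [L'.Braided]

lemma Compat.map {U U' W W' : B} {d : DualPair U U'} {e : DualPair W W'} {s : U ⟶ W} {s' : U' ⟶ W'}
    (h : Compat d e s s') (L : B ⥤ D) [L.Braided] :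
    Compat (d.map L) (e.map L) (L.map s) (L.map s') where
  unit := by
    change (Functor.LaxMonoidal.ε L ≫ L.map d.η ≫ δ L U U') ≫ _ =
      Functor.LaxMonoidal.ε L ≫ L.map e.η ≫ δ L W W'
    rw [← h.unit]
    simp
  counit := by
    change _ ≫ (μ L W W' ≫ L.map e.ε ≫ Functor.OplaxMonoidal.η L) =
      μ L U U' ≫ L.map d.ε ≫ Functor.OplaxMonoidal.η L
    rw [← h.counit]
    simp

lemma Compat.tensor {U U' W W' V V' T T' : D} {d : DualPair U U'} {e : DualPair W W'} {s : U ⟶ W}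
    {s' : U' ⟶ W'} {d₁ : DualPair V V'} {e₁ : DualPair T T'} {r : V ⟶ T} {r' : V' ⟶ T'}
    (h : Compat d e s s') (h₁ : Compat d₁ e₁ r r') :
    Compat (d.tensor d₁) (e.tensor e₁) (s ⊗ₘ r) (r' ⊗ₘ s') where
  unit := by
    have h2 := tensorHom_whisker_square (h₁.cup s).symm s'
    change (d.η ≫ d₁.cup U ▷ U' ≫ (α_ _ _ _).hom) ≫ _ = e.η ≫ e₁.cup W ▷ W' ≫ (α_ _ _ _).hom
    rw [Category.assoc, Category.assoc, ← MonoidalCategory.associator_naturality, ← reassoc_of% h2,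
      reassoc_of% h.unit]
  counit := by
    have h2 := tensorHom_whisker_square (h₁.cap s) s'
    change _ ≫ (α_ _ _ _).inv ≫ e₁.cap W ▷ W' ≫ e.ε = (α_ _ _ _).inv ≫ d₁.cap U ▷ U' ≫ d.ε
    rw [MonoidalCategory.associator_inv_naturality_assoc, reassoc_of% h2, h.counit]

/-- The image of a tensor product of dualities is the tensor product of the images, up to `μ` on
both members. -/
lemma compat_map_tensor {U U' V V' : B} (d : DualPair U U') (e : DualPair V V') (L : B ⥤ D)
    [L.Braided] : Compat ((d.map L).tensor (e.map L)) ((d.tensor e).map L) (μ L U V) (μ L V' U') where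
  unit := by
    have h1 : 𝟙 (L.obj U) ≫ L.map (e.cup U) = (e.map L).cup (L.obj U) ≫
        extProd L (extProd L (𝟙 _) (𝟙 _)) (𝟙 _) := by
      rw [← cup_map, extProd_id, extProd, tensorHom_id, Category.id_comp]
    have h2 := extProd_comp (extProd_whiskerRight h1 (𝟙 (L.obj U')))
      (extProd_assoc (extProd L (𝟙 (L.obj U)) (𝟙 (L.obj V))) (𝟙 (L.obj V')) (𝟙 (L.obj U')))
    simp only [extProd_id] at h2
    change ((Functor.LaxMonoidal.ε L ≫ L.map d.η ≫ δ L U U') ≫ (e.map L).cup _ ▷ _ ≫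
      (α_ _ _ _).hom) ≫ _ = Functor.LaxMonoidal.ε L ≫
        L.map (d.η ≫ e.cup U ▷ U' ≫ (α_ (U ⊗ V) V' U').hom) ≫ δ L _ _
    rw [← cancel_mono (μ L _ _), L.map_comp d.η]
    simp only [Category.assoc, δ_μ, Category.comp_id] at h2 ⊢
    rw [← extProd, ← h2, δ_μ_assoc]
  counit := by
    have h1 : extProd L (extProd L (𝟙 (L.obj U)) (𝟙 (L.obj V))) (𝟙 (L.obj V')) ≫ L.map (e.cap U) =
        (e.map L).cap (L.obj U) ≫ 𝟙 _ := by
      rw [← cap_map, extProd_id, extProd, tensorHom_id, Category.comp_id, Category.assoc]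
    have h2 := extProd_comp (extProd_assoc_inv (extProd L (𝟙 (L.obj U)) (𝟙 (L.obj V))) (𝟙 (L.obj V'))
      (𝟙 (L.obj U'))) (extProd_whiskerRight h1 (𝟙 (L.obj U')))
    simp only [extProd_id] at h2
    change _ ≫ μ L _ _ ≫ L.map ((α_ _ _ _).inv ≫ e.cap U ▷ U' ≫ d.ε) ≫ _ =
      (α_ _ _ _).inv ≫ (e.map L).cap _ ▷ _ ≫ μ L U U' ≫ L.map d.ε ≫ _
    rw [← Category.assoc (α_ (U ⊗ V) V' U').inv, L.map_comp]
    simp only [extProd, Category.assoc] at h2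
    rw [Category.assoc, reassoc_of% h2]

/-- Together with `Compat.unique`, this forces the component of a monoidal transformation at a dual
object. -/
lemma compat_of_isMonoidal {U U' : B} (d : DualPair U U') (θ : L ⟶ L') [NatTrans.IsMonoidal θ] :
    Compat (d.map L) (d.map L') (θ.app U) (θ.app U') where
  unit := by
    change (Functor.LaxMonoidal.ε L ≫ L.map d.η ≫ δ L U U') ≫ _ =
      Functor.LaxMonoidal.ε L' ≫ L'.map d.η ≫ δ L' U U'
    rw [← cancel_mono (μ L' U U')]
    simp only [Category.assoc, δ_μ, Category.comp_id]
    rw [← NatTrans.IsMonoidal.tensor, δ_μ_assoc, θ.naturality, NatTrans.IsMonoidal.unit_assoc]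
  counit := by
    change _ ≫ (μ L' U U' ≫ L'.map d.ε ≫ Functor.OplaxMonoidal.η L') =
      μ L U U' ≫ L.map d.ε ≫ Functor.OplaxMonoidal.η L
    rw [← NatTrans.IsMonoidal.tensor_assoc, ← θ.naturality_assoc, ← cancel_mono
      (Functor.LaxMonoidal.ε L')]
    simp only [Category.assoc, η_ε, Category.comp_id]
    rw [← NatTrans.IsMonoidal.unit (τ := θ), η_ε_assoc]

lemma compat_map_unit (d : DualPair (𝟙_ B) (𝟙_ B)) (h : d.η = (λ_ (𝟙_ B)).inv)
    (h' : d.ε = (λ_ (𝟙_ B)).hom) {t : L.obj (𝟙_ B) ⟶ L'.obj (𝟙_ B)}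
    (ht : Functor.LaxMonoidal.ε L ≫ t = Functor.LaxMonoidal.ε L') :
    Compat (d.map L) (d.map L') t t := by
  have h1 := leftUnitor_map_unit t ht
  constructor
  · change (Functor.LaxMonoidal.ε L ≫ L.map d.η ≫ δ L _ _) ≫ _ =
      Functor.LaxMonoidal.ε L' ≫ L'.map d.η ≫ δ L' _ _
    rw [h, ← cancel_mono (μ L' (𝟙_ B) (𝟙_ B) ≫ L'.map (λ_ (𝟙_ B)).hom)]
    simp only [Category.assoc]
    rw [h1, δ_μ_assoc, δ_μ_assoc, ← L.map_comp_assoc, ← L'.map_comp, Iso.inv_hom_id, L.map_id,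
      L'.map_id, Category.id_comp, Category.comp_id, ht]
  · change _ ≫ (μ L' _ _ ≫ L'.map d.ε ≫ Functor.OplaxMonoidal.η L') =
      μ L _ _ ≫ L.map d.ε ≫ Functor.OplaxMonoidal.η L
    have h2 : t ≫ Functor.OplaxMonoidal.η L' = Functor.OplaxMonoidal.η L := by
      rw [← cancel_epi (Functor.LaxMonoidal.ε L), reassoc_of% ht, ε_η, ε_η]
    rw [h', reassoc_of% h1, h2]

end DualPair

/-! ### The unique monoidal extension of an isomorphism given on `C`. -/

section Uniqueness

open PathInt

variable {C : Type u₁} [Category.{v₁} C] [MonoidalCategory C] [SymmetricCategory C]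
  [PartiallyTraced C]
  {D : Type u₂} [Category.{v₂} D] [MonoidalCategory D] [SymmetricCategory D]
  {L L' : PathInt C ⥤ D} [L.Braided] [L'.Braided] (ψ : embed C ⋙ L ≅ embed C ⋙ L')

/-- The component of `ψ` at `a`. -/
abbrev compBase (a : C) : L.obj (base a) ≅ L'.obj (base a) := ψ.app a

/-- The isomorphism on the dual of `a` induced by the component of `ψ` at `a`. -/
def compCobase (p : C) : L.obj (cobase p) ≅ L'.obj (cobase p) :=
  starIso ((baseDual p).map L) ((baseDual p).map L') (compBase ψ p)

lemma compat_compCobase (p : C) : Compat ((baseDual p).map L) ((baseDual p).map L')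
    (compBase ψ p).hom (compCobase ψ p).hom := compat_star _ _ _

/-- The extension of `ψ` to all objects. -/
def extend (X : PathInt C) : L.obj X ≅ L'.obj X :=
  (L.mapIso (decomp X.as.pos X.as.neg)).symm ≪≫ (μIso L _ _).symm ≪≫
    (compBase ψ X.as.pos ⊗ᵢ compCobase ψ X.as.neg) ≪≫ μIso L' _ _ ≪≫
    L'.mapIso (decomp X.as.pos X.as.neg)

lemma μ_map_extend (a x : C) : μ L (base a) (cobase x) ≫ L.map (decomp a x).hom ≫
      (extend ψ ⟨⟨a, x⟩⟩).hom =
    ((compBase ψ a).hom ⊗ₘ (compCobase ψ x).hom) ≫ μ L' (base a) (cobase x) ≫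
      L'.map (decomp a x).hom := by
  change _ ≫ _ ≫ L.map (decomp a x).inv ≫ δ L _ _ ≫ _ = _
  rw [← L.map_comp_assoc, Iso.hom_inv_id, L.map_id, Category.id_comp, μ_δ_assoc]
  rfl

variable [NatTrans.IsMonoidal ψ.hom]

lemma compBase_tensor (a b : C) : ((compBase ψ a).hom ⊗ₘ (compBase ψ b).hom) ≫
      μ L' (base a) (base b) ≫ L'.map (baseMu a b).hom =
    μ L (base a) (base b) ≫ L.map (baseMu a b).hom ≫ (compBase ψ (a ⊗ b)).hom := by
  have h := NatTrans.IsMonoidal.tensor (τ := ψ.hom) a b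
  rw [Functor.LaxMonoidal.comp_μ, Functor.LaxMonoidal.comp_μ, Category.assoc] at h
  exact h.symm

lemma compBase_unit : Functor.LaxMonoidal.ε L ≫ (compBase ψ (𝟙_ C)).hom =
    Functor.LaxMonoidal.ε L' := by
  have h := NatTrans.IsMonoidal.unit (τ := ψ.hom)
  rw [Functor.LaxMonoidal.comp_ε, Functor.LaxMonoidal.comp_ε] at h
  have h1 : L.map (Functor.LaxMonoidal.ε (embed C)) = 𝟙 _ := L.map_id _
  have h2 : L'.map (Functor.LaxMonoidal.ε (embed C)) = 𝟙 _ := L'.map_id _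
  rw [h1, h2] at h
  refine Eq.trans ?_ (h.trans (Category.comp_id _))
  exact congrArg (· ≫ _) (Category.comp_id _).symm

lemma compBase_natural {a b : C} (u : a ⟶ b) :
    L.map (baseMap u) ≫ (compBase ψ b).hom = (compBase ψ a).hom ≫ L'.map (baseMap u) :=
  ψ.hom.naturality u

lemma J_baseMu {a q b x : C} (u : a ⊗ q ⟶ b ⊗ x) :
    (J u (𝟙 (𝟙_ C ⊗ 𝟙_ C)) : base a ⊗ base q ⟶ base b ⊗ base x) ≫ (baseMu b x).hom =
      (baseMu a q).hom ≫ baseMap u := by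
  change J u (𝟙 _) ≫ J (𝟙 _) _ = J (𝟙 _) _ ≫ J u (𝟙 _)
  rw [J_comp, J_comp]
  simp

/-- Naturality of `ψ` at `u`, rewritten on tensor products of base objects: the square that
`mate_nat` takes as input. -/
lemma compBase_conj {a q b x : C} {u : a ⊗ q ⟶ b ⊗ x} {v : base a ⊗ base q ⟶ base b ⊗ base x}
    (hv : v ≫ (baseMu b x).hom = (baseMu a q).hom ≫ baseMap u) :
    ((compBase ψ a).hom ⊗ₘ (compBase ψ q).hom) ≫ μ L' (base a) (base q) ≫
      L'.map v ≫ δ L' (base b) (base x) =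
    (μ L (base a) (base q) ≫ L.map v ≫ δ L (base b) (base x)) ≫
      ((compBase ψ b).hom ⊗ₘ (compBase ψ x).hom) := by
  have h1 := compBase_tensor ψ a q
  have h2 := compBase_tensor ψ b x
  have h3 := compBase_natural ψ u
  rw [← cancel_mono (μ L' (base b) (base x)), ← cancel_mono (L'.map (baseMu b x).hom)]
  simp only [Category.assoc]
  rw [h2, δ_μ_assoc, δ_μ_assoc, ← L'.map_comp, ← L.map_comp_assoc, hv, L.map_comp, L'.map_comp,
    reassoc_of% h1, ← h3, Category.assoc]

/-- An arrow is the mate of a morphism of `C`. Both functors preserve mates, and `ψ` with its dual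
components is compatible with the dualities, so `mate_nat` carries naturality over `C` to the arrow.
-/
lemma extend_arrow {a x b q : C} (u : a ⊗ q ⟶ b ⊗ x) :
    L.map (arrow u) ≫ (extend ψ ⟨⟨b, q⟩⟩).hom = (extend ψ ⟨⟨a, x⟩⟩).hom ≫ L'.map (arrow u) := by
  have h1 := μ_map_extend ψ a x
  have h2 := μ_map_extend ψ b q
  have h3 := mate_nat (compat_compCobase ψ x) (compat_compCobase ψ q) _ _
    (compBase_conj ψ (J_baseMu u))
  have h4 := mate_map L (baseDual x) (baseDual q) (A := base a) (B := base b)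
    (J u (𝟙 (𝟙_ C ⊗ 𝟙_ C)))
  have h5 := mate_map L' (baseDual x) (baseDual q) (A := base a) (B := base b)
    (J u (𝟙 (𝟙_ C ⊗ 𝟙_ C)))
  rw [← cancel_epi (L.map (decomp a x).hom), ← cancel_epi (μ L (base a) (cobase x)),
    reassoc_of% h1, ← L'.map_comp, ← L.map_comp_assoc, decomp_arrow, L.map_comp, L'.map_comp,
    ← reassoc_of% h5, reassoc_of% h3, Category.assoc, ← reassoc_of% h4, h2]

/-- The extension of `ψ`, as a natural isomorphism. -/
def extendIso : L ≅ L' := NatIso.ofComponents (extend ψ) (fun {X Y} f => by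
  induction f using hom_induction with
  | id => simp
  | step p f ih =>
    have h : L.map (sing f) ≫ (extend ψ ⟨_⟩).hom = (extend ψ ⟨_⟩).hom ≫ L'.map (sing f) :=
      extend_arrow ψ f.hom
    rw [L.map_comp, L'.map_comp, Category.assoc, h, reassoc_of% ih])

/-- The object `(I, I)` is both of the form `(a, I)` and of the form `(I, p)`. The two prescriptions
agree there because `baseDual` of the unit object is the evident self-duality. -/
lemma compCobase_unit : (compCobase ψ (𝟙_ C)).hom = (compBase ψ (𝟙_ C)).hom := by
  refine (compat_compCobase ψ (𝟙_ C)).unique (compat_map_unit (baseDual (𝟙_ C)) ?_ ?_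
    (compBase_unit ψ))
  · refine congrArg arrow (?_ : (λ_ _).hom ≫ 𝟙 _ ≫ (ρ_ _).inv = (λ_ _).inv ⊗ₘ (ρ_ _).hom)
    monoidal
  · refine congrArg arrow (?_ : (ρ_ _).hom ≫ 𝟙 _ ≫ (λ_ _).inv = (λ_ _).hom ⊗ₘ (ρ_ _).inv)
    monoidal

lemma extend_base (a : C) : (extend ψ (base a)).hom = (compBase ψ a).hom := by
  have h1 := μ_map_extend ψ a (𝟙_ C)
  have h2 := rightUnitor_map_unit (compBase ψ a).hom (compBase_unit ψ)
  have h3 : (decomp a (𝟙_ C)).hom = (ρ_ (base a)).hom :=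
    congrArg (J (ρ_ a).hom) (unitors_inv_equal (C := C)).symm
  rw [h3, compCobase_unit] at h1
  have h4 := h1.trans h2
  exact (cancel_epi _).1 ((cancel_epi _).1 h4)

lemma extend_cobase (p : C) : (extend ψ (cobase p)).hom = (compCobase ψ p).hom := by
  have h1 := μ_map_extend ψ (𝟙_ C) p
  have h2 := leftUnitor_map_unit (compCobase ψ p).hom (compBase_unit ψ)
  have h3 : (decomp (𝟙_ C) p).hom = (λ_ (cobase p)).hom :=
    congrArg (fun t => J t (ρ_ p).inv) (unitors_equal (C := C)).symm
  rw [h3] at h1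
  have h4 := h1.trans h2
  exact (cancel_epi _).1 ((cancel_epi _).1 h4)

lemma extendIso_app (X : PathInt C) : (extendIso ψ).hom.app X = (extend ψ X).hom := rfl

lemma tensorCompat_base_base (a b : C) : TensorCompat (extendIso ψ).hom (base a) (base b) := by
  have h1 := compBase_tensor ψ a b
  have h2 := (extendIso ψ).hom.naturality (baseMu a b).hom
  rw [extendIso_app, extendIso_app, extend_base] at h2
  rw [TensorCompat, extProd, ← cancel_mono (L'.map (baseMu a b).hom), extendIso_app, extendIso_app,
    extendIso_app, extend_base, extend_base, Category.assoc, Category.assoc, h1, h2]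

lemma tensorCompat_base_cobase (a p : C) :
    TensorCompat (extendIso ψ).hom (base a) (cobase p) := by
  have h1 := μ_map_extend ψ a p
  have h2 := (extendIso ψ).hom.naturality (decomp a p).hom
  rw [extendIso_app, extendIso_app] at h2
  rw [TensorCompat, extProd, ← cancel_mono (L'.map (decomp a p).hom), extendIso_app, extendIso_app,
    extendIso_app, extend_base, extend_cobase, Category.assoc, Category.assoc, ← h1, h2]

/-- The comparison `(I, p) ⊗ (I, q) ≅ (I, q ⊗ p)`, as the dual of the comparison for `q ⊗ p`. -/
def cobaseMu (p q : C) : cobase p ⊗ cobase q ≅ cobase (q ⊗ p) :=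
  starIso ((baseDual q).tensor (baseDual p)) (baseDual (q ⊗ p)) (baseMu q p)

/-- Both composites are partners of the same morphism for the same two dualities (on the first
members this is `compBase_tensor`), so they coincide by `Compat.unique`. -/
lemma tensorCompat_cobase_cobase (p q : C) :
    TensorCompat (extendIso ψ).hom (cobase p) (cobase q) := by
  have h0 : Compat ((baseDual q).tensor (baseDual p)) (baseDual (q ⊗ p)) (baseMu q p).hom
    (cobaseMu p q).hom := compat_star _ _ _
  have h1 := ((compat_map_tensor (baseDual q) (baseDual p) L).comp (h0.map L)).comp
    (compat_compCobase ψ (q ⊗ p))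
  have h2 := (((compat_compCobase ψ q).tensor (compat_compCobase ψ p)).comp
    (compat_map_tensor (baseDual q) (baseDual p) L')).comp (h0.map L')
  rw [Category.assoc, compBase_tensor, ← Category.assoc] at h2
  have h3 := h1.unique h2
  have h4 := (extendIso ψ).hom.naturality (cobaseMu p q).hom
  rw [extendIso_app, extendIso_app, extend_cobase] at h4
  rw [TensorCompat, extProd, ← cancel_mono (L'.map (cobaseMu p q).hom), extendIso_app, extendIso_app,
    extendIso_app, extend_cobase, extend_cobase, ← h3, Category.assoc, Category.assoc, h4]

/-- Write `Y` as `(b, I) ⊗ (I, p)` and rebracket: `(a, I) ⊗ (b, I)` is again a base object, so only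
known pairs occur. -/
lemma tensorCompat_base (a : C) (Y : PathInt C) : TensorCompat (extendIso ψ).hom (base a) Y :=
  ((tensorCompat_base_base ψ a Y.as.pos).assoc
    ((tensorCompat_base_cobase ψ (a ⊗ Y.as.pos) Y.as.neg).of_iso (baseMu _ _).symm (Iso.refl _))
    (tensorCompat_base_cobase ψ _ _)).of_iso (Iso.refl _) (decomp Y.as.pos Y.as.neg)

lemma tensorCompat_cobase (p : C) (Y : PathInt C) :
    TensorCompat (extendIso ψ).hom (cobase p) Y :=
  ((tensorCompat_cobase_cobase ψ p Y.as.neg).assoc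
    ((tensorCompat_base_cobase ψ Y.as.pos (Y.as.neg ⊗ p)).braid.of_iso (cobaseMu _ _).symm
      (Iso.refl _))
    (tensorCompat_base_cobase ψ _ _).braid).of_iso (Iso.refl _)
      (β_ _ _ ≪≫ decomp Y.as.pos Y.as.neg)

lemma tensorCompat_extendIso (X Y : PathInt C) : TensorCompat (extendIso ψ).hom X Y :=
  ((tensorCompat_cobase ψ X.as.neg Y).assoc' (tensorCompat_base ψ X.as.pos _)
    (tensorCompat_base_cobase ψ _ _)).of_iso (decomp X.as.pos X.as.neg) (Iso.refl _)

instance : NatTrans.IsMonoidal (extendIso ψ).hom where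
  unit := by
    have h : (extendIso ψ).hom.app (𝟙_ (PathInt C)) = (compBase ψ (𝟙_ C)).hom :=
      extend_base ψ (𝟙_ C)
    rw [h]
    exact compBase_unit ψ
  tensor X Y := tensorCompat_extendIso ψ X Y

/-- The components at `(I, p)` are forced by duality, and those at `(a, x)` by compatibility with
the tensor product and naturality at `decomp`. -/
lemma eq_extendIso (θ : L ≅ L') [NatTrans.IsMonoidal θ.hom]
    (h : ∀ a : C, θ.hom.app (base a) = (compBase ψ a).hom) : θ = extendIso ψ := by
  ext X
  have h1 := μ_map_extend ψ X.as.pos X.as.neg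
  have h2 := compat_of_isMonoidal (baseDual X.as.neg) θ.hom
  rw [h] at h2
  have h3 := NatTrans.IsMonoidal.tensor (τ := θ.hom) (base X.as.pos) (cobase X.as.neg)
  have h4 := θ.hom.naturality (decomp X.as.pos X.as.neg).hom
  rw [h2.unique (compat_compCobase ψ X.as.neg), h] at h3
  rw [← reassoc_of% h3, ← h4, cancel_epi, cancel_epi] at h1
  exact h1.symm

end Uniqueness

end PartialTrace

theorem mainTheorem10 {C : Type u₁} [Category.{v₁} C] [MonoidalCategory C] [SymmetricCategory C]
    [PartialTrace.PartiallyTraced C]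
    {D : Type u₂} [Category.{v₂} D] [MonoidalCategory D] [SymmetricCategory D]
    [LeftRigidCategory D]
    (G : C ⥤ D) [G.Braided] (hG : PartialTrace.PreservesTrace G) :
    (∃ (L : PartialTrace.PathInt C ⥤ D) (_ : L.Braided) (φ : PartialTrace.embed C ⋙ L ≅ G),
      NatTrans.IsMonoidal φ.hom) ∧
    ∀ (L L' : PartialTrace.PathInt C ⥤ D) [L.Braided] [L'.Braided]
      (φ : PartialTrace.embed C ⋙ L ≅ G) (φ' : PartialTrace.embed C ⋙ L' ≅ G),
      NatTrans.IsMonoidal φ.hom → NatTrans.IsMonoidal φ'.hom →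
      ∃! θ : L ≅ L', NatTrans.IsMonoidal θ.hom ∧
        Functor.whiskerLeft (PartialTrace.embed C) θ.hom ≫ φ'.hom = φ.hom := by
  refine ⟨PartialTrace.exists_extension G hG, fun L L' _ _ φ φ' hφ hφ' => ?_⟩
  -- The condition on `θ` says that its restriction along `embed C` is `φ` followed by the inverse
  -- of `φ'`; this is the isomorphism to be extended.
  have hψ : NatTrans.IsMonoidal (φ ≪≫ φ'.symm).hom :=
    inferInstanceAs (NatTrans.IsMonoidal (φ.hom ≫ φ'.inv))
  refine ⟨PartialTrace.extendIso (φ ≪≫ φ'.symm), ⟨inferInstance, ?_⟩, ?_⟩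
  · ext a
    refine (congrArg (· ≫ φ'.hom.app a) (PartialTrace.extend_base (φ ≪≫ φ'.symm) a)).trans ?_
    change (φ.hom.app a ≫ φ'.inv.app a) ≫ φ'.hom.app a = φ.hom.app a
    exact (Category.assoc _ _ _).trans
      ((congrArg (φ.hom.app a ≫ ·) (Iso.inv_hom_id_app φ' a)).trans (Category.comp_id _))
  · rintro θ ⟨hθ, h⟩
    refine PartialTrace.eq_extendIso _ θ fun a => ?_
    exact (Iso.eq_comp_inv (φ'.app a)).2 (NatTrans.congr_app h a)
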